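/- **Setting.** Let $\mu(t,z)$, $(t,z)\in\mathbb R^2$, be a stationary, mean zero random field with twice continuously differentiable realizations, such that $\mu$ and its partial derivatives of order one and two are bounded by a deterministic constant. Let $\Phi(t,z)=\mathbb E[\mu(t''+t,z''+z)\,\mu(t'',z'')]$, with $\Phi(0,0)=\int_{\mathbb R}\Phi(t,0)\,dt=\int_{\mathbb R}\Phi(0,z)\,dz=1$. Consider two regimes: *regime 1* (slowly changing medium), $0\le\alpha\le1$, $\beta=2$; *regime 2* (rapidly changing medium), $\alpha=2$, $0\le\beta\le1$. Assume the following mixing condition with constants $C$ and $d>2$, for each of the three fields $X=\mu,\ \partial_t\mu,\ \partial_z\mu$. In regime 1, let $\mathcal F_z=\sigma(\mu(t,z'):\ z'\le z,\ t\in\mathbb R)$; for all $t,t',z$, all $\Delta z>0$ and all $z_1,z_2\ge z+\Delta z$, almost surely $$\big|\mathbb E[X(t,z+\Delta z)\,|\,\mathcal F_z]\big|\le C(\Delta z)^{-d},\qquad \big|\mathbb E[X(t,z_1)X(t',z_2)\,|\,\mathcal F_z]-\mathbb E[X(t,z_1)X(t',z_2)]\big|\le C(\Delta z)^{-d}.$$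 In regime 2 the same holds with the roles of time and range exchanged, the $\sigma$-algebras being generated by $\mu$ at times up to $t$. Let $c_o,\rho,T,S>0$ and $L\ge c_oT$, and let $f:\mathbb R\to\mathbb R$ be continuously differentiable and supported in $[0,S]$. For small $\varepsilon>0$ let $$c_\varepsilon(t,z)=c_o\big[1+\varepsilon\mu(t/\varepsilon^\alpha,z/\varepsilon^\beta)\big]^{-1},\qquad \zeta_\varepsilon=\rho c_\varepsilon,$$ let $(p_\varepsilon,u_\varepsilon)$ be the classical solution of $$\rho\,\partial_tu_\varepsilon+\partial_zp_\varepsilon=0,\qquad \frac1{\rho c_\varepsilon^2}\,\partial_tp_\varepsilon+\partial_zu_\varepsilon=0,\qquad t\in\mathbb R,\ 0<z<L,$$ with $p_\varepsilon=u_\varepsilon=0$ for $t<0$ and, for the right and left going waves $A_\varepsilon=\zeta_\varepsilon^{-1/2}p_\varepsilon+\zeta_\varepsilon^{1/2}u_\varepsilon$ and $B_\varepsilon=-\zeta_\varepsilon^{-1/2}p_\varepsilon+\zeta_\varepsilon^{1/2}u_\varepsilon$, the boundary conditions $A_\varepsilon(t,0)=f(t/\varepsilon^2)$ and $B_\varepsilon(t,L)=0$.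 Let $t_\varepsilon(z,s)=\varepsilon^2s+\int_0^z dz'/c_\varepsilon(t_\varepsilon(z',s),z')$ be the random travel time along the right going characteristics, and define the wave front $a_\varepsilon(\tau,s)=A_\varepsilon(t_\varepsilon(c_o\tau,s),c_o\tau)$. **Theorem 1 (pulse stabilization).** In regime 1 or 2, the wave front $a_\varepsilon(\tau,s)$ converges in probability as $\varepsilon\to0$, in the space of continuous functions on $[0,T]\times[0,S]$ with the supremum norm, to the deterministic function $\overline a(\tau,s)$ which is the unique continuous solution, for $\tau\ge0$ and $0\le s\le S$, of $$\partial_\tau\overline a(\tau,s)=-\frac{c_o^2}{8}\int_0^s\overline a(\tau,y)\,\Psi\Big(\frac{s-y}2\Big)dy,\quad \tau>0,\qquad \overline a(0,s)=f(s),$$ where $\Psi(s)=-\partial_z^2\Phi(0,c_os)$ in regime 1 and $\Psi(s)=c_o^{-2}\,\partial_t^2\Phi(s,0)$ in regime 2. The kernel $\Psi$ is integrable on $(0,\infty)$, and with $\hat f(\omega)=\int_{\mathbb R}f(s)e^{i\omega s}ds$, $$\overline a(\tau,s)=\int_{-\infty}^\infty\frac{d\omega}{2\pi}\,\hat f(\omega)\exp\Big[-i\omega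 s-\frac{c_o^2\tau}{4}\int_0^\infty\Psi(u)e^{2i\omega u}du\Big],$$ the integral over $\omega$ being absolutely convergent. -/

import Mathlib

open MeasureTheory Set Filter Topology

noncomputable section

namespace PulseFront

/-! ### The random medium -/

/-- Partial derivative in time of a field `m t z`. -/
def timeDeriv (m : ℝ → ℝ → ℝ) (t z : ℝ) : ℝ := deriv (fun t' => m t' z) t

/-- Partial derivative in range of a field `m t z`. -/
def rangeDeriv (m : ℝ → ℝ → ℝ) (t z : ℝ) : ℝ := deriv (fun z' => m t z') z

section Medium

variable {Ω : Type*} [MeasurableSpace Ω]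

/-- The random field `∂_t μ`. -/
def fieldT (μ : ℝ → ℝ → Ω → ℝ) (t z : ℝ) (ω : Ω) : ℝ := timeDeriv (fun t' z' => μ t' z' ω) t z

/-- The random field `∂_z μ`. -/
def fieldZ (μ : ℝ → ℝ → Ω → ℝ) (t z : ℝ) (ω : Ω) : ℝ := rangeDeriv (fun t' z' => μ t' z' ω) t z

/-- The autocorrelation `Φ(t,z) = E[μ(t''+t, z''+z) μ(t'',z'')]`; by stationarity the base point
`(t'',z'')` is irrelevant and is taken to be the origin. -/
def autocorr (P : Measure Ω) (μ : ℝ → ℝ → Ω → ℝ) (t z : ℝ) : ℝ :=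
  ∫ ω, μ t z ω * μ 0 0 ω ∂P

/-- The sigma-algebra generated by the field at ranges up to `z` (and all times). -/
abbrev rangeHistory (μ : ℝ → ℝ → Ω → ℝ) (z : ℝ) : MeasurableSpace Ω :=
  ⨆ (z' : ℝ) (_ : z' ≤ z) (t : ℝ), MeasurableSpace.comap (μ t z') inferInstance

/-- The sigma-algebra generated by the field at times up to `t` (and all ranges). -/
abbrev timeHistory (μ : ℝ → ℝ → Ω → ℝ) (t : ℝ) : MeasurableSpace Ω :=
  ⨆ (t' : ℝ) (_ : t' ≤ t) (z : ℝ), MeasurableSpace.comap (μ t' z) inferInstance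

/-- Mixing of the field `X r q` with respect to the histories `𝓗 r`, where `r` is the coordinate
along which correlations decay and `q` is the other coordinate: conditional means and
conditional second moments given the history up to `r` approach their unconditional values
(the mean being zero) at the rate `C (Δr)^{-d}`. -/
structure IsMixing (P : Measure Ω) (𝓗 : ℝ → MeasurableSpace Ω) (C d : ℝ)
    (X : ℝ → ℝ → Ω → ℝ) : Prop where
  first : ∀ r q δ : ℝ, 0 < δ → ∀ᵐ ω ∂P, |(P[X (r + δ) q | 𝓗 r]) ω| ≤ C * δ ^ (-d)
  second : ∀ r δ r₁ r₂ q₁ q₂ : ℝ, 0 < δ → r + δ ≤ r₁ → r + δ ≤ r₂ →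
    ∀ᵐ ω ∂P, |(P[fun ω' => X r₁ q₁ ω' * X r₂ q₂ ω' | 𝓗 r]) ω
        - ∫ ω', X r₁ q₁ ω' * X r₂ q₂ ω' ∂P| ≤ C * δ ^ (-d)

/-- Strict stationarity: the law of the field (on the space of all functions of `(t,z)` with the
product sigma-algebra) is invariant under shifts of time and range. -/
def IsStationary (P : Measure Ω) (μ : ℝ → ℝ → Ω → ℝ) : Prop :=
  ∀ h k : ℝ, P.map (fun ω (x : ℝ × ℝ) => μ (x.1 + h) (x.2 + k) ω)
    = P.map (fun ω (x : ℝ × ℝ) => μ x.1 x.2 ω)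

/-- The two scaling regimes: slowly changing and rapidly changing medium. -/
inductive Regime
  | slow
  | rapid

/-- Exponents: `ε^α` is the correlation time and `ε^β` the correlation length. -/
def Regime.Exponents : Regime → ℝ → ℝ → Prop
  | .slow, α, β => 0 ≤ α ∧ α ≤ 1 ∧ β = 2
  | .rapid, α, β => α = 2 ∧ 0 ≤ β ∧ β ≤ 1

/-- The mixing assumption on a field `X t z` built from `μ`: in range for the slowly changing
medium, in time for the rapidly changing one. -/
def Regime.Mixing (R : Regime) (P : Measure Ω) (μ : ℝ → ℝ → Ω → ℝ) (C d : ℝ)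
    (X : ℝ → ℝ → Ω → ℝ) : Prop :=
  match R with
  | .slow => IsMixing P (rangeHistory μ) C d (fun z t => X t z)
  | .rapid => IsMixing P (timeHistory μ) C d X

/-- The kernel `Ψ`: `-∂_z²Φ(0, c₀ s)` for the slowly changing medium and `c₀⁻² ∂_t²Φ(s, 0)` for
the rapidly changing one. -/
def Regime.kernel (R : Regime) (c₀ : ℝ) (Φ : ℝ → ℝ → ℝ) (s : ℝ) : ℝ :=
  match R with
  | .slow => -iteratedDeriv 2 (fun z => Φ 0 z) (c₀ * s)
  | .rapid => (c₀ ^ 2)⁻¹ * iteratedDeriv 2 (fun t => Φ t 0) s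

/-- The standing assumptions on the random fluctuations `μ(t,z)`. -/
structure IsRandomMedium (R : Regime) (P : Measure Ω) (μ : ℝ → ℝ → Ω → ℝ) : Prop where
  measurable : ∀ t z, Measurable (μ t z)
  stationary : IsStationary P μ
  mean_zero : ∀ t z, ∫ ω, μ t z ω ∂P = 0
  smooth : ∀ ω, ContDiff ℝ 2 (fun x : ℝ × ℝ => μ x.1 x.2 ω)
  /-- The field and its first and second derivatives are bounded by a deterministic constant. -/
  bounded : ∃ M : ℝ, ∀ ω, ∀ x : ℝ × ℝ, ∀ k : ℕ, k ≤ 2 →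
    ‖iteratedFDeriv ℝ k (fun y : ℝ × ℝ => μ y.1 y.2 ω) x‖ ≤ M
  variance_one : autocorr P μ 0 0 = 1
  correlation_time_one : ∫ t, autocorr P μ t 0 = 1
  correlation_length_one : ∫ z, autocorr P μ 0 z = 1
  mixing : ∃ C d : ℝ, 2 < d ∧ R.Mixing P μ C d μ ∧ R.Mixing P μ C d (fieldT μ) ∧
    R.Mixing P μ C d (fieldZ μ)

end Medium

/-! ### The acoustic waves in one realization of the medium -/

/-- The local wave speed `c_ε(t,z) = c₀ / (1 + ε m(t/ε^α, z/ε^β))`. -/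
def localSpeed (c₀ α β ε : ℝ) (m : ℝ → ℝ → ℝ) (t z : ℝ) : ℝ :=
  c₀ * (1 + ε * m (t / ε ^ α) (z / ε ^ β))⁻¹

/-- The right going wave `A = ζ^{-1/2} p + ζ^{1/2} u`, where `ζ = ρ c` is the impedance. -/
def rightGoing (ρ : ℝ) (c p u : ℝ → ℝ → ℝ) (t z : ℝ) : ℝ :=
  (√(ρ * c t z))⁻¹ * p t z + √(ρ * c t z) * u t z

/-- The left going wave `B = -ζ^{-1/2} p + ζ^{1/2} u`. -/
def leftGoing (ρ : ℝ) (c p u : ℝ → ℝ → ℝ) (t z : ℝ) : ℝ :=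
  -(√(ρ * c t z))⁻¹ * p t z + √(ρ * c t z) * u t z

/-- `(p, u)` is a classical solution of the acoustic equations with density `ρ` and bulk modulus
`K = ρ c²` in the range interval `(0, L)`, quiescent for negative times, with the pulse `g(t)`
impinging at `z = 0` and no left going wave entering at `z = L`. -/
structure IsAcousticWave (ρ L : ℝ) (c : ℝ → ℝ → ℝ) (g : ℝ → ℝ) (p u : ℝ → ℝ → ℝ) : Prop where
  continuous_p : ContinuousOn (fun x : ℝ × ℝ => p x.1 x.2) (univ ×ˢ Icc 0 L)
  continuous_u : ContinuousOn (fun x : ℝ × ℝ => u x.1 x.2) (univ ×ˢ Icc 0 L)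
  differentiable_p : DifferentiableOn ℝ (fun x : ℝ × ℝ => p x.1 x.2) (univ ×ˢ Ioo 0 L)
  differentiable_u : DifferentiableOn ℝ (fun x : ℝ × ℝ => u x.1 x.2) (univ ×ˢ Ioo 0 L)
  momentum : ∀ t, ∀ z ∈ Ioo 0 L, ρ * timeDeriv u t z + rangeDeriv p t z = 0
  mass : ∀ t, ∀ z ∈ Ioo 0 L, (ρ * c t z ^ 2)⁻¹ * timeDeriv p t z + rangeDeriv u t z = 0
  quiescent : ∀ t < 0, ∀ z ∈ Icc 0 L, p t z = 0 ∧ u t z = 0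
  incoming : ∀ t, rightGoing ρ c p u t 0 = g t
  outgoing : ∀ t, leftGoing ρ c p u t L = 0

/-- `θ` is the travel time along the right going characteristic that leaves `z = 0` at time `t₀`:
`θ(z) = t₀ + ∫_0^z dz' / c(θ(z'), z')`. -/
def IsTravelTime (L : ℝ) (c : ℝ → ℝ → ℝ) (t₀ : ℝ) (θ : ℝ → ℝ) : Prop :=
  ContinuousOn θ (Icc 0 L) ∧
    ∀ z ∈ Icc 0 L, θ z = t₀ + ∫ z' in (0 : ℝ)..z, (c (θ z') z')⁻¹

/-- The wave front `a(τ,s) = A(θ(c₀ τ, s), c₀ τ)`, where `θ s z` is the travel time to the range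
`z` along the characteristic with parameter `s`. -/
def waveFront (c₀ ρ : ℝ) (c p u : ℝ → ℝ → ℝ) (θ : ℝ → ℝ → ℝ) (τ s : ℝ) : ℝ :=
  rightGoing ρ c p u (θ s (c₀ * τ)) (c₀ * τ)

/-! ### The limit -/

/-- The Fourier transform `∫ f(s) e^{iws} ds` of the pulse. -/
def pulseHat (f : ℝ → ℝ) (w : ℝ) : ℂ :=
  ∫ s : ℝ, (f s : ℂ) * Complex.exp (Complex.I * w * s)

/-- The integrand `(2π)⁻¹ f̂(w) exp[-iws - (c₀² τ / 4) ∫_0^∞ Ψ(u) e^{2iwu} du]`. -/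
def fourierIntegrand (c₀ : ℝ) (Ψ f : ℝ → ℝ) (τ s w : ℝ) : ℂ :=
  (2 * Real.pi : ℂ)⁻¹ * pulseHat f w *
    Complex.exp (-(Complex.I * w * s) - (c₀ ^ 2 * τ / 4 : ℂ) *
      ∫ u in Ioi (0 : ℝ), (Ψ u : ℂ) * Complex.exp (2 * Complex.I * w * u))

/-- `b(τ,s)`, for `τ ≥ 0` and `0 ≤ s ≤ S`, is a continuous solution of
`∂_τ b(τ,s) = -(c₀²/8) ∫_0^s b(τ,y) Ψ((s-y)/2) dy` for `τ > 0`, with `b(0,s) = f(s)`. -/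
structure SolvesLimitProblem (c₀ S : ℝ) (Ψ f : ℝ → ℝ) (b : ℝ → ℝ → ℝ) : Prop where
  continuous : ContinuousOn (fun x : ℝ × ℝ => b x.1 x.2) (Ici 0 ×ˢ Icc 0 S)
  evolution : ∀ τ > 0, ∀ s ∈ Icc 0 S,
    HasDerivAt (fun τ' => b τ' s)
      (-(c₀ ^ 2 / 8) * ∫ y in (0 : ℝ)..s, b τ y * Ψ ((s - y) / 2)) τ
  initial : ∀ s ∈ Icc 0 S, b 0 s = f s

end PulseFront

end

/-!
# Pulse stabilization in a time dependent random medium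

Measure range in units of travel time, `ξ = z / c₀`, and write the slowness of the medium as
`w = 1 + ε n`, where the field `n(x, y)` decorrelates in `x` (range in the slow regime, time in the
rapid one), which is resolved on the scale `ε²`, while `y` is resolved on a scale `κ ∈ [ε, 1]`. Along
their characteristics the right and left going waves satisfy `A' = -Gp B` and `B' = -Gm A`, with
coupling coefficients of size `1/ε` whose leading parts are `j / (2ε)` and `σ j / (2ε)`. Here `j` is
the partial derivative `nx` of `n`, and the sign `σ` is `+1` in the slow regime and `-1` in the rapid
one.

Substituting the equation for `B` into that for `A` produces a double integral. A left going
characteristic reaches the front at the point `(Θ_s(ξ), ξ)` after having left the front at the range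
`ξ + ε² h`, where the front carried the label `s - 2h`; the factors `1/ε` are compensated by the
length `ε² dh`. The kernel that results is `σ j jh / 4`, with `jh` the value of `nx` at the distance
`σ h` in the coordinate `x`. By stationarity its mean is `k(h) / 4 = c₀² Ψ(h) / 4`, since the
correlation function of the derivative of a process is minus the second derivative of the correlation
function. So the front `a(ξ, s)` is compared with the solution of
`b(ξ, s) = f(s) - (1/4) ∫₀^ξ ∫ k(h) b(x, s - 2h) dh dx`, which is the limit problem.

The comparison (`IsFrontApprox.front_error`) is deterministic. The error is measured in a maximum norm
with the weight `exp (-l Θ_s(ξ))`, in which the double integral is a contraction for large `l`. It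
requires that
* the labels of characteristics are preserved up to `o(ε²)`, and
* the kernel, integrated along a characteristic against `b`, averages to `k`.

Both reduce to averages of the medium along the diagonal `x = r / ε²`, `y = r / κ`: of `n`, which keeps
the characteristics within `o(κ)` of the diagonal; of `ny`, the coefficient of the linearized
equation for the separation of two characteristics (`IsDriftField.abs_sub_sub_le`); and of
`σ nx(x, y) nx(x + σ h, y) - k(h)` (`IsMediumFlow.average`). In the slow regime the characteristics
themselves solve an equation with decorrelating right-hand side; in the rapid regime their inverse
functions do, and integrals over the range are transformed to integrals over time.

These averages tend to zero in probability by a weak law of large numbers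
(`tendsto_measure_integral_of_decorrelated`): the mixing condition makes the correlation of the
integrand at two different points of the diagonal tend to zero, since their distance in `x` is of
order `ε⁻²`. Equicontinuity makes the convergence uniform in the end points and in `s`.

The limit problem is solved by the Fourier formula. The pulse has an integrable Fourier transform, as
`f` and `f'` are square integrable; differentiation under the integral sign gives the evolution
equation in the form of an integral over `(0, ∞)`, and uniqueness of the associated Volterra equation on the
half line shows that the solution vanishes for `s ≤ 0`, which restricts the integral to `(0, s)`.
-/

noncomputable section

namespace PulseFront

open scoped NNReal

/-! ### Scalar differential equations -/

/-- Global solution of a scalar equation with bounded Lipschitz right-hand side, obtained by gluing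
the Picard-Lindelöf solutions on growing intervals. -/
theorem exists_forall_hasDerivAt {F : ℝ → ℝ → ℝ} {K : ℝ≥0} {C : ℝ}
    (hF : ∀ q, Continuous fun r => F r q) (hK : ∀ r, LipschitzWith K (F r))
    (hC : ∀ r q, |F r q| ≤ C) (r₀ q₀ : ℝ) :
    ∃ q : ℝ → ℝ, q r₀ = q₀ ∧ ∀ r, HasDerivAt q (F r (q r)) r := by
  have hC0 : 0 ≤ C := (abs_nonneg _).trans (hC 0 0)
  have loc : ∀ n : ℕ, ∃ q : ℝ → ℝ, q r₀ = q₀ ∧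
      ∀ r ∈ Ioo (r₀ - (n + 1)) (r₀ + (n + 1)), HasDerivAt q (F r (q r)) r := by
    intro n
    have hn : (0 : ℝ) < n + 1 := by positivity
    have hmem : r₀ ∈ Icc (r₀ - (n + 1)) (r₀ + (n + 1)) := ⟨by linarith, by linarith⟩
    have hPL : IsPicardLindelof F (tmin := r₀ - (n + 1)) (tmax := r₀ + (n + 1)) ⟨r₀, hmem⟩ q₀
        (Real.toNNReal (C * (n + 1))) 0 (Real.toNNReal C) K := by
      refine ⟨fun t _ => (hK t).lipschitzOnWith, fun x _ => (hF x).continuousOn, ?_, ?_⟩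
      · intro t _ x _
        rw [Real.coe_toNNReal _ hC0]
        exact hC t x
      · rw [Real.coe_toNNReal _ hC0, Real.coe_toNNReal _ (by positivity)]
        simp
    obtain ⟨q, hq0, hq⟩ := hPL.exists_eq_forall_mem_Icc_hasDerivWithinAt₀
    exact ⟨q, hq0, fun r hr => (hq r (Ioo_subset_Icc_self hr)).hasDerivAt (Icc_mem_nhds hr.1 hr.2)⟩
  choose Q hQ0 hQ using loc
  have agree : ∀ m n : ℕ, m ≤ n → EqOn (Q m) (Q n) (Ioo (r₀ - (m + 1)) (r₀ + (m + 1))) := by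
    intro m n hmn
    have hm : (0 : ℝ) < m + 1 := by positivity
    have hmn' : (m : ℝ) ≤ n := by exact_mod_cast hmn
    refine ODE_solution_unique_of_mem_Ioo (v := F) (s := fun _ => univ) (K := K) (t₀ := r₀)
      (fun t _ => (hK t).lipschitzOnWith) ⟨by linarith, by linarith⟩
      (fun t ht => ⟨hQ m t ht, trivial⟩)
      (fun t ht => ⟨hQ n t ⟨by linarith [ht.1], by linarith [ht.2]⟩, trivial⟩) ?_
    rw [hQ0, hQ0]
  refine ⟨fun r => Q ⌈|r - r₀|⌉₊ r, by simp [hQ0], fun r => ?_⟩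
  set N := ⌈|r - r₀|⌉₊ + 1 with hN
  have hrN : |r - r₀| ≤ ⌈|r - r₀|⌉₊ := Nat.le_ceil _
  have hev : (fun r => Q ⌈|r - r₀|⌉₊ r) =ᶠ[𝓝 r] Q N := by
    have hnear : ∀ᶠ r' in 𝓝 r, |r' - r₀| < ⌈|r - r₀|⌉₊ + 1 := by
      have : Continuous fun r' : ℝ => |r' - r₀| := by fun_prop
      exact this.continuousAt.eventually_lt continuousAt_const (by linarith)
    filter_upwards [hnear] with r' hr'
    have h1 : ⌈|r' - r₀|⌉₊ ≤ N := by
      rw [Nat.ceil_le, hN]; push_cast; linarith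
    refine agree _ _ h1 ?_
    have h2 := Nat.le_ceil (|r' - r₀|)
    have h3 := abs_le.mp h2
    exact ⟨by linarith [h3.1], by linarith [h3.2]⟩
  have hmem : r ∈ Ioo (r₀ - (N + 1)) (r₀ + (N + 1)) := by
    have h3 := abs_le.mp hrN
    rw [hN]; push_cast
    exact ⟨by linarith [h3.1], by linarith [h3.2]⟩
  have := (hQ N r hmem).congr_of_eventuallyEq hev
  rwa [← hev.eq_of_nhds] at this

/-- Solution curves of a scalar equation do not cross, forwards or backwards. -/
theorem le_of_hasDerivAt_of_le {F : ℝ → ℝ → ℝ} {K : ℝ≥0} (hK : ∀ r, LipschitzWith K (F r))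
    {q₁ q₂ : ℝ → ℝ} (h₁ : ∀ r, HasDerivAt q₁ (F r (q₁ r)) r)
    (h₂ : ∀ r, HasDerivAt q₂ (F r (q₂ r)) r) {r₀ : ℝ} (h : q₁ r₀ ≤ q₂ r₀) (r : ℝ) :
    q₁ r ≤ q₂ r := by
  by_contra! hr
  have hc : Continuous fun x => q₁ x - q₂ x :=
    continuous_iff_continuousAt.mpr fun x => ((h₁ x).sub (h₂ x)).continuousAt
  -- the two solutions meet somewhere, hence coincide
  obtain ⟨x, hx⟩ : ∃ x, q₁ x - q₂ x = 0 :=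
    mem_range_of_exists_le_of_exists_ge hc ⟨r₀, by linarith⟩ ⟨r, by linarith⟩
  have := ODE_solution_unique_univ (v := F) (s := fun _ => univ) (K := K) (t₀ := x)
    (fun t => (hK t).lipschitzOnWith) (fun t => ⟨h₁ t, trivial⟩) (fun t => ⟨h₂ t, trivial⟩)
    (by linarith)
  rw [this] at hr
  exact lt_irrefl _ hr

theorem abs_sub_le_of_hasDerivAt {F : ℝ → ℝ → ℝ} {K : ℝ≥0} (hK : ∀ r, LipschitzWith K (F r))
    {q₁ q₂ : ℝ → ℝ} (h₁ : ∀ r, HasDerivAt q₁ (F r (q₁ r)) r)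
    (h₂ : ∀ r, HasDerivAt q₂ (F r (q₂ r)) r) {r₀ r : ℝ} (hr : r₀ ≤ r) :
    |q₁ r - q₂ r| ≤ |q₁ r₀ - q₂ r₀| * Real.exp (K * (r - r₀)) := by
  have := dist_le_of_trajectories_ODE (v := F) (K := K) (f := q₁) (g := q₂) (a := r₀) (b := r)
    (δ := |q₁ r₀ - q₂ r₀|) hK
    (fun x _ => (h₁ x).continuousAt.continuousWithinAt) (fun x _ => (h₁ x).hasDerivWithinAt)
    (fun x _ => (h₂ x).continuousAt.continuousWithinAt) (fun x _ => (h₂ x).hasDerivWithinAt)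
    (by rw [Real.dist_eq]) r ⟨hr, le_rfl⟩
  rwa [Real.dist_eq] at this

/-- Along an increasing curve the weight `exp (λ T)` integrates to `O(1/λ)` times its final
value. -/
theorem integral_exp_le_of_half_le {T T' : ℝ → ℝ} {a b l : ℝ} (hab : a ≤ b) (hl : 0 < l)
    (hT : ∀ x, HasDerivAt T (T' x) x) (hc : Continuous T') (h : ∀ x, 1 / 2 ≤ T' x) :
    ∫ x in a..b, Real.exp (l * T x) ≤ 2 / l * Real.exp (l * T b) := by
  have hTc : Continuous T := continuous_iff_continuousAt.mpr fun x => (hT x).continuousAt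
  have hder : ∀ x ∈ uIcc a b, HasDerivAt (fun x => Real.exp (l * T x))
      (Real.exp (l * T x) * (l * T' x)) x := fun x _ => ((hT x).const_mul l).exp
  have hint := intervalIntegral.integral_eq_sub_of_hasDerivAt hder
    (by apply Continuous.intervalIntegrable; fun_prop)
  have hle : ∫ x in a..b, Real.exp (l * T x) * (l / 2) ≤
      ∫ x in a..b, Real.exp (l * T x) * (l * T' x) := by
    apply intervalIntegral.integral_mono_on hab
    · apply Continuous.intervalIntegrable; fun_prop
    · apply Continuous.intervalIntegrable; fun_prop
    · intro x _
      have := h x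
      have h2 : l / 2 ≤ l * T' x := by nlinarith
      gcongr
  rw [hint, intervalIntegral.integral_mul_const] at hle
  have := Real.exp_pos (l * T a)
  rw [div_mul_eq_mul_div, le_div_iff₀ hl]
  linarith

theorem integral_exp_le_of_le_neg_half {T T' : ℝ → ℝ} {a b l : ℝ} (hab : a ≤ b) (hl : 0 < l)
    (hT : ∀ x, HasDerivAt T (T' x) x) (hc : Continuous T') (h : ∀ x, T' x ≤ -(1 / 2)) :
    ∫ x in a..b, Real.exp (l * T x) ≤ 2 / l * Real.exp (l * T a) := by
  have := integral_exp_le_of_half_le (T := fun x => T (-x)) (T' := fun x => -T' (-x)) (a := -b)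
    (b := -a) (by linarith) hl (fun x => ?_) (by fun_prop) (fun x => by have := h (-x); linarith)
  · rw [intervalIntegral.integral_comp_neg (fun x => Real.exp (l * T x))] at this
    simpa using this
  · have := (hT (-x)).comp x (hasDerivAt_neg x)
    simpa [Function.comp_def] using this

/-! ### The transport system in characteristic form -/

/-- The right and left going waves `A`, `B` as functions of time `t` and scaled range `ξ = z / c₀`,
in a medium with scaled slowness `w`, together with the right going characteristics `Θ s`. The
transport equations are stated along arbitrary characteristics. -/
structure IsFrontSystem (Λ ε K : ℝ) (f : ℝ → ℝ) (w Gp Gm A B : ℝ → ℝ → ℝ) (Θ : ℝ → ℝ → ℝ) :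
    Prop where
  pos : 0 < ε
  range_pos : 0 < Λ
  continuous_w : Continuous fun x : ℝ × ℝ => w x.1 x.2
  lipschitz_w : ∃ k : ℝ≥0, ∀ ξ, LipschitzWith k fun t => w t ξ
  near_one : ∀ t ξ, |w t ξ - 1| ≤ 1 / 2
  continuous_Gp : Continuous fun x : ℝ × ℝ => Gp x.1 x.2
  continuous_Gm : Continuous fun x : ℝ × ℝ => Gm x.1 x.2
  bound_Gp : ∀ t ξ, |Gp t ξ| ≤ K
  bound_Gm : ∀ t ξ, |Gm t ξ| ≤ K
  continuousOn_A : ContinuousOn (fun x : ℝ × ℝ => A x.1 x.2) (univ ×ˢ Icc 0 Λ)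
  continuousOn_B : ContinuousOn (fun x : ℝ × ℝ => B x.1 x.2) (univ ×ˢ Icc 0 Λ)
  transport_A : ∀ (T : ℝ → ℝ), ∀ ξ ∈ Ioo 0 Λ, HasDerivAt T (w (T ξ) ξ) ξ →
    HasDerivAt (fun x => A (T x) x) (-(Gp (T ξ) ξ * B (T ξ) ξ)) ξ
  transport_B : ∀ (T : ℝ → ℝ), ∀ ξ ∈ Ioo 0 Λ, HasDerivAt T (-w (T ξ) ξ) ξ →
    HasDerivAt (fun x => B (T x) x) (-(Gm (T ξ) ξ * A (T ξ) ξ)) ξ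
  quiescent : ∀ t < 0, ∀ ξ ∈ Icc 0 Λ, A t ξ = 0 ∧ B t ξ = 0
  incoming : ∀ t, A t 0 = f (t / ε ^ 2)
  outgoing : ∀ t, B t Λ = 0
  pulse_zero : ∀ s ≤ 0, f s = 0
  flow : ∀ s ξ, HasDerivAt (Θ s) (w (Θ s ξ) ξ) ξ
  flow_zero : ∀ s, Θ s 0 = ε ^ 2 * s

namespace IsFrontSystem

variable {Λ ε K : ℝ} {f : ℝ → ℝ} {w Gp Gm A B : ℝ → ℝ → ℝ} {Θ : ℝ → ℝ → ℝ}

theorem exists_right (H : IsFrontSystem Λ ε K f w Gp Gm A B Θ) (t ξ : ℝ) :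
    ∃ T : ℝ → ℝ, T ξ = t ∧ ∀ x, HasDerivAt T (w (T x) x) x := by
  obtain ⟨k, hk⟩ := H.lipschitz_w
  refine exists_forall_hasDerivAt (F := fun ξ t => w t ξ) (C := 3 / 2) (fun t => ?_) hk
    (fun ξ t => ?_) ξ t
  · exact H.continuous_w.comp (by fun_prop : Continuous fun r : ℝ => (t, r))
  · have := abs_le.mp (H.near_one t ξ)
    rw [abs_le]; constructor <;> linarith [this.1, this.2]

theorem exists_left (H : IsFrontSystem Λ ε K f w Gp Gm A B Θ) (t ξ : ℝ) :
    ∃ T : ℝ → ℝ, T ξ = t ∧ ∀ x, HasDerivAt T (-w (T x) x) x := by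
  obtain ⟨k, hk⟩ := H.lipschitz_w
  refine exists_forall_hasDerivAt (F := fun ξ t => -w t ξ) (C := 3 / 2) (K := k) (fun t => ?_)
    (fun r => (hk r).neg) (fun ξ t => ?_) ξ t
  · exact (H.continuous_w.comp (by fun_prop : Continuous fun r : ℝ => (t, r))).neg
  · have := abs_le.mp (H.near_one t ξ)
    rw [abs_le]; constructor <;> linarith [this.1, this.2]

theorem continuousOn_along {u : ℝ → ℝ → ℝ} {s : Set ℝ}
    (hu : ContinuousOn (fun x : ℝ × ℝ => u x.1 x.2) (univ ×ˢ s)) {T : ℝ → ℝ}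
    (hT : Continuous T) : ContinuousOn (fun x => u (T x) x) s :=
  hu.comp (f := fun x => (T x, x)) (by fun_prop) fun x hx => ⟨trivial, hx⟩

theorem A_eq (H : IsFrontSystem Λ ε K f w Gp Gm A B Θ) {T : ℝ → ℝ}
    (hT : ∀ x, HasDerivAt T (w (T x) x) x) {ξ : ℝ} (hξ : ξ ∈ Icc 0 Λ) :
    A (T ξ) ξ = f (T 0 / ε ^ 2) - ∫ x in (0 : ℝ)..ξ, Gp (T x) x * B (T x) x := by
  have hTc : Continuous T := continuous_iff_continuousAt.mpr fun x => (hT x).continuousAt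
  have hsub : Icc 0 ξ ⊆ Icc 0 Λ := Icc_subset_Icc_right hξ.2
  have := intervalIntegral.integral_eq_sub_of_hasDerivAt_of_le (a := 0) (b := ξ) hξ.1
    ((continuousOn_along H.continuousOn_A hTc).mono hsub)
    (fun x hx => H.transport_A T x ⟨hx.1, hx.2.trans_le hξ.2⟩ (hT x)) ?_
  · rw [intervalIntegral.integral_neg, H.incoming] at this
    linarith
  · apply ContinuousOn.intervalIntegrable
    rw [uIcc_of_le hξ.1]
    have h1 : ContinuousOn (fun x => Gp (T x) x) (Icc 0 ξ) :=
      (H.continuous_Gp.comp (by fun_prop : Continuous fun x => (T x, x))).continuousOn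
    exact (h1.mul ((continuousOn_along H.continuousOn_B hTc).mono hsub)).neg

theorem B_eq (H : IsFrontSystem Λ ε K f w Gp Gm A B Θ) {T : ℝ → ℝ}
    (hT : ∀ x, HasDerivAt T (-w (T x) x) x) {ξ : ℝ} (hξ : ξ ∈ Icc 0 Λ) :
    B (T ξ) ξ = ∫ x in ξ..Λ, Gm (T x) x * A (T x) x := by
  have hTc : Continuous T := continuous_iff_continuousAt.mpr fun x => (hT x).continuousAt
  have hsub : Icc ξ Λ ⊆ Icc 0 Λ := Icc_subset_Icc_left hξ.1
  have := intervalIntegral.integral_eq_sub_of_hasDerivAt_of_le (a := ξ) (b := Λ) hξ.2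
    ((continuousOn_along H.continuousOn_B hTc).mono hsub)
    (fun x hx => H.transport_B T x ⟨hξ.1.trans_lt hx.1, hx.2⟩ (hT x)) ?_
  · rw [intervalIntegral.integral_neg, H.outgoing] at this
    linarith
  · apply ContinuousOn.intervalIntegrable
    rw [uIcc_of_le hξ.2]
    have h1 : ContinuousOn (fun x => Gm (T x) x) (Icc ξ Λ) :=
      (H.continuous_Gm.comp (by fun_prop : Continuous fun x => (T x, x))).continuousOn
    exact (h1.mul ((continuousOn_along H.continuousOn_A hTc).mono hsub)).neg

theorem continuous_flow (H : IsFrontSystem Λ ε K f w Gp Gm A B Θ) (s : ℝ) : Continuous (Θ s) :=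
  continuous_iff_continuousAt.mpr fun x => (H.flow s x).continuousAt

theorem continuous_w_along (H : IsFrontSystem Λ ε K f w Gp Gm A B Θ) {T : ℝ → ℝ}
    (hT : Continuous T) : Continuous fun x => w (T x) x :=
  H.continuous_w.comp (by fun_prop : Continuous fun x => (T x, x))

theorem half_le_w (H : IsFrontSystem Λ ε K f w Gp Gm A B Θ) (t ξ : ℝ) : 1 / 2 ≤ w t ξ := by
  have := abs_le.mp (H.near_one t ξ); linarith [this.1]

theorem flow_monotone (H : IsFrontSystem Λ ε K f w Gp Gm A B Θ) (s : ℝ) : Monotone (Θ s) :=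
  monotone_of_deriv_nonneg (fun x => (H.flow s x).differentiableAt) fun x => by
    rw [(H.flow s x).deriv]; linarith [H.half_le_w (Θ s x) x]

/-- Finite speed of propagation: the waves vanish ahead of the leading characteristic. The proof
bounds the maximum of `exp (-λ t) max |A| |B|` ahead of the front by half of itself. -/
theorem eq_zero_ahead (H : IsFrontSystem Λ ε K f w Gp Gm A B Θ) {t ξ : ℝ} (hξ : ξ ∈ Icc 0 Λ)
    (ht : t ≤ Θ 0 ξ) : A t ξ = 0 ∧ B t ξ = 0 := by
  obtain ⟨k, hk⟩ := H.lipschitz_w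
  have hK0 : 0 ≤ K := (abs_nonneg _).trans (H.bound_Gp 0 0)
  set l : ℝ := 4 * K + 1 with hl
  have hl0 : 0 < l := by positivity
  have hΘ0 : Θ 0 0 = 0 := by rw [H.flow_zero]; simp
  set D : Set (ℝ × ℝ) := (Icc (-1) (Θ 0 Λ) ×ˢ Icc 0 Λ) ∩ {x | x.1 ≤ Θ 0 x.2} with hD
  have hDc : IsCompact D := (isCompact_Icc.prod isCompact_Icc).inter_right
    (isClosed_le continuous_fst ((H.continuous_flow 0).comp continuous_snd))
  have hΛ0 : 0 ≤ Θ 0 Λ := by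
    have := H.flow_monotone 0 H.range_pos.le
    rwa [hΘ0] at this
  have hDne : D.Nonempty := ⟨(0, 0), ⟨⟨⟨by norm_num, hΛ0⟩, ⟨le_rfl, H.range_pos.le⟩⟩, hΘ0.ge⟩⟩
  have hsub : D ⊆ univ ×ˢ Icc 0 Λ := fun x hx => ⟨trivial, hx.1.2⟩
  set φ : ℝ × ℝ → ℝ := fun x => Real.exp (-(l * x.1)) * max |A x.1 x.2| |B x.1 x.2| with hφ
  have hφc : ContinuousOn φ D := by
    have hA := (H.continuousOn_A.mono hsub).abs
    have hB := (H.continuousOn_B.mono hsub).abs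
    exact (by fun_prop : ContinuousOn (fun x : ℝ × ℝ => Real.exp (-(l * x.1))) D).mul (hA.sup hB)
  obtain ⟨x₀, hx₀, hmax⟩ := hDc.exists_isMaxOn hDne hφc
  set W := φ x₀ with hW
  have hW0 : 0 ≤ W := by positivity
  -- every point ahead of the front obeys the weighted bound
  have key : ∀ t ξ, ξ ∈ Icc 0 Λ → t ≤ Θ 0 ξ → max |A t ξ| |B t ξ| ≤ W * Real.exp (l * t) := by
    intro t ξ hξ ht
    by_cases h : t < 0
    · obtain ⟨h1, h2⟩ := H.quiescent t h ξ hξ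
      rw [h1, h2]; simp; positivity
    · have hmem : (t, ξ) ∈ D :=
        ⟨⟨⟨by linarith, ht.trans (H.flow_monotone 0 hξ.2)⟩, hξ⟩, ht⟩
      have : Real.exp (-(l * t)) * max |A t ξ| |B t ξ| ≤ W := hmax hmem
      rwa [Real.exp_neg, inv_mul_le_iff₀ (Real.exp_pos _), mul_comm] at this
  have improve : ∀ t ξ, ξ ∈ Icc 0 Λ → t ≤ Θ 0 ξ →
      max |A t ξ| |B t ξ| ≤ W / 2 * Real.exp (l * t) := by
    intro t ξ hξ ht
    have hfrac : K * (2 / l) ≤ 1 / 2 := by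
      rw [← mul_div_assoc, div_le_iff₀ hl0]; linarith
    refine max_le ?_ ?_
    · obtain ⟨T, hT0, hT⟩ := H.exists_right t ξ
      have hTc : Continuous T := continuous_iff_continuousAt.mpr fun x => (hT x).continuousAt
      have hle : ∀ x, T x ≤ Θ 0 x :=
        le_of_hasDerivAt_of_le (F := fun ξ t => w t ξ) hk hT (H.flow 0) (r₀ := ξ) (by rwa [hT0])
      have h0 : f (T 0 / ε ^ 2) = 0 := by
        apply H.pulse_zero
        have := hle 0
        rw [hΘ0] at this
        exact div_nonpos_of_nonpos_of_nonneg this (by positivity)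
      have hb : |∫ x in (0 : ℝ)..ξ, Gp (T x) x * B (T x) x| ≤
          ∫ x in (0 : ℝ)..ξ, K * W * Real.exp (l * T x) := by
        rw [← Real.norm_eq_abs]
        refine intervalIntegral.norm_integral_le_of_norm_le hξ.1 ?_
          (by apply Continuous.intervalIntegrable; fun_prop)
        refine Eventually.of_forall fun x hx => ?_
        rw [norm_mul, Real.norm_eq_abs, Real.norm_eq_abs, mul_assoc]
        exact mul_le_mul (H.bound_Gp _ _)
          ((le_max_right _ _).trans (key _ _ ⟨hx.1.le, hx.2.trans hξ.2⟩ (hle x)))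
          (abs_nonneg _) hK0
      have hexp := integral_exp_le_of_half_le (a := 0) (b := ξ) hξ.1 hl0 hT
        (H.continuous_w_along hTc) (fun x => H.half_le_w _ _)
      rw [intervalIntegral.integral_const_mul] at hb
      rw [← hT0, H.A_eq hT hξ, h0, zero_sub, abs_neg]
      calc _ ≤ K * W * (2 / l * Real.exp (l * T ξ)) :=
            hb.trans (mul_le_mul_of_nonneg_left hexp (by positivity))
        _ = (K * (2 / l)) * (W * Real.exp (l * T ξ)) := by ring
        _ ≤ 1 / 2 * (W * Real.exp (l * T ξ)) := by gcongr
        _ = _ := by ring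
    · obtain ⟨T, hT0, hT⟩ := H.exists_left t ξ
      have hTc : Continuous T := continuous_iff_continuousAt.mpr fun x => (hT x).continuousAt
      have hanti : Antitone T := antitone_of_deriv_nonpos (fun x => (hT x).differentiableAt)
        fun x => by rw [(hT x).deriv]; linarith [H.half_le_w (T x) x]
      have hle : ∀ x, ξ ≤ x → T x ≤ Θ 0 x := fun x hx =>
        (hanti hx).trans (hT0.le.trans (ht.trans (H.flow_monotone 0 hx)))
      have hb : |∫ x in ξ..Λ, Gm (T x) x * A (T x) x| ≤
          ∫ x in ξ..Λ, K * W * Real.exp (l * T x) := by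
        rw [← Real.norm_eq_abs]
        refine intervalIntegral.norm_integral_le_of_norm_le hξ.2 ?_
          (by apply Continuous.intervalIntegrable; fun_prop)
        refine Eventually.of_forall fun x hx => ?_
        rw [norm_mul, Real.norm_eq_abs, Real.norm_eq_abs, mul_assoc]
        exact mul_le_mul (H.bound_Gm _ _)
          ((le_max_left _ _).trans (key _ _ ⟨hξ.1.trans hx.1.le, hx.2⟩ (hle x hx.1.le)))
          (abs_nonneg _) hK0
      have hexp := integral_exp_le_of_le_neg_half (a := ξ) (b := Λ) hξ.2 hl0 hT
        (H.continuous_w_along hTc).neg (fun x => by linarith [H.half_le_w (T x) x])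
      rw [intervalIntegral.integral_const_mul] at hb
      rw [← hT0, H.B_eq hT hξ]
      calc _ ≤ K * W * (2 / l * Real.exp (l * T ξ)) :=
            hb.trans (mul_le_mul_of_nonneg_left hexp (by positivity))
        _ = (K * (2 / l)) * (W * Real.exp (l * T ξ)) := by ring
        _ ≤ 1 / 2 * (W * Real.exp (l * T ξ)) := by gcongr
        _ = _ := by ring
  have hWzero : W = 0 := by
    have h := improve x₀.1 x₀.2 hx₀.1.2 hx₀.2
    have : W ≤ W / 2 := by
      have h2 : Real.exp (-(l * x₀.1)) * max |A x₀.1 x₀.2| |B x₀.1 x₀.2| ≤ W / 2 := by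
        rwa [Real.exp_neg, inv_mul_le_iff₀ (Real.exp_pos _), mul_comm]
      exact h2
    linarith
  have := key t ξ hξ ht
  rw [hWzero, zero_mul] at this
  exact ⟨abs_nonpos_iff.mp ((le_max_left _ _).trans this),
    abs_nonpos_iff.mp ((le_max_right _ _).trans this)⟩

end IsFrontSystem

/-! ### Comparison of the wave front with its limit -/

/-- The limit profile as a function on the whole plane: continuous, zero for nonpositive labels,
and solving the limit problem in integral form; `k = c₀² Ψ`. The inner integral extends over
`[0, S + 1]` because the profile vanishes at negative labels. -/
structure IsProfile (S : ℝ) (k f : ℝ → ℝ) (b : ℝ → ℝ → ℝ) : Prop where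
  continuous : Continuous fun x : ℝ × ℝ => b x.1 x.2
  continuous_kernel : Continuous k
  eq_zero : ∀ τ ≥ 0, ∀ s ≤ 0, b τ s = 0
  eq : ∀ τ ≥ 0, ∀ s ∈ Icc 0 S,
    b τ s = f s - 1 / 4 * ∫ x in (0 : ℝ)..τ, ∫ h in (0 : ℝ)..(S + 1), k h * b x (s - 2 * h)

/-- A curve whose velocity is within `b` of `v` stays within `b |y - x|` of a line of slope `v`. -/
theorem abs_sub_drift_le {T T' : ℝ → ℝ} {v b : ℝ} (hT : ∀ x, HasDerivAt T (T' x) x)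
    (hb : ∀ x, |T' x - v| ≤ b) (x y : ℝ) : |T y - T x - v * (y - x)| ≤ b * |y - x| := by
  have := (convex_univ (𝕜 := ℝ) (E := ℝ)).norm_image_sub_le_of_norm_hasDerivWithin_le
    (f := fun x => T x - v * x) (f' := fun x => T' x - v) (C := b)
    (fun x _ => ((hT x).sub (by simpa using (hasDerivAt_id x).const_mul v)).hasDerivWithinAt)
    (fun x _ => hb x) (mem_univ x) (mem_univ y)
  rw [Real.norm_eq_abs, Real.norm_eq_abs] at this
  convert this using 2
  ring

namespace IsFrontSystem

variable {Λ ε K : ℝ} {f : ℝ → ℝ} {w Gp Gm A B : ℝ → ℝ → ℝ} {Θ : ℝ → ℝ → ℝ}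

theorem exists_flow_lipschitz (H : IsFrontSystem Λ ε K f w Gp Gm A B Θ) :
    ∃ k : ℝ≥0, ∀ ξ ∈ Icc 0 Λ, LipschitzWith k fun s => Θ s ξ := by
  obtain ⟨k, hk⟩ := H.lipschitz_w
  refine ⟨Real.toNNReal (ε ^ 2 * Real.exp (k * Λ)), fun ξ hξ => ?_⟩
  refine LipschitzWith.of_dist_le_mul fun s r => ?_
  rw [Real.coe_toNNReal _ (by positivity), Real.dist_eq, Real.dist_eq]
  have := abs_sub_le_of_hasDerivAt (F := fun ξ t => w t ξ) hk (H.flow s) (H.flow r) hξ.1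
  have h0 : |ε ^ 2 * s - ε ^ 2 * r| = ε ^ 2 * |s - r| := by
    rw [← mul_sub, abs_mul, abs_of_nonneg (by positivity)]
  rw [H.flow_zero, H.flow_zero, h0] at this
  have h2 : Real.exp (k * (ξ - 0)) ≤ Real.exp (k * Λ) :=
    Real.exp_le_exp.mpr (mul_le_mul_of_nonneg_left (by linarith [hξ.2]) k.2)
  calc _ ≤ _ := this
    _ ≤ ε ^ 2 * |s - r| * Real.exp (k * Λ) := by gcongr
    _ = _ := by ring

theorem continuousOn_flow (H : IsFrontSystem Λ ε K f w Gp Gm A B Θ) (s : Set ℝ) :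
    ContinuousOn (fun x : ℝ × ℝ => Θ x.2 x.1) (Icc 0 Λ ×ˢ s) := by
  obtain ⟨k, hk⟩ := H.exists_flow_lipschitz
  exact continuousOn_prod_of_continuousOn_lipschitzOnWith' _ k
    (fun a ha => (hk a ha).lipschitzOnWith) fun b _ => (H.continuous_flow b).continuousOn

theorem continuousOn_front (H : IsFrontSystem Λ ε K f w Gp Gm A B Θ) (s : Set ℝ) :
    ContinuousOn (fun x : ℝ × ℝ => A (Θ x.2 x.1) x.1) (Icc 0 Λ ×ˢ s) :=
  H.continuousOn_A.comp (f := fun x : ℝ × ℝ => (Θ x.2 x.1, x.1))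
    ((H.continuousOn_flow s).prodMk continuousOn_fst) fun _ hx => ⟨trivial, hx.1⟩

end IsFrontSystem

/-- The quantitative hypotheses under which the wave front is compared with its limit. Here `j` is
the leading part of `2 ε Gp`, `σ j` that of `2 ε Gm`, and `jh h t ξ` approximates `j` at the
point reached by the left going characteristic through `(t, ξ)` after the range `ε² h`. The labels
of the characteristics are preserved up to `η`, and the kernel `σ j jh` averages to `k` up to
`ηR`. -/
structure IsFrontApprox (Λ ε S M σ η ηR d ωd Ca : ℝ) (k : ℝ → ℝ) (w Gp Gm : ℝ → ℝ → ℝ)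
    (Θ : ℝ → ℝ → ℝ) (j : ℝ → ℝ → ℝ) (jh : ℝ → ℝ → ℝ → ℝ) (b : ℝ → ℝ → ℝ) : Prop where
  eps_le : ε ≤ 1
  S_pos : 0 < S
  M_pos : 0 < M
  sign : |σ| = 1
  eta_nonneg : 0 ≤ η
  eta_le : η ≤ 1
  drift : ∀ t ξ, |w t ξ - 1| ≤ M * ε
  continuous_j : Continuous fun x : ℝ × ℝ => j x.1 x.2
  continuous_jh : Continuous fun x : ℝ × ℝ × ℝ => jh x.1 x.2.1 x.2.2
  bound_jh : ∀ h t ξ, |jh h t ξ| ≤ M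
  approx_Gp : ∀ t ξ, |ε * Gp t ξ - j t ξ / 2| ≤ M * ε
  approx_Gm : ∀ t ξ, |ε * Gm t ξ - σ * j t ξ / 2| ≤ M * ε
  approx_jh : ∀ T : ℝ → ℝ, (∀ ξ, HasDerivAt T (-w (T ξ) ξ) ξ) → ∀ ξ, ∀ h ∈ Icc 0 (S + 1),
    |j (T (ξ + ε ^ 2 * h)) (ξ + ε ^ 2 * h) - jh h (T ξ) ξ| ≤ M * ε
  label : ∀ s ∈ Icc 0 S, ∀ ξ ∈ Icc 0 Λ, |Θ s ξ - Θ 0 ξ - ε ^ 2 * s| ≤ η * ε ^ 2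
  average : ∀ s ∈ Icc 0 S, ∀ ξ ∈ Icc 0 Λ,
    |∫ x in (0 : ℝ)..ξ, ∫ h in (0 : ℝ)..(S + 1),
      (σ * j (Θ s x) x * jh h (Θ s x) x - k h) * b x (s - 2 * h)| ≤ ηR
  bound_b : ∀ τ ∈ Icc 0 Λ, ∀ s ∈ Icc (-(2 * (S + 1))) S, |b τ s| ≤ Ca
  modulus_b : ∀ τ ∈ Icc 0 Λ, ∀ τ' ∈ Icc 0 Λ, ∀ s ∈ Icc (-(2 * (S + 1))) S,
    ∀ s' ∈ Icc (-(2 * (S + 1))) S, |τ - τ'| ≤ d → |s - s'| ≤ d → |b τ s - b τ' s'| ≤ ωd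
  d_ge : 2 * η + 2 * M * ε * (S + 1) + ε ^ 2 * (S + 1) ≤ d

namespace IsFrontApprox

variable {Λ ε S M σ η ηR d ωd Ca : ℝ} {k f : ℝ → ℝ} {w Gp Gm A B : ℝ → ℝ → ℝ} {Θ : ℝ → ℝ → ℝ}
  {j : ℝ → ℝ → ℝ} {jh : ℝ → ℝ → ℝ → ℝ} {b : ℝ → ℝ → ℝ}

theorem Ca_nonneg (Q : IsFrontApprox Λ ε S M σ η ηR d ωd Ca k w Gp Gm Θ j jh b) (hΛ : 0 < Λ) :
    0 ≤ Ca :=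
  (abs_nonneg _).trans (Q.bound_b 0 ⟨le_rfl, hΛ.le⟩ 0 ⟨by linarith [Q.S_pos], Q.S_pos.le⟩)

theorem modulus_nonneg (Q : IsFrontApprox Λ ε S M σ η ηR d ωd Ca k w Gp Gm Θ j jh b)
    (H : IsFrontSystem Λ ε (M / ε) f w Gp Gm A B Θ) : 0 ≤ ωd := by
  have hd : 0 ≤ d := by
    have h1 := Q.d_ge; have h2 := Q.eta_nonneg; have h3 := Q.M_pos; have h4 := H.pos
    have h5 := Q.S_pos
    have : 0 ≤ 2 * η + 2 * M * ε * (S + 1) + ε ^ 2 * (S + 1) := by positivity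
    linarith
  have h0 : (0 : ℝ) ∈ Icc 0 Λ := ⟨le_rfl, H.range_pos.le⟩
  have h1 : (0 : ℝ) ∈ Icc (-(2 * (S + 1))) S := ⟨by linarith [Q.S_pos], Q.S_pos.le⟩
  exact (abs_nonneg _).trans
    (Q.modulus_b 0 h0 0 h0 0 h1 0 h1 (by simpa using hd) (by simpa using hd))

/-- Along a left going characteristic the label `s` decreases at the rate `2` per unit of scaled
range, so that `A` is there approximately the profile at the label `s - 2 h`. -/
theorem left_point (Q : IsFrontApprox Λ ε S M σ η ηR d ωd Ca k w Gp Gm Θ j jh b)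
    (H : IsFrontSystem Λ ε (M / ε) f w Gp Gm A B Θ) (P : IsProfile S k f b) {l W : ℝ} (hl : 0 < l)
    (hW : ∀ ξ ∈ Icc 0 Λ, ∀ s ∈ Icc 0 S, |A (Θ s ξ) ξ - b ξ s| ≤ W * Real.exp (l * Θ s ξ))
    (hW0 : 0 ≤ W)
    {s x h : ℝ} (hs : s ∈ Icc 0 S) (hx : x ∈ Icc 0 Λ) (hh : h ∈ Icc 0 (S + 1))
    (hxh : x + ε ^ 2 * h ≤ Λ) {T : ℝ → ℝ} (hT0 : T x = Θ s x)
    (hT : ∀ y, HasDerivAt T (-w (T y) y) y) :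
    |A (T (x + ε ^ 2 * h)) (x + ε ^ 2 * h) - b x (s - 2 * h)| ≤
      ωd + W * Real.exp (l * Θ s x) := by
  have hε := H.pos
  have hε2 : 0 < ε ^ 2 := by positivity
  have hM := Q.M_pos
  have hη := Q.eta_nonneg
  have hS := Q.S_pos
  set y := x + ε ^ 2 * h with hy
  have hstep : 0 ≤ ε ^ 2 * h := mul_nonneg hε2.le hh.1
  have hxy : x ≤ y := by linarith
  have hyΛ : y ∈ Icc 0 Λ := ⟨hx.1.trans hxy, hxh⟩
  have hωd := Q.modulus_nonneg H
  have hWe : 0 ≤ W * Real.exp (l * Θ s x) := by positivity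
  -- drifts of the two characteristics
  have d1 := abs_sub_drift_le (v := -1) (b := M * ε) hT
    (fun y => by rw [show -w (T y) y - -1 = -(w (T y) y - 1) by ring, abs_neg]; exact Q.drift _ _)
    x y
  have d0 := abs_sub_drift_le (v := 1) (b := M * ε) (H.flow 0) (fun y => Q.drift _ _) x y
  have hyx : y - x = ε ^ 2 * h := by rw [hy]; ring
  rw [hyx, abs_of_nonneg hstep] at d1 d0
  have lab := Q.label s hs x hx
  have hdlarge := Q.d_ge
  have hsmall : M * ε * (ε ^ 2 * h) ≤ M * ε * (S + 1) * ε ^ 2 := by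
    have : M * ε * h ≤ M * ε * (S + 1) := by gcongr; exact hh.2
    nlinarith
  rw [hT0] at d1
  have e1 := abs_le.mp d1
  have e0 := abs_le.mp d0
  have el := abs_le.mp lab
  have hlab2 : |T y - Θ 0 y - ε ^ 2 * (s - 2 * h)| ≤ (η + 2 * M * ε * (S + 1)) * ε ^ 2 := by
    rw [abs_le]; constructor <;> nlinarith [e1.1, e1.2, e0.1, e0.2, el.1, el.2]
  have hmems : s - 2 * h ∈ Icc (-(2 * (S + 1))) S :=
    ⟨by linarith [hs.1, hh.2], by linarith [hs.2, hh.1]⟩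
  have hmε : 0 ≤ 2 * M * ε * (S + 1) := by positivity
  rcases le_or_gt (T y) (Θ 0 y) with hle | hgt
  · rw [(H.eq_zero_ahead hyΛ hle).1, zero_sub, abs_neg]
    have hs2 : s - 2 * h ≤ η + 2 * M * ε * (S + 1) := by
      have := (abs_le.mp hlab2).1
      by_contra! hcon
      nlinarith
    have h0 : (0 : ℝ) ∈ Icc (-(2 * (S + 1))) S := ⟨by linarith, hS.le⟩
    rcases le_or_gt (s - 2 * h) 0 with hneg | hpos
    · rw [P.eq_zero x hx.1 _ hneg, abs_zero]; positivity
    · have := Q.modulus_b x hx x hx _ hmems 0 h0 (by rw [sub_self, abs_zero]; nlinarith)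
        (by rw [sub_zero, abs_of_pos hpos]; nlinarith)
      rw [P.eq_zero x hx.1 0 le_rfl, sub_zero] at this
      linarith
  · -- the point lies on a right going characteristic with label `r ∈ [0, s]`
    obtain ⟨kΘ, hkΘ⟩ := H.exists_flow_lipschitz
    have hup : T y ≤ Θ s y := by
      have h1 : Antitone T := antitone_of_deriv_nonpos (fun x => (hT x).differentiableAt)
        fun x => by rw [(hT x).deriv]; linarith [H.half_le_w (T x) x]
      exact (h1 hxy).trans (hT0.le.trans (H.flow_monotone s hxy))
    obtain ⟨r, hr, hrT⟩ : T y ∈ (fun r => Θ r y) '' Icc 0 s :=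
      intermediate_value_Icc hs.1 (hkΘ y hyΛ).continuous.continuousOn ⟨hgt.le, hup⟩
    have hrS : r ∈ Icc 0 S := ⟨hr.1, hr.2.trans hs.2⟩
    have hrT' : Θ r y = T y := hrT
    have labr := Q.label r hrS y hyΛ
    rw [hrT'] at labr
    have hdist : |r - (s - 2 * h)| ≤ 2 * η + 2 * M * ε * (S + 1) := by
      have h1 := abs_le.mp labr
      have h2 := abs_le.mp hlab2
      rw [abs_le]
      constructor
      · refine le_of_mul_le_mul_left ?_ hε2
        linarith only [h1.1, h1.2, h2.1, h2.2]
      · refine le_of_mul_le_mul_left ?_ hε2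
        linarith only [h1.1, h1.2, h2.1, h2.2]
    have hE := hW y hyΛ r hrS
    rw [hrT'] at hE
    have hTt : Real.exp (l * T y) ≤ Real.exp (l * Θ s x) := by
      apply Real.exp_le_exp.mpr
      have h1 : Antitone T := antitone_of_deriv_nonpos (fun x => (hT x).differentiableAt)
        fun x => by rw [(hT x).deriv]; linarith [H.half_le_w (T x) x]
      have := h1 hxy
      rw [hT0] at this
      gcongr
    have hmod := Q.modulus_b y hyΛ x hx r ⟨by linarith [hr.1], hrS.2⟩ _ hmems
      (by
        rw [hyx, abs_of_nonneg hstep]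
        have : ε ^ 2 * h ≤ ε ^ 2 * (S + 1) := by gcongr; exact hh.2
        linarith)
      (by
        have : 0 ≤ ε ^ 2 * (S + 1) := by positivity
        linarith)
    calc _ ≤ |A (T y) y - b y r| + |b y r - b x (s - 2 * h)| := abs_sub_le _ _ _
      _ ≤ W * Real.exp (l * T y) + ωd := add_le_add hE hmod
      _ ≤ W * Real.exp (l * Θ s x) + ωd := by gcongr
      _ = _ := by ring

/-- The left going characteristic has overtaken the leading edge of the pulse after the range
`ε² (S + 1)`, so the range of the integral over `h` may be cut off at `S + 1`. -/
theorem left_zero (Q : IsFrontApprox Λ ε S M σ η ηR d ωd Ca k w Gp Gm Θ j jh b)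
    (H : IsFrontSystem Λ ε (M / ε) f w Gp Gm A B Θ)
    {s x h : ℝ} (hs : s ∈ Icc 0 S) (hx : x ∈ Icc 0 Λ) (hh : S + 1 ≤ h)
    (hxh : x + ε ^ 2 * h ≤ Λ) {T : ℝ → ℝ} (hT0 : T x = Θ s x)
    (hT : ∀ y, HasDerivAt T (-w (T y) y) y) :
    A (T (x + ε ^ 2 * h)) (x + ε ^ 2 * h) = 0 := by
  have hε := H.pos
  have hε2 : 0 < ε ^ 2 := by positivity
  have hS := Q.S_pos
  have hstep : 0 ≤ ε ^ 2 * h := mul_nonneg hε2.le (by linarith)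
  refine (H.eq_zero_ahead ⟨by linarith [hx.1], hxh⟩ ?_).1
  have d1 := abs_sub_drift_le (v := -1) (b := 1 / 2) hT (fun y => by
    rw [show -w (T y) y - -1 = -(w (T y) y - 1) by ring, abs_neg]; exact H.near_one _ _)
    x (x + ε ^ 2 * h)
  have d0 := abs_sub_drift_le (v := 1) (b := 1 / 2) (H.flow 0) (fun y => H.near_one _ _)
    x (x + ε ^ 2 * h)
  rw [add_sub_cancel_left, abs_of_nonneg hstep] at d1 d0
  have lab := (abs_le.mp (Q.label s hs x hx)).2
  have e1 := (abs_le.mp d1).2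
  have e0 := (abs_le.mp d0).1
  rw [hT0] at e1
  have : ε ^ 2 * (s + η) ≤ ε ^ 2 * h := by
    have := Q.eta_le
    exact mul_le_mul_of_nonneg_left (by linarith [hs.2]) hε2.le
  nlinarith

set_option maxHeartbeats 800000 in
/-- The left going wave at a point of the front: it is `ε` times a weighted average of the
profile, up to a truncation within the distance `ε² (S + 1)` of the end of the range interval. -/
theorem left_wave (Q : IsFrontApprox Λ ε S M σ η ηR d ωd Ca k w Gp Gm Θ j jh b)
    (H : IsFrontSystem Λ ε (M / ε) f w Gp Gm A B Θ) (P : IsProfile S k f b) {l W : ℝ} (hl : 0 < l)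
    (hW : ∀ ξ ∈ Icc 0 Λ, ∀ s ∈ Icc 0 S, |A (Θ s ξ) ξ - b ξ s| ≤ W * Real.exp (l * Θ s ξ))
    (hW0 : 0 ≤ W) {s x : ℝ} (hs : s ∈ Icc 0 S) (hx : x ∈ Icc 0 Λ) :
    |B (Θ s x) x - ε * (σ / 2) * ∫ h in (0 : ℝ)..(S + 1), jh h (Θ s x) x * b x (s - 2 * h)| ≤
      ε * ((S + 1) * (4 * M * (ε * Ca + ωd + W * Real.exp (l * Θ s x))) +
        (Ioi (Λ - ε ^ 2 * (S + 1))).indicator (fun _ => M * Ca * (S + 1)) x) := by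
  have hε := H.pos
  have hε2 : 0 < ε ^ 2 := by positivity
  have hM := Q.M_pos
  have hS := Q.S_pos
  have hCa := Q.Ca_nonneg H.range_pos
  have hωd := Q.modulus_nonneg H
  obtain ⟨T, hT0, hT⟩ := H.exists_left (Θ s x) x
  have hTc : Continuous T := continuous_iff_continuousAt.mpr fun x => (hT x).continuousAt
  set E := W * Real.exp (l * Θ s x) with hE
  have hE0 : 0 ≤ E := by positivity
  set hm := (Λ - x) / ε ^ 2 with hhm
  have hm0 : 0 ≤ hm := div_nonneg (by linarith [hx.2]) hε2.le
  have hmΛ : x + ε ^ 2 * hm = Λ := by rw [hhm]; field_simp; ring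
  set g : ℝ → ℝ := fun h => Gm (T (x + ε ^ 2 * h)) (x + ε ^ 2 * h) *
    A (T (x + ε ^ 2 * h)) (x + ε ^ 2 * h) with hg
  have hgc : ContinuousOn g (Icc 0 hm) := by
    have h1 : ContinuousOn (fun h => A (T (x + ε ^ 2 * h)) (x + ε ^ 2 * h)) (Icc 0 hm) :=
      (IsFrontSystem.continuousOn_along H.continuousOn_A hTc).comp
        (f := fun h => x + ε ^ 2 * h) (by fun_prop) fun h hh =>
          ⟨by nlinarith [hh.1, hx.1], by rw [← hmΛ]; nlinarith [hh.2]⟩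
    have h2 : Continuous fun h => Gm (T (x + ε ^ 2 * h)) (x + ε ^ 2 * h) :=
      H.continuous_Gm.comp (by fun_prop : Continuous fun h => (T (x + ε ^ 2 * h), x + ε ^ 2 * h))
    exact h2.continuousOn.mul h1
  have hB : B (Θ s x) x = ε ^ 2 * ∫ h in (0 : ℝ)..hm, g h := by
    rw [← hT0, H.B_eq hT hx, hg,
      intervalIntegral.integral_comp_add_mul (fun y => Gm (T y) y * A (T y) y) hε2.ne' x,
      mul_zero, add_zero, hmΛ, smul_eq_mul, mul_inv_cancel_left₀ hε2.ne']
  set h' := min hm (S + 1) with hh'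
  have h'0 : 0 ≤ h' := le_min hm0 (by linarith)
  have hB' : B (Θ s x) x = ε ^ 2 * ∫ h in (0 : ℝ)..h', g h := by
    rw [hB]
    congr 1
    rcases le_total hm (S + 1) with hle | hle
    · rw [hh', min_eq_left hle]
    · rw [hh', min_eq_right hle]
      rw [← intervalIntegral.integral_add_adjacent_intervals (a := 0) (b := S + 1) (c := hm)]
      · have : ∫ h in (S + 1)..hm, g h = ∫ h in (S + 1)..hm, (0 : ℝ) := by
          apply intervalIntegral.integral_congr
          intro h hh
          rw [uIcc_of_le hle] at hh
          have hz := Q.left_zero H hs hx hh.1 (by rw [← hmΛ]; nlinarith [hh.2]) hT0 hT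
          simp only [hg, hz, mul_zero]
        rw [this]; simp
      · exact (hgc.mono (Icc_subset_Icc_right hle)).intervalIntegrable_of_Icc (by linarith)
      · exact (hgc.mono (Icc_subset_Icc_left (by linarith))).intervalIntegrable_of_Icc hle
  set J : ℝ → ℝ := fun h => jh h (Θ s x) x * b x (s - 2 * h) with hJ
  have hJc : Continuous J := by
    have h1 : Continuous fun h => jh h (Θ s x) x :=
      Q.continuous_jh.comp (by fun_prop : Continuous fun h : ℝ => (h, Θ s x, x))
    have h2 : Continuous fun h => b x (s - 2 * h) :=
      P.continuous.comp (by fun_prop : Continuous fun h : ℝ => (x, s - 2 * h))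
    exact h1.mul h2
  have hJb : ∀ h ∈ Icc 0 (S + 1), |J h| ≤ M * Ca := fun h hh => by
    rw [hJ, abs_mul]
    exact mul_le_mul (Q.bound_jh _ _ _) (Q.bound_b x hx _ ⟨by linarith [hs.1, hh.2],
      by linarith [hs.2, hh.1]⟩) (abs_nonneg _) hM.le
  have hsplit : ∫ h in (0 : ℝ)..(S + 1), J h = (∫ h in (0 : ℝ)..h', J h) +
      ∫ h in h'..(S + 1), J h :=
    (intervalIntegral.integral_add_adjacent_intervals (hJc.intervalIntegrable _ _)
      (hJc.intervalIntegrable _ _)).symm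
  have hgi : IntervalIntegrable g volume 0 h' :=
    (hgc.mono (Icc_subset_Icc_right (min_le_left _ _))).intervalIntegrable_of_Icc h'0
  have hmain : B (Θ s x) x - ε * (σ / 2) * ∫ h in (0 : ℝ)..(S + 1), J h =
      ε * ((∫ h in (0 : ℝ)..h', (ε * g h - σ / 2 * J h)) - σ / 2 * ∫ h in h'..(S + 1), J h) := by
    rw [hB', hsplit, intervalIntegral.integral_sub (hgi.const_mul _)
      ((hJc.intervalIntegrable _ _).const_mul _), intervalIntegral.integral_const_mul,
      intervalIntegral.integral_const_mul]
    ring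
  have hσ2 : |σ / 2| = 1 / 2 := by rw [abs_div, Q.sign]; norm_num
  -- the integrand is close to its leading part
  have hpoint : ∀ h ∈ Icc 0 h', |ε * g h - σ / 2 * J h| ≤ 4 * M * (ε * Ca + ωd + E) := by
    intro h hh
    have hhS : h ∈ Icc 0 (S + 1) := ⟨hh.1, hh.2.trans (min_le_right _ _)⟩
    have hxh : x + ε ^ 2 * h ≤ Λ := by
      rw [← hmΛ]; nlinarith [hh.2.trans (min_le_left _ _)]
    have hA := Q.left_point H P hl hW hW0 hs hx hhS hxh hT0 hT
    rw [← hE] at hA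
    set a := A (T (x + ε ^ 2 * h)) (x + ε ^ 2 * h) with ha
    set t' := T (x + ε ^ 2 * h) with ht'
    set bb := b x (s - 2 * h) with hbb
    have hbC : |bb| ≤ Ca := Q.bound_b x hx _ ⟨by linarith [hs.1, hhS.2], by linarith [hs.2, hh.1]⟩
    have haC : |a| ≤ Ca + (ωd + E) := by
      have := abs_sub_abs_le_abs_sub a bb; linarith
    have hj := Q.approx_jh T hT x h hhS
    rw [hT0, ← ht'] at hj
    have hG := Q.approx_Gm t' (x + ε ^ 2 * h)
    have hjb := Q.bound_jh h (Θ s x) x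
    have hid : ε * g h - σ / 2 * J h =
        (ε * Gm t' (x + ε ^ 2 * h) - σ * j t' (x + ε ^ 2 * h) / 2) * a +
        σ / 2 * (j t' (x + ε ^ 2 * h) - jh h (Θ s x) x) * a +
        σ / 2 * jh h (Θ s x) x * (a - bb) := by
      simp only [hg, hJ]; ring
    rw [hid]
    refine (abs_add_three _ _ _).trans ?_
    rw [abs_mul, abs_mul, abs_mul, abs_mul, abs_mul, hσ2]
    have i1 : |ε * Gm t' (x + ε ^ 2 * h) - σ * j t' (x + ε ^ 2 * h) / 2| * |a| ≤
        M * ε * (Ca + (ωd + E)) := by gcongr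
    have i2 : 1 / 2 * |j t' (x + ε ^ 2 * h) - jh h (Θ s x) x| * |a| ≤
        1 / 2 * (M * ε) * (Ca + (ωd + E)) := by gcongr
    have i3 : 1 / 2 * |jh h (Θ s x) x| * |a - bb| ≤ 1 / 2 * M * (ωd + E) := by gcongr
    have i4 : M * ε * (ωd + E) ≤ M * (ωd + E) := by
      have : ε * (ωd + E) ≤ 1 * (ωd + E) := by gcongr; exact Q.eps_le
      have := mul_le_mul_of_nonneg_left this hM.le
      linarith only [this]
    have i5 : 0 ≤ M * ε * Ca := by positivity
    have i6 : 0 ≤ M * (ωd + E) := by positivity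
    linarith only [i1, i2, i3, i4, i5, i6]
  have b1 : |∫ h in (0 : ℝ)..h', (ε * g h - σ / 2 * J h)| ≤
      (S + 1) * (4 * M * (ε * Ca + ωd + E)) := by
    have := intervalIntegral.norm_integral_le_of_norm_le_const
      (a := 0) (b := h') (f := fun h => ε * g h - σ / 2 * J h) (C := 4 * M * (ε * Ca + ωd + E))
      fun h hh => by
        rw [uIoc_of_le h'0] at hh
        exact hpoint h ⟨hh.1.le, hh.2⟩
    rw [Real.norm_eq_abs, sub_zero, abs_of_nonneg h'0] at this
    refine this.trans ?_
    rw [mul_comm]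
    have h'S : h' ≤ S + 1 := min_le_right _ _
    gcongr
  have b2 : |σ / 2 * ∫ h in h'..(S + 1), J h| ≤
      (Ioi (Λ - ε ^ 2 * (S + 1))).indicator (fun _ => M * Ca * (S + 1)) x := by
    by_cases hxΛ : x ∈ Ioi (Λ - ε ^ 2 * (S + 1))
    · rw [indicator_of_mem hxΛ, abs_mul, hσ2]
      have := intervalIntegral.norm_integral_le_of_norm_le_const
        (a := h') (b := S + 1) (f := J) (C := M * Ca) fun h hh => by
          rw [uIoc_of_le (min_le_right _ _)] at hh
          exact hJb h ⟨h'0.trans hh.1.le, hh.2⟩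
      rw [Real.norm_eq_abs,
        abs_of_nonneg (show 0 ≤ S + 1 - h' by linarith [min_le_right hm (S + 1)])] at this
      have h3 : M * Ca * (S + 1 - h') ≤ M * Ca * (S + 1) := by gcongr; linarith
      have h4 : 0 ≤ |∫ h in h'..(S + 1), J h| := abs_nonneg _
      linarith
    · rw [indicator_of_notMem hxΛ]
      have hle : S + 1 ≤ hm := by
        rw [hhm, le_div_iff₀ hε2]
        simp only [mem_Ioi, not_lt] at hxΛ
        linarith
      rw [hh', min_eq_right hle]; simp
  rw [hmain, abs_mul, abs_of_pos hε]
  refine mul_le_mul_of_nonneg_left ?_ hε.le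
  exact (abs_sub _ _).trans (add_le_add b1 b2)

theorem integral_indicator_Ioi_le {a c ξ : ℝ} (hc : 0 ≤ c) (hξ : 0 ≤ ξ) (ha : a ≤ ξ) :
    ∫ x in (0 : ℝ)..ξ, (Ioi a).indicator (fun _ => c) x ≤ (ξ - a) * c := by
  rw [intervalIntegral.integral_of_le hξ, setIntegral_indicator measurableSet_Ioi,
    setIntegral_const, smul_eq_mul]
  refine mul_le_mul_of_nonneg_right ?_ hc
  have hsub : Ioc 0 ξ ∩ Ioi a ⊆ Ioc a ξ := fun x hx => ⟨hx.2, hx.1.2⟩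
  calc volume.real (Ioc 0 ξ ∩ Ioi a) ≤ volume.real (Ioc a ξ) :=
        measureReal_mono hsub (by simp)
    _ = ξ - a := by rw [Real.volume_real_Ioc_of_le ha]

set_option maxHeartbeats 800000 in
/-- The deterministic error estimate. The weighted maximum `W` of the error is bounded by the sum
of the perturbations plus `W / 2`, by one step of Grönwall type along the right going
characteristics. -/
theorem front_error (Q : IsFrontApprox Λ ε S M σ η ηR d ωd Ca k w Gp Gm Θ j jh b)
    (H : IsFrontSystem Λ ε (M / ε) f w Gp Gm A B Θ) (P : IsProfile S k f b)
    {s ξ : ℝ} (hs : s ∈ Icc 0 S) (hξ : ξ ∈ Icc 0 Λ) :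
    |A (Θ s ξ) ξ - b ξ s| ≤
      2 * (ηR + 4 * M ^ 2 * (S + 1) * (Λ * (2 * (ε * Ca) + ωd)) +
        ε ^ 2 * (S + 1) * (M ^ 2 * Ca * (S + 1))) *
      Real.exp (4 * (4 * M ^ 2 * (S + 1)) * (S + 2 * Λ)) := by
  have hε := H.pos
  have hM := Q.M_pos
  have hS := Q.S_pos
  have hΛ := H.range_pos
  have hCa := Q.Ca_nonneg hΛ
  have hωd := Q.modulus_nonneg H
  set C := 4 * M ^ 2 * (S + 1) with hC
  have hC0 : 0 < C := by positivity
  set l := 4 * C with hl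
  have hl0 : 0 < l := by positivity
  have hηR : 0 ≤ ηR := (abs_nonneg _).trans (Q.average 0 ⟨le_rfl, hS.le⟩ 0 ⟨le_rfl, hΛ.le⟩)
  set N := ηR + C * (Λ * (2 * (ε * Ca) + ωd)) + ε ^ 2 * (S + 1) * (M ^ 2 * Ca * (S + 1)) with hN
  have hN0 : 0 ≤ N := by positivity
  have hΘpos : ∀ s ∈ Icc 0 S, ∀ ξ ∈ Icc 0 Λ, 0 ≤ Θ s ξ := fun s hs ξ hξ => by
    have := H.flow_monotone s hξ.1
    rw [H.flow_zero] at this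
    have h2 : 0 ≤ ε ^ 2 * s := mul_nonneg (by positivity) hs.1
    linarith
  -- the weighted maximum of the error
  set D : Set (ℝ × ℝ) := Icc 0 Λ ×ˢ Icc 0 S with hD
  have hDc : IsCompact D := isCompact_Icc.prod isCompact_Icc
  have hDne : D.Nonempty := ⟨(0, 0), ⟨le_rfl, hΛ.le⟩, ⟨le_rfl, hS.le⟩⟩
  set φ : ℝ × ℝ → ℝ := fun x =>
    Real.exp (-(l * Θ x.2 x.1)) * |A (Θ x.2 x.1) x.1 - b x.1 x.2| with hφ
  have hφc : ContinuousOn φ D := by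
    have h1 : ContinuousOn (fun x : ℝ × ℝ => Real.exp (-(l * Θ x.2 x.1))) D :=
      ((H.continuousOn_flow (Icc 0 S)).const_mul l).neg.rexp
    exact h1.mul ((H.continuousOn_front (Icc 0 S)).sub P.continuous.continuousOn).abs
  obtain ⟨x₀, hx₀, hmax⟩ := hDc.exists_isMaxOn hDne hφc
  set W := φ x₀ with hWdef
  have hW0 : 0 ≤ W := by positivity
  have hW : ∀ ξ ∈ Icc 0 Λ, ∀ s ∈ Icc 0 S, |A (Θ s ξ) ξ - b ξ s| ≤ W * Real.exp (l * Θ s ξ) := by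
    intro ξ hξ s hs
    have : Real.exp (-(l * Θ s ξ)) * |A (Θ s ξ) ξ - b ξ s| ≤ W :=
      hmax (show (ξ, s) ∈ D from ⟨hξ, hs⟩)
    rwa [Real.exp_neg, inv_mul_le_iff₀ (Real.exp_pos _), mul_comm] at this
  have improve : ∀ ξ ∈ Icc 0 Λ, ∀ s ∈ Icc 0 S,
      |A (Θ s ξ) ξ - b ξ s| ≤ (N + W / 2) * Real.exp (l * Θ s ξ) := by
    intro ξ hξ s hs
    have hΘc := H.continuous_flow s
    have hpath : Continuous fun x => (Θ s x, x) := by fun_prop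
    have hjc : Continuous fun x => j (Θ s x) x := Q.continuous_j.comp hpath
    set I : ℝ → ℝ := fun x => ∫ h in (0 : ℝ)..(S + 1), jh h (Θ s x) x * b x (s - 2 * h) with hI
    set k' : ℝ → ℝ := fun x => ∫ h in (0 : ℝ)..(S + 1), k h * b x (s - 2 * h) with hk'
    have hbc : Continuous fun p : ℝ × ℝ => b p.1 (s - 2 * p.2) :=
      P.continuous.comp (by fun_prop : Continuous fun p : ℝ × ℝ => (p.1, s - 2 * p.2))
    have hjhc : Continuous fun p : ℝ × ℝ => jh p.2 (Θ s p.1) p.1 :=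
      Q.continuous_jh.comp (by fun_prop : Continuous fun p : ℝ × ℝ => (p.2, Θ s p.1, p.1))
    have hkc : Continuous fun p : ℝ × ℝ => k p.2 := P.continuous_kernel.comp continuous_snd
    have hIc : Continuous I :=
      intervalIntegral.continuous_parametric_intervalIntegral_of_continuous'
        (f := fun x h => jh h (Θ s x) x * b x (s - 2 * h)) (hjhc.mul hbc) 0 (S + 1)
    have hk'c : Continuous k' :=
      intervalIntegral.continuous_parametric_intervalIntegral_of_continuous'
        (f := fun x h => k h * b x (s - 2 * h)) (hkc.mul hbc) 0 (S + 1)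
    have havg : ∀ x, ∫ h in (0 : ℝ)..(S + 1),
        (σ * j (Θ s x) x * jh h (Θ s x) x - k h) * b x (s - 2 * h) =
        σ * (j (Θ s x) x * I x) - k' x := by
      intro x
      have c1 : Continuous fun h => jh h (Θ s x) x * b x (s - 2 * h) :=
        (hjhc.mul hbc).comp (by fun_prop : Continuous fun h : ℝ => (x, h))
      have c2 : Continuous fun h => k h * b x (s - 2 * h) :=
        (hkc.mul hbc).comp (by fun_prop : Continuous fun h : ℝ => (x, h))
      rw [hI, hk', ← mul_assoc, ← intervalIntegral.integral_const_mul,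
        ← intervalIntegral.integral_sub ((c1.intervalIntegrable _ _).const_mul _)
          (c2.intervalIntegrable _ _)]
      congr 1; ext h; ring
    have hav := Q.average s hs ξ hξ
    simp only [havg] at hav
    have hGB : ContinuousOn (fun x => Gp (Θ s x) x * B (Θ s x) x) (Icc 0 ξ) := by
      have h1 : ContinuousOn (fun x => Gp (Θ s x) x) (Icc 0 ξ) :=
        (H.continuous_Gp.comp hpath).continuousOn
      exact h1.mul ((IsFrontSystem.continuousOn_along H.continuousOn_B hΘc).mono
        (Icc_subset_Icc_right hξ.2))
    have hGBi : IntervalIntegrable (fun x => Gp (Θ s x) x * B (Θ s x) x) volume 0 ξ :=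
      hGB.intervalIntegrable_of_Icc hξ.1
    have hjIi : IntervalIntegrable (fun x => σ * (j (Θ s x) x * I x)) volume 0 ξ :=
      (continuous_const.mul (hjc.mul hIc)).intervalIntegrable _ _
    have hkii : IntervalIntegrable k' volume 0 ξ := hk'c.intervalIntegrable _ _
    have hdecomp : A (Θ s ξ) ξ - b ξ s =
        -(∫ x in (0 : ℝ)..ξ, (Gp (Θ s x) x * B (Θ s x) x - 1 / 4 * (σ * (j (Θ s x) x * I x)))) -
        1 / 4 * ∫ x in (0 : ℝ)..ξ, (σ * (j (Θ s x) x * I x) - k' x) := by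
      rw [H.A_eq (H.flow s) hξ, P.eq ξ hξ.1 s hs, H.flow_zero,
        mul_div_cancel_left₀ _ (by positivity : ε ^ 2 ≠ 0),
        intervalIntegral.integral_sub hGBi (hjIi.const_mul _),
        intervalIntegral.integral_sub hjIi hkii, intervalIntegral.integral_const_mul]
      ring
    set g : ℝ → ℝ := fun x => C * (2 * (ε * Ca) + ωd) + C * W * Real.exp (l * Θ s x) +
      (Ioi (Λ - ε ^ 2 * (S + 1))).indicator (fun _ => M ^ 2 * Ca * (S + 1)) x with hg
    have hpoint : ∀ x ∈ Icc 0 ξ,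
        |Gp (Θ s x) x * B (Θ s x) x - 1 / 4 * (σ * (j (Θ s x) x * I x))| ≤ g x := by
      intro x hx
      have hxΛ : x ∈ Icc 0 Λ := ⟨hx.1, hx.2.trans hξ.2⟩
      have hB := Q.left_wave H P hl0 hW hW0 hs hxΛ
      have hIb : |I x| ≤ M * Ca * (S + 1) := by
        have := intervalIntegral.norm_integral_le_of_norm_le_const
          (a := 0) (b := S + 1) (f := fun h => jh h (Θ s x) x * b x (s - 2 * h)) (C := M * Ca)
          fun h hh => by
            rw [uIoc_of_le (by linarith)] at hh
            rw [norm_mul]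
            exact mul_le_mul (Q.bound_jh _ _ _) (Q.bound_b x hxΛ _ ⟨by linarith [hs.1, hh.2],
              by linarith [hs.2, hh.1]⟩) (norm_nonneg _) hM.le
        rwa [Real.norm_eq_abs, sub_zero, abs_of_pos (by linarith : 0 < S + 1)] at this
      have hid : Gp (Θ s x) x * B (Θ s x) x - 1 / 4 * (σ * (j (Θ s x) x * I x)) =
          Gp (Θ s x) x * (B (Θ s x) x - ε * (σ / 2) * I x) +
          (ε * Gp (Θ s x) x - j (Θ s x) x / 2) * (σ / 2) * I x := by ring
      have hσ2 : |σ / 2| = 1 / 2 := by rw [abs_div, Q.sign]; norm_num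
      set ind := (Ioi (Λ - ε ^ 2 * (S + 1))).indicator (fun _ => M * Ca * (S + 1)) x with hind
      have hind2 : (Ioi (Λ - ε ^ 2 * (S + 1))).indicator (fun _ => M ^ 2 * Ca * (S + 1)) x =
          M * ind := by
        rw [hind]
        by_cases hxm : x ∈ Ioi (Λ - ε ^ 2 * (S + 1))
        · rw [indicator_of_mem hxm, indicator_of_mem hxm]; ring
        · rw [indicator_of_notMem hxm, indicator_of_notMem hxm, mul_zero]
      set E := W * Real.exp (l * Θ s x) with hE
      have i1 : |Gp (Θ s x) x * (B (Θ s x) x - ε * (σ / 2) * I x)| ≤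
          M / ε * (ε * ((S + 1) * (4 * M * (ε * Ca + ωd + E)) + ind)) := by
        rw [abs_mul]
        exact mul_le_mul (H.bound_Gp _ _) hB (abs_nonneg _) (by positivity)
      have i2 : |(ε * Gp (Θ s x) x - j (Θ s x) x / 2) * (σ / 2) * I x| ≤
          M * ε * (1 / 2) * (M * Ca * (S + 1)) := by
        rw [abs_mul, abs_mul, hσ2]
        have := Q.approx_Gp (Θ s x) x
        gcongr
      have i3 : M / ε * (ε * ((S + 1) * (4 * M * (ε * Ca + ωd + E)) + ind)) =
          C * (ε * Ca + ωd + E) + M * ind := by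
        rw [hC]; field_simp
      have i4 : M * ε * (1 / 2) * (M * Ca * (S + 1)) ≤ C * (ε * Ca) := by
        have : 0 ≤ M ^ 2 * (S + 1) * (ε * Ca) := by positivity
        rw [hC]; linarith only [this]
      rw [hid]
      refine (abs_add_le _ _).trans ?_
      simp only [hg]
      rw [hind2]
      have : C * W * Real.exp (l * Θ s x) = C * E := by rw [hE]; ring
      linarith only [i1, i2, i3, i4, this]
    have hexpc : Continuous fun x => Real.exp (l * Θ s x) := by fun_prop
    have hindi : IntervalIntegrable
        (fun x => (Ioi (Λ - ε ^ 2 * (S + 1))).indicator (fun _ => M ^ 2 * Ca * (S + 1)) x)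
        volume 0 ξ := by
      rw [intervalIntegrable_iff]
      exact (integrableOn_const (by simp)).indicator measurableSet_Ioi
    have hgi1 : IntervalIntegrable
        (fun x => C * (2 * (ε * Ca) + ωd) + C * W * Real.exp (l * Θ s x)) volume 0 ξ :=
      (by fun_prop : Continuous fun x =>
        C * (2 * (ε * Ca) + ωd) + C * W * Real.exp (l * Θ s x)).intervalIntegrable _ _
    have hb1 := intervalIntegral.norm_integral_le_of_norm_le
      (f := fun x => Gp (Θ s x) x * B (Θ s x) x - 1 / 4 * (σ * (j (Θ s x) x * I x)))
      (g := g) hξ.1 (μ := volume)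
      (Eventually.of_forall fun x hx => hpoint x ⟨hx.1.le, hx.2⟩) (hgi1.add hindi)
    rw [Real.norm_eq_abs] at hb1
    have hgint : ∫ x in (0 : ℝ)..ξ, g x ≤ C * (Λ * (2 * (ε * Ca) + ωd)) +
        W / 2 * Real.exp (l * Θ s ξ) + ε ^ 2 * (S + 1) * (M ^ 2 * Ca * (S + 1)) := by
      have hexp := integral_exp_le_of_half_le (a := 0) (b := ξ) hξ.1 hl0 (H.flow s)
        (H.continuous_w_along hΘc) (fun x => H.half_le_w _ _)
      have hind : ∫ x in (0 : ℝ)..ξ,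
          (Ioi (Λ - ε ^ 2 * (S + 1))).indicator (fun _ => M ^ 2 * Ca * (S + 1)) x ≤
          ε ^ 2 * (S + 1) * (M ^ 2 * Ca * (S + 1)) := by
        rcases le_total (Λ - ε ^ 2 * (S + 1)) ξ with h | h
        · refine (integral_indicator_Ioi_le (by positivity) hξ.1 h).trans ?_
          have : ξ - (Λ - ε ^ 2 * (S + 1)) ≤ ε ^ 2 * (S + 1) := by linarith [hξ.2]
          gcongr
        · have : ∫ x in (0 : ℝ)..ξ,
              (Ioi (Λ - ε ^ 2 * (S + 1))).indicator (fun _ => M ^ 2 * Ca * (S + 1)) x =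
              ∫ x in (0 : ℝ)..ξ, (0 : ℝ) := by
            apply intervalIntegral.integral_congr
            intro x hx
            rw [uIcc_of_le hξ.1] at hx
            exact indicator_of_notMem (by simp only [mem_Ioi, not_lt]; linarith [hx.2]) _
          rw [this]; simp; positivity
      rw [hg, intervalIntegral.integral_add hgi1 hindi, intervalIntegral.integral_add
        (by simp) (by apply Continuous.intervalIntegrable; fun_prop),
        intervalIntegral.integral_const, intervalIntegral.integral_const_mul, sub_zero,
        smul_eq_mul]
      have h1 : ξ * (C * (2 * (ε * Ca) + ωd)) ≤ C * (Λ * (2 * (ε * Ca) + ωd)) := by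
        have : ξ * (C * (2 * (ε * Ca) + ωd)) ≤ Λ * (C * (2 * (ε * Ca) + ωd)) := by
          have := hξ.2
          gcongr
        linarith
      have h2 : C * W * ∫ x in (0 : ℝ)..ξ, Real.exp (l * Θ s x) ≤
          W / 2 * Real.exp (l * Θ s ξ) := by
        refine (mul_le_mul_of_nonneg_left hexp (by positivity)).trans (le_of_eq ?_)
        rw [hl]; field_simp; ring
      linarith
    have hone : 1 ≤ Real.exp (l * Θ s ξ) :=
      Real.one_le_exp (mul_nonneg hl0.le (hΘpos s hs ξ hξ))
    rw [hdecomp]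
    refine (abs_sub _ _).trans ?_
    rw [abs_neg, abs_mul, abs_of_pos (by norm_num : (0 : ℝ) < 1 / 4)]
    have hNexp : N ≤ N * Real.exp (l * Θ s ξ) := le_mul_of_one_le_right hN0 hone
    have h4 : 1 / 4 * |∫ x in (0 : ℝ)..ξ, (σ * (j (Θ s x) x * I x) - k' x)| ≤ ηR := by
      have := abs_nonneg (∫ x in (0 : ℝ)..ξ, (σ * (j (Θ s x) x * I x) - k' x))
      linarith
    rw [add_mul]
    linarith [hb1.trans hgint]
  have hWN : W ≤ 2 * N := by
    have h := improve x₀.1 hx₀.1 x₀.2 hx₀.2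
    have h2 : Real.exp (-(l * Θ x₀.2 x₀.1)) * |A (Θ x₀.2 x₀.1) x₀.1 - b x₀.1 x₀.2| ≤
        N + W / 2 := by
      rwa [Real.exp_neg, inv_mul_le_iff₀ (Real.exp_pos _), mul_comm]
    have h3 : W ≤ N + W / 2 := h2
    linarith
  refine (hW ξ hξ s hs).trans ?_
  have hΘle : Θ s ξ ≤ S + 2 * Λ := by
    have := abs_sub_drift_le (v := 1) (b := 1 / 2) (H.flow s) (fun y => H.near_one _ _) 0 ξ
    rw [H.flow_zero, sub_zero, abs_of_nonneg hξ.1] at this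
    have h1 := (abs_le.mp this).2
    have h2 : ε ^ 2 * s ≤ 1 * S := by
      have := Q.eps_le
      have h3 : ε ^ 2 ≤ 1 := by nlinarith
      exact mul_le_mul h3 hs.2 hs.1 zero_le_one
    linarith [hξ.2]
  gcongr

end IsFrontApprox

section Fourier

open scoped FourierTransform SchwartzMap ContDiff

/-! ### The Fourier transform of the pulse -/

/-- The Fourier integral of an `L¹ ∩ L²` function is square integrable: it agrees with the `L²`
Fourier transform, since both give the same pairing with test functions. -/
theorem memLp_two_fourier {g : ℝ → ℂ} (hg : Integrable g) (hg2 : MemLp g 2) :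
    MemLp (𝓕 g) 2 := by
  set G : Lp ℂ 2 (volume : Measure ℝ) := hg2.toLp g with hG
  have hcont : Continuous (𝓕 g) :=
    VectorFourier.fourierIntegral_continuous Real.continuous_fourierChar
      (by exact continuous_inner) hg
  have hae : ∀ᵐ x, (𝓕 g) x = (𝓕 G : Lp ℂ 2 (volume : Measure ℝ)) x := by
    refine ae_eq_of_integral_contDiff_smul_eq hcont.locallyIntegrable
      ((Lp.memLp (𝓕 G)).locallyIntegrable (by norm_num)) fun φ hφ hφc => ?_
    have hφc' : HasCompactSupport fun x => (φ x : ℂ) :=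
      hφc.comp_left (g := fun x : ℝ => (x : ℂ)) Complex.ofReal_zero
    have hφ' : ContDiff ℝ ∞ fun x => (φ x : ℂ) := Complex.ofRealCLM.contDiff.comp hφ
    set ψ : 𝓢(ℝ, ℂ) := hφc'.toSchwartzMap hφ' with hψ
    have hψx : ∀ x, ψ x = (φ x : ℂ) := fun x => rfl
    have h1 := congrArg (fun F : 𝓢'(ℝ, ℂ) => F ψ) (Lp.fourier_toTemperedDistribution_eq G)
    simp only [TemperedDistribution.fourier_apply, Lp.toTemperedDistribution_apply] at h1
    have h2 : ∫ x, (𝓕 ψ : 𝓢(ℝ, ℂ)) x • G x = ∫ x, (𝓕 ψ : 𝓢(ℝ, ℂ)) x • g x := by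
      apply integral_congr_ae
      filter_upwards [hg2.coeFn_toLp] with x hx
      rw [hG, hx]
    have h3 : ∫ x, ψ x • (𝓕 g) x = ∫ x, (𝓕 ψ : 𝓢(ℝ, ℂ)) x • g x := by
      have := VectorFourier.integral_fourierIntegral_smul_eq_flip (μ := volume) (ν := volume)
        (L := innerₗ ℝ) (f := (ψ : ℝ → ℂ)) (g := g) Real.continuous_fourierChar
        (by exact continuous_inner) ψ.integrable hg
      rw [flip_innerₗ] at this
      exact this.symm
    calc ∫ x, φ x • (𝓕 g) x = ∫ x, ψ x • (𝓕 g) x := by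
          congr 1
      _ = ∫ x, ψ x • (𝓕 G : Lp ℂ 2 (volume : Measure ℝ)) x := by rw [h3, ← h2, h1]
      _ = _ := by congr 1
  exact (memLp_congr_ae hae).mpr (Lp.memLp _)

variable {f : ℝ → ℝ}

theorem pulseHat_eq (w : ℝ) :
    pulseHat f w = 𝓕 (fun x => (f x : ℂ)) (-(1 / (2 * Real.pi)) * w) := by
  rw [Real.fourier_real_eq_integral_exp_smul, pulseHat]
  congr 1; ext v
  rw [smul_eq_mul, mul_comm]
  congr 2
  push_cast
  have : (Real.pi : ℂ) ≠ 0 := by exact_mod_cast Real.pi_ne_zero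
  field_simp

/-- For a `C¹` pulse both `f̂` and `w f̂` are square integrable, so that `f̂` is integrable. -/
theorem integrable_fourier_pulse (hf : ContDiff ℝ 1 f) (hfc : HasCompactSupport f) :
    Integrable (𝓕 fun x => (f x : ℂ)) := by
  set g : ℝ → ℂ := fun x => (f x : ℂ) with hg
  have hgd : ContDiff ℝ 1 g := Complex.ofRealCLM.contDiff.comp hf
  have hgc : HasCompactSupport g := hfc.comp_left (g := fun x : ℝ => (x : ℂ)) Complex.ofReal_zero
  have hg' : Continuous (deriv g) := hgd.continuous_deriv le_rfl
  have i0 : Integrable g := hgd.continuous.integrable_of_hasCompactSupport hgc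
  have i1 : Integrable (deriv g) := hg'.integrable_of_hasCompactSupport hgc.deriv
  have m0 := memLp_two_fourier i0 (hgd.continuous.memLp_of_hasCompactSupport hgc)
  have m1 := memLp_two_fourier i1 (hg'.memLp_of_hasCompactSupport hgc.deriv)
  rw [Real.fourier_deriv i0 (hgd.differentiable (by norm_num)) i1] at m1
  have s0 := (memLp_two_iff_integrable_sq_norm m0.1).mp m0
  have s1 := (memLp_two_iff_integrable_sq_norm m1.1).mp m1
  refine Integrable.mono' ((integrable_inv_one_add_sq.add s0).add s1) m0.1
    (Eventually.of_forall fun x => ?_)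
  simp only [Pi.add_apply]
  set r := ‖𝓕 g x‖ with hr
  have h1 : ‖(2 * Real.pi * Complex.I * x : ℂ) • 𝓕 g x‖ = 2 * Real.pi * |x| * r := by
    rw [norm_smul, norm_mul, norm_mul, norm_mul]
    simp only [Complex.norm_ofNat, Complex.norm_real, Complex.norm_I, Real.norm_eq_abs,
      abs_of_pos Real.pi_pos, mul_one, hr]
  rw [h1]
  have hpi : 1 ≤ 2 * Real.pi := by linarith [Real.pi_gt_three]
  have h2 : (|x| * r) ^ 2 ≤ (2 * Real.pi * |x| * r) ^ 2 := by
    rw [mul_assoc]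
    apply pow_le_pow_left₀ (by positivity)
    exact le_mul_of_one_le_left (by positivity) hpi
  have h3 : (|x| * r) ^ 2 = x ^ 2 * r ^ 2 := by rw [mul_pow, sq_abs]
  have h4 : 0 < 1 + x ^ 2 := by positivity
  have h5 : 2 * r ≤ (1 + x ^ 2)⁻¹ + (1 + x ^ 2) * r ^ 2 := by
    have : 0 ≤ (1 + x ^ 2)⁻¹ * (1 - (1 + x ^ 2) * r) ^ 2 := by positivity
    have h6 : (1 + x ^ 2)⁻¹ * (1 - (1 + x ^ 2) * r) ^ 2 =
        (1 + x ^ 2)⁻¹ + (1 + x ^ 2) * r ^ 2 - 2 * r := by field_simp; ring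
    linarith
  have h7 : 0 ≤ r := norm_nonneg _
  linarith

theorem integrable_pulseHat (hf : ContDiff ℝ 1 f) (hfc : HasCompactSupport f) :
    Integrable (pulseHat f) := by
  have h := (integrable_fourier_pulse hf hfc).comp_mul_left'
    (R := -(1 / (2 * Real.pi))) (neg_ne_zero.mpr (by have := Real.pi_pos; positivity))
  refine h.congr (Eventually.of_forall fun w => ?_)
  exact (pulseHat_eq w).symm

theorem integral_pulseHat (hf : ContDiff ℝ 1 f) (hfc : HasCompactSupport f) (s : ℝ) :
    ∫ w : ℝ, (2 * Real.pi : ℂ)⁻¹ * pulseHat f w * Complex.exp (-(Complex.I * w * s)) = f s := by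
  set g : ℝ → ℂ := fun x => (f x : ℂ) with hg
  have hgc : Continuous g := Complex.continuous_ofReal.comp hf.continuous
  have hgs : HasCompactSupport g := hfc.comp_left (g := fun x : ℝ => (x : ℂ)) Complex.ofReal_zero
  have hinv := congrFun (hgc.fourierInv_fourier_eq (hgc.integrable_of_hasCompactSupport hgs)
    (integrable_fourier_pulse hf hfc)) s
  rw [Real.fourierInv_eq'] at hinv
  have hpi := Real.pi_pos
  have hcv := Measure.integral_comp_mul_left
    (fun v : ℝ => Complex.exp (↑(2 * Real.pi * inner ℝ v s) * Complex.I) • 𝓕 g v)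
    (-(1 / (2 * Real.pi)))
  rw [hinv] at hcv
  have habs : |(-(1 / (2 * Real.pi)))⁻¹| = 2 * Real.pi := by
    rw [inv_neg, abs_neg, one_div, inv_inv, abs_of_pos (by positivity)]
  rw [habs] at hcv
  have h2pi : (2 * Real.pi : ℂ) ≠ 0 := by
    have : (Real.pi : ℂ) ≠ 0 := by exact_mod_cast Real.pi_ne_zero
    simp [this]
  have : ∀ w : ℝ, (2 * Real.pi : ℂ)⁻¹ * pulseHat f w * Complex.exp (-(Complex.I * w * s)) =
      (2 * Real.pi : ℂ)⁻¹ *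
        (Complex.exp (↑(2 * Real.pi * inner ℝ (-(1 / (2 * Real.pi)) * w) s) * Complex.I) •
          𝓕 g (-(1 / (2 * Real.pi)) * w)) := by
    intro w
    rw [pulseHat_eq, smul_eq_mul, mul_assoc, mul_comm (𝓕 g _)]
    congr 3
    simp only [RCLike.inner_apply, conj_trivial]
    push_cast
    field_simp
  simp_rw [this]
  rw [integral_const_mul, hcv]
  simp only [hg, Complex.real_smul]
  push_cast
  field_simp

end Fourier

/-! ### The limit problem -/

/-- Mean value inequality with a variable bound on the derivative. -/
theorem abs_sub_le_integral {g g' B : ℝ → ℝ} {τ : ℝ} (hτ : 0 ≤ τ) (hg : ContinuousOn g (Icc 0 τ))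
    (hg' : ∀ x ∈ Ioo 0 τ, HasDerivAt g (g' x) x) (hB : Continuous B)
    (h : ∀ x ∈ Ioo 0 τ, |g' x| ≤ B x) : |g τ - g 0| ≤ ∫ x in (0 : ℝ)..τ, B x := by
  have hI : ∀ x, HasDerivAt (fun x => ∫ y in (0 : ℝ)..x, B y) (B x) x := fun x =>
    intervalIntegral.integral_hasDerivAt_right (hB.intervalIntegrable _ _)
      hB.stronglyMeasurable.stronglyMeasurableAtFilter hB.continuousAt
  have hIc : Continuous fun x => ∫ y in (0 : ℝ)..x, B y :=
    continuous_iff_continuousAt.mpr fun x => (hI x).continuousAt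
  have h0 : (0 : ℝ) ∈ Icc 0 τ := ⟨le_rfl, hτ⟩
  have h1 : τ ∈ Icc 0 τ := ⟨hτ, le_rfl⟩
  have m1 : MonotoneOn (fun x => (∫ y in (0 : ℝ)..x, B y) - g x) (Icc 0 τ) := by
    refine monotoneOn_of_deriv_nonneg (convex_Icc _ _) (hIc.continuousOn.sub hg) ?_ ?_
    · rw [interior_Icc]
      exact fun x hx => ((hI x).sub (hg' x hx)).differentiableAt.differentiableWithinAt
    · rw [interior_Icc]
      intro x hx
      have hd : HasDerivAt (fun x => (∫ y in (0 : ℝ)..x, B y) - g x) _ x := (hI x).sub (hg' x hx)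
      rw [hd.deriv]
      linarith [le_abs_self (g' x), h x hx]
  have m2 : MonotoneOn (fun x => (∫ y in (0 : ℝ)..x, B y) + g x) (Icc 0 τ) := by
    refine monotoneOn_of_deriv_nonneg (convex_Icc _ _) (hIc.continuousOn.add hg) ?_ ?_
    · rw [interior_Icc]
      exact fun x hx => ((hI x).add (hg' x hx)).differentiableAt.differentiableWithinAt
    · rw [interior_Icc]
      intro x hx
      have hd : HasDerivAt (fun x => (∫ y in (0 : ℝ)..x, B y) + g x) _ x := (hI x).add (hg' x hx)
      rw [hd.deriv]
      linarith [neg_abs_le (g' x), h x hx]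
  have e1 := m1 h0 h1 hτ
  have e2 := m2 h0 h1 hτ
  simp only [intervalIntegral.integral_same] at e1 e2
  rw [abs_le]
  constructor <;> linarith

/-- A bounded family for which every bound `B τ` improves to `K ∫₀^τ B` vanishes. -/
theorem eq_zero_of_volterra {ι : Type*} {X : Set ι} {u : ℝ → ι → ℝ} {K C τ₁ : ℝ} (hK : 0 ≤ K)
    (hC : ∀ τ ∈ Icc 0 τ₁, ∀ i ∈ X, |u τ i| ≤ C)
    (hu : ∀ B : ℝ → ℝ, Continuous B → (∀ τ ∈ Icc 0 τ₁, ∀ i ∈ X, |u τ i| ≤ B τ) →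
      ∀ τ ∈ Icc 0 τ₁, ∀ i ∈ X, |u τ i| ≤ ∫ x in (0 : ℝ)..τ, K * B x) :
    ∀ τ ∈ Icc 0 τ₁, ∀ i ∈ X, u τ i = 0 := by
  intro τ hτ i hi
  have hC0 : 0 ≤ C := (abs_nonneg _).trans (hC τ hτ i hi)
  set l := 2 * K + 1 with hl
  have hl0 : 0 < l := by positivity
  have step : ∀ n : ℕ, ∀ τ ∈ Icc 0 τ₁, ∀ i ∈ X,
      |u τ i| ≤ C * (1 / 2) ^ n * Real.exp (l * τ) := by
    intro n
    induction n with
    | zero =>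
      intro τ hτ i hi
      have := Real.one_le_exp (mul_nonneg hl0.le hτ.1)
      calc |u τ i| ≤ C := hC τ hτ i hi
        _ ≤ C * (1 / 2) ^ 0 * Real.exp (l * τ) := by
          rw [pow_zero, mul_one]; exact le_mul_of_one_le_right hC0 this
    | succ n ih =>
      intro τ hτ i hi
      refine (hu _ (by fun_prop) ih τ hτ i hi).trans ?_
      have hder : ∀ x ∈ uIcc 0 τ, HasDerivAt (fun x => Real.exp (l * x) / l)
          (Real.exp (l * x)) x := fun x _ => by
        have := (((hasDerivAt_id x).const_mul l).exp).div_const l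
        simpa [hl0.ne'] using this
      have hint := intervalIntegral.integral_eq_sub_of_hasDerivAt hder
        (by apply Continuous.intervalIntegrable; fun_prop)
      have : ∀ x, K * (C * (1 / 2) ^ n * Real.exp (l * x)) =
          K * (C * (1 / 2) ^ n) * Real.exp (l * x) := fun x => by ring
      simp_rw [this]
      rw [intervalIntegral.integral_const_mul, hint]
      have hK2 : K / l ≤ 1 / 2 := by rw [div_le_iff₀ hl0]; linarith
      have hp : 0 ≤ C * (1 / 2) ^ n := by positivity
      have e0 : 0 ≤ Real.exp (l * 0) / l := by positivity
      calc K * (C * (1 / 2) ^ n) * (Real.exp (l * τ) / l - Real.exp (l * 0) / l)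
          ≤ K * (C * (1 / 2) ^ n) * (Real.exp (l * τ) / l) := by gcongr; linarith
        _ = K / l * (C * (1 / 2) ^ n * Real.exp (l * τ)) := by ring
        _ ≤ 1 / 2 * (C * (1 / 2) ^ n * Real.exp (l * τ)) := by gcongr
        _ = _ := by ring
  have hlim : Tendsto (fun n : ℕ => C * (1 / 2) ^ n * Real.exp (l * τ)) atTop (𝓝 0) := by
    have := (tendsto_pow_atTop_nhds_zero_of_lt_one (r := (1 / 2 : ℝ)) (by norm_num)
      (by norm_num)).const_mul C |>.mul_const (Real.exp (l * τ))
    simpa using this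
  exact abs_nonpos_iff.mp (ge_of_tendsto' hlim fun n => step n τ hτ i hi)

/-- The one-sided Fourier transform of the kernel, at frequency `2 w`. -/
def kernelHat (Ψ : ℝ → ℝ) (w : ℝ) : ℂ :=
  ∫ u in Ioi (0 : ℝ), (Ψ u : ℂ) * Complex.exp (2 * Complex.I * w * u)

/-- The limit profile, defined for all labels `s` by its Fourier representation. -/
def limitProfile (c₀ : ℝ) (Ψ f : ℝ → ℝ) (τ s : ℝ) : ℝ :=
  (∫ w : ℝ, fourierIntegrand c₀ Ψ f τ s w).re

section

variable {c₀ : ℝ} {Ψ f : ℝ → ℝ}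

theorem fourierIntegrand_eq (τ s w : ℝ) : fourierIntegrand c₀ Ψ f τ s w =
    (2 * Real.pi : ℂ)⁻¹ * pulseHat f w *
      Complex.exp (-(Complex.I * w * s) - (c₀ ^ 2 * τ / 4 : ℂ) * kernelHat Ψ w) := rfl

theorem norm_exp_two_I (w u : ℝ) : ‖Complex.exp (2 * Complex.I * w * u)‖ = 1 := by
  rw [Complex.norm_exp]; simp

theorem norm_kernelHat_le (w : ℝ) : ‖kernelHat Ψ w‖ ≤ ∫ u in Ioi (0 : ℝ), |Ψ u| := by
  refine (norm_integral_le_integral_norm _).trans (le_of_eq ?_)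
  congr 1; ext u
  rw [norm_mul, norm_exp_two_I, mul_one, Complex.norm_real, Real.norm_eq_abs]

theorem continuous_kernelHat (hΨc : Continuous Ψ) (hΨ : IntegrableOn Ψ (Ioi 0)) :
    Continuous (kernelHat Ψ) := by
  refine continuous_of_dominated (bound := fun u => |Ψ u|) (fun w => ?_) (fun w => ?_) hΨ.abs ?_
  · exact (by fun_prop : Continuous fun u : ℝ =>
      (Ψ u : ℂ) * Complex.exp (2 * Complex.I * w * u)).aestronglyMeasurable
  · refine Eventually.of_forall fun u => ?_
    rw [norm_mul, norm_exp_two_I, mul_one, Complex.norm_real, Real.norm_eq_abs]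
  · exact Eventually.of_forall fun u => by fun_prop

theorem norm_fourierIntegrand_le {τ T : ℝ} (hτ : |τ| ≤ T) (s w : ℝ) :
    ‖fourierIntegrand c₀ Ψ f τ s w‖ ≤
      Real.exp (c₀ ^ 2 * T / 4 * ∫ u in Ioi (0 : ℝ), |Ψ u|) * ‖pulseHat f w‖ := by
  have hT : 0 ≤ T := (abs_nonneg _).trans hτ
  have hI : 0 ≤ ∫ u in Ioi (0 : ℝ), |Ψ u| := integral_nonneg fun u => abs_nonneg _
  rw [fourierIntegrand_eq, norm_mul, norm_mul, Complex.norm_exp]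
  have h1 : ‖(2 * Real.pi : ℂ)⁻¹‖ ≤ 1 := by
    rw [norm_inv, norm_mul, Complex.norm_real, Real.norm_eq_abs, abs_of_pos Real.pi_pos]
    apply inv_le_one_of_one_le₀
    simp only [Complex.norm_ofNat]
    linarith [Real.pi_gt_three]
  have h2 : (-(Complex.I * w * s) - (c₀ ^ 2 * τ / 4 : ℂ) * kernelHat Ψ w).re ≤
      c₀ ^ 2 * T / 4 * ∫ u in Ioi (0 : ℝ), |Ψ u| := by
    have e1 : (-(Complex.I * w * s) - (c₀ ^ 2 * τ / 4 : ℂ) * kernelHat Ψ w).re =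
        -(c₀ ^ 2 * τ / 4 * (kernelHat Ψ w).re) := by
      have : (c₀ ^ 2 * τ / 4 : ℂ) = ((c₀ ^ 2 * τ / 4 : ℝ) : ℂ) := by push_cast; ring
      rw [this, Complex.sub_re, Complex.re_ofReal_mul]
      simp
    rw [e1]
    have e2 : |c₀ ^ 2 * τ / 4 * (kernelHat Ψ w).re| ≤
        c₀ ^ 2 * T / 4 * ∫ u in Ioi (0 : ℝ), |Ψ u| := by
      rw [abs_mul, abs_div, abs_mul, abs_of_nonneg (sq_nonneg c₀),
          abs_of_pos (by norm_num : (0 : ℝ) < 4)]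
      have := (Complex.abs_re_le_norm _).trans (norm_kernelHat_le (Ψ := Ψ) w)
      gcongr
    linarith [neg_abs_le (c₀ ^ 2 * τ / 4 * (kernelHat Ψ w).re)]
  calc _ ≤ 1 * ‖pulseHat f w‖ * Real.exp (c₀ ^ 2 * T / 4 * ∫ u in Ioi (0 : ℝ), |Ψ u|) := by
        gcongr
    _ = _ := by ring

end

/-- The data of the limit problem: an integrable continuous kernel and a `C¹` pulse supported in
`[0, S]`. -/
structure IsLimitData (S : ℝ) (Ψ f : ℝ → ℝ) : Prop where
  S_pos : 0 < S
  continuous : Continuous Ψ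
  integrableOn : IntegrableOn Ψ (Ioi 0)
  contDiff : ContDiff ℝ 1 f
  support : Function.support f ⊆ Icc 0 S

namespace IsLimitData

variable {c₀ S : ℝ} {Ψ f : ℝ → ℝ}

theorem hasCompactSupport (D : IsLimitData S Ψ f) : HasCompactSupport f :=
  HasCompactSupport.of_support_subset_isCompact isCompact_Icc D.support

theorem pulse_eq_zero (D : IsLimitData S Ψ f) {s : ℝ} (hs : s ≤ 0) : f s = 0 := by
  have hlt : ∀ s < 0, f s = 0 := fun s hs => by
    by_contra h
    exact absurd (D.support h).1 (not_le.mpr hs)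
  have h1 : Tendsto f (𝓝[<] 0) (𝓝 (f 0)) :=
    D.contDiff.continuous.continuousAt.tendsto.mono_left nhdsWithin_le_nhds
  have h2 : Tendsto f (𝓝[<] 0) (𝓝 0) :=
    tendsto_const_nhds.congr' (eventually_nhdsWithin_of_forall fun s hs => (hlt s hs).symm)
  rcases hs.lt_or_eq with h | h
  · exact hlt s h
  · rw [h]; exact tendsto_nhds_unique h1 h2

theorem continuous_kernelHat (D : IsLimitData S Ψ f) : Continuous (kernelHat Ψ) :=
  PulseFront.continuous_kernelHat D.continuous D.integrableOn

theorem aestronglyMeasurable_fourierIntegrand (D : IsLimitData S Ψ f) (τ s : ℝ) :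
    AEStronglyMeasurable (fourierIntegrand c₀ Ψ f τ s) := by
  have h1 := (integrable_pulseHat D.contDiff D.hasCompactSupport).1
  have h2 := D.continuous_kernelHat
  have h3 : Continuous fun w : ℝ =>
      Complex.exp (-(Complex.I * w * s) - (c₀ ^ 2 * τ / 4 : ℂ) * kernelHat Ψ w) := by fun_prop
  exact (h1.const_mul _).mul h3.aestronglyMeasurable

theorem integrable_fourierIntegrand (D : IsLimitData S Ψ f) (τ s : ℝ) :
    Integrable (fourierIntegrand c₀ Ψ f τ s) :=
  Integrable.mono' ((integrable_pulseHat D.contDiff D.hasCompactSupport).norm.const_mul _)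
    (D.aestronglyMeasurable_fourierIntegrand τ s)
    (Eventually.of_forall fun w => norm_fourierIntegrand_le le_rfl s w)

/-- The Fourier representation is real because its integrand at `-w` is the complex conjugate of
the integrand at `w`. -/
theorem ofReal_limitProfile (τ s : ℝ) :
    (limitProfile c₀ Ψ f τ s : ℂ) = ∫ w : ℝ, fourierIntegrand c₀ Ψ f τ s w := by
  have hpulse : ∀ w, pulseHat f (-w) = (starRingEnd ℂ) (pulseHat f w) := fun w => by
    rw [pulseHat, pulseHat, ← integral_conj]
    congr 1; ext s
    rw [map_mul, Complex.conj_ofReal, ← Complex.exp_conj, map_mul, map_mul, Complex.conj_I,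
      Complex.conj_ofReal, Complex.conj_ofReal]
    push_cast; ring_nf
  have hker : ∀ w, kernelHat Ψ (-w) = (starRingEnd ℂ) (kernelHat Ψ w) := fun w => by
    rw [kernelHat, kernelHat, ← integral_conj]
    congr 1; ext s
    rw [map_mul, Complex.conj_ofReal, ← Complex.exp_conj, map_mul, map_mul, map_mul, Complex.conj_I,
      Complex.conj_ofReal, Complex.conj_ofReal, Complex.conj_ofNat]
    push_cast; ring_nf
  have hsymm : ∀ w : ℝ, fourierIntegrand c₀ Ψ f τ s (-w) =
      (starRingEnd ℂ) (fourierIntegrand c₀ Ψ f τ s w) := fun w => by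
    rw [fourierIntegrand_eq, fourierIntegrand_eq, hpulse, hker, map_mul, map_mul,
      ← Complex.exp_conj]
    simp only [map_sub, map_neg, map_mul, map_inv₀, map_div₀, map_pow, Complex.conj_I,
      Complex.conj_ofReal, Complex.conj_ofNat]
    push_cast; ring_nf
  have hconj : (starRingEnd ℂ) (∫ w : ℝ, fourierIntegrand c₀ Ψ f τ s w) =
      ∫ w : ℝ, fourierIntegrand c₀ Ψ f τ s w := by
    rw [← integral_conj, ← integral_neg_eq_self]
    simp_rw [hsymm, Complex.conj_conj]
  exact Complex.conj_eq_iff_re.mp hconj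

theorem abs_limitProfile_le (D : IsLimitData S Ψ f) {τ T : ℝ} (hτ : |τ| ≤ T) (s : ℝ) :
    |limitProfile c₀ Ψ f τ s| ≤ ∫ w : ℝ,
      Real.exp (c₀ ^ 2 * T / 4 * ∫ u in Ioi (0 : ℝ), |Ψ u|) * ‖pulseHat f w‖ :=
  (Complex.abs_re_le_norm _).trans (norm_integral_le_of_norm_le
    ((integrable_pulseHat D.contDiff D.hasCompactSupport).norm.const_mul _)
    (Eventually.of_forall fun w => norm_fourierIntegrand_le hτ s w))

theorem continuous_limitProfile (D : IsLimitData S Ψ f) :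
    Continuous fun x : ℝ × ℝ => limitProfile c₀ Ψ f x.1 x.2 := by
  refine Complex.continuous_re.comp (continuous_iff_continuousAt.mpr fun x₀ => ?_)
  refine continuousAt_of_dominated
    (F := fun (x : ℝ × ℝ) w => fourierIntegrand c₀ Ψ f x.1 x.2 w)
    (bound := fun w => Real.exp (c₀ ^ 2 * (|x₀.1| + 1) / 4 * ∫ u in Ioi (0 : ℝ), |Ψ u|) *
      ‖pulseHat f w‖)
    (Eventually.of_forall fun x => D.aestronglyMeasurable_fourierIntegrand x.1 x.2) ?_
    ((integrable_pulseHat D.contDiff D.hasCompactSupport).norm.const_mul _) ?_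
  · have : ∀ᶠ x : ℝ × ℝ in 𝓝 x₀, |x.1| < |x₀.1| + 1 :=
      (by fun_prop : Continuous fun x : ℝ × ℝ => |x.1|).continuousAt.eventually_lt
        continuousAt_const (by linarith)
    filter_upwards [this] with x hx
    exact Eventually.of_forall fun w => norm_fourierIntegrand_le hx.le _ w
  · refine Eventually.of_forall fun w => ?_
    simp_rw [fourierIntegrand_eq]
    fun_prop

theorem limitProfile_zero (D : IsLimitData S Ψ f) (s : ℝ) : limitProfile c₀ Ψ f 0 s = f s := by
  have h := integral_pulseHat D.contDiff D.hasCompactSupport s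
  have : ∀ w, fourierIntegrand c₀ Ψ f 0 s w =
      (2 * Real.pi : ℂ)⁻¹ * pulseHat f w * Complex.exp (-(Complex.I * w * s)) := fun w => by
    rw [fourierIntegrand_eq]; simp
  rw [limitProfile]
  simp_rw [this, h]
  simp

/-- Multiplication by `kernelHat Ψ` in frequency is a one sided convolution in the label. -/
theorem integral_kernelHat_mul (D : IsLimitData S Ψ f) (τ s : ℝ) :
    ∫ w : ℝ, kernelHat Ψ w * fourierIntegrand c₀ Ψ f τ s w =
      ∫ u in Ioi (0 : ℝ), (Ψ u : ℂ) * limitProfile c₀ Ψ f τ (s - 2 * u) := by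
  have hshift : ∀ w u : ℝ, Complex.exp (2 * Complex.I * w * u) * fourierIntegrand c₀ Ψ f τ s w =
      fourierIntegrand c₀ Ψ f τ (s - 2 * u) w := fun w u => by
    rw [fourierIntegrand_eq, fourierIntegrand_eq, mul_left_comm, ← Complex.exp_add]
    push_cast; ring_nf
  have hint : Integrable (Function.uncurry fun (w u : ℝ) =>
      (Ψ u : ℂ) * fourierIntegrand c₀ Ψ f τ (s - 2 * u) w)
      (volume.prod (volume.restrict (Ioi 0))) := by
    have hb := (D.integrable_fourierIntegrand (c₀ := c₀) τ s).mul_prod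
      (D.integrableOn.ofReal (𝕜 := ℂ))
    have he : Continuous fun x : ℝ × ℝ => Complex.exp (2 * Complex.I * x.1 * x.2) := by fun_prop
    have := hb.bdd_mul (c := 1) he.aestronglyMeasurable
      (Eventually.of_forall fun x => (norm_exp_two_I x.1 x.2).le)
    refine this.congr (Eventually.of_forall fun x => ?_)
    simp only [Function.uncurry]
    rw [← hshift]
    simp only [Complex.coe_algebraMap]
    ring
  calc _ = ∫ w : ℝ, ∫ u in Ioi (0 : ℝ), (Ψ u : ℂ) * fourierIntegrand c₀ Ψ f τ (s - 2 * u) w := by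
        congr 1; ext w
        rw [kernelHat, ← integral_mul_const]
        congr 1; ext u
        rw [mul_assoc, hshift]
    _ = ∫ u in Ioi (0 : ℝ), ∫ w : ℝ, (Ψ u : ℂ) * fourierIntegrand c₀ Ψ f τ (s - 2 * u) w :=
        integral_integral_swap hint
    _ = _ := by
        congr 1; ext u
        rw [integral_const_mul, ofReal_limitProfile]

/-- The evolution equation on the whole line of labels, obtained by differentiating the Fourier
representation and exchanging the order of integration. -/
theorem hasDerivAt_limitProfile (D : IsLimitData S Ψ f) (τ s : ℝ) :
    HasDerivAt (fun τ => limitProfile c₀ Ψ f τ s)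
      (-(c₀ ^ 2 / 4) * ∫ u in Ioi (0 : ℝ), Ψ u * limitProfile c₀ Ψ f τ (s - 2 * u)) τ := by
  set I := ∫ u in Ioi (0 : ℝ), |Ψ u| with hI
  have hI0 : 0 ≤ I := integral_nonneg fun u => abs_nonneg _
  have key := (hasDerivAt_integral_of_dominated_loc_of_deriv_le (x₀ := τ)
    (F := fun τ w => fourierIntegrand c₀ Ψ f τ s w)
    (F' := fun τ w => -(c₀ ^ 2 / 4 : ℂ) * (kernelHat Ψ w * fourierIntegrand c₀ Ψ f τ s w))
    (s := Metric.ball τ 1)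
    (bound := fun w => c₀ ^ 2 / 4 * (I * (Real.exp (c₀ ^ 2 * (|τ| + 1) / 4 * I) * ‖pulseHat f w‖)))
    (Metric.ball_mem_nhds _ one_pos)
    (Eventually.of_forall fun τ => D.aestronglyMeasurable_fourierIntegrand τ s)
    (D.integrable_fourierIntegrand τ s)
    ((D.continuous_kernelHat.aestronglyMeasurable.mul
      (D.aestronglyMeasurable_fourierIntegrand τ s)).const_mul _) ?_
    (((integrable_pulseHat D.contDiff D.hasCompactSupport).norm.const_mul _).const_mul _ |>.const_mul
      _) ?_).2
  · rw [integral_const_mul, D.integral_kernelHat_mul] at key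
    have hre := Complex.reCLM.hasFDerivAt.comp_hasDerivAt τ key
    have hval : (Complex.reCLM (-(c₀ ^ 2 / 4 : ℂ) *
        ∫ u in Ioi (0 : ℝ), (Ψ u : ℂ) * limitProfile c₀ Ψ f τ (s - 2 * u))) =
        -(c₀ ^ 2 / 4) * ∫ u in Ioi (0 : ℝ), Ψ u * limitProfile c₀ Ψ f τ (s - 2 * u) := by
      have h1 : ∫ u in Ioi (0 : ℝ), (Ψ u : ℂ) * limitProfile c₀ Ψ f τ (s - 2 * u) =
          ((∫ u in Ioi (0 : ℝ), Ψ u * limitProfile c₀ Ψ f τ (s - 2 * u) : ℝ) : ℂ) := by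
        rw [← integral_complex_ofReal]; push_cast; rfl
      rw [h1, Complex.reCLM_apply]
      have h2 : -(c₀ ^ 2 / 4 : ℂ) = ((-(c₀ ^ 2 / 4) : ℝ) : ℂ) := by push_cast; ring
      rw [h2, ← Complex.ofReal_mul, Complex.ofReal_re]
    rw [hval] at hre
    exact hre
  · refine Eventually.of_forall fun w x hx => ?_
    have hx' : |x| ≤ |τ| + 1 := by
      have := abs_sub_abs_le_abs_sub x τ
      rw [Metric.mem_ball, Real.dist_eq] at hx
      linarith
    rw [norm_mul, norm_mul]
    have h1 : ‖-(c₀ ^ 2 / 4 : ℂ)‖ = c₀ ^ 2 / 4 := by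
      have h2 : -(c₀ ^ 2 / 4 : ℂ) = ((-(c₀ ^ 2 / 4) : ℝ) : ℂ) := by push_cast; ring
      rw [h2, Complex.norm_real, norm_neg, Real.norm_eq_abs, abs_of_nonneg (by positivity)]
    rw [h1]
    have h3 := norm_kernelHat_le (Ψ := Ψ) w
    have h4 := norm_fourierIntegrand_le (c₀ := c₀) (Ψ := Ψ) (f := f) hx' s w
    gcongr
  · refine Eventually.of_forall fun w x _ => ?_
    simp_rw [fourierIntegrand_eq]
    have h1 : HasDerivAt (fun x : ℝ => -(Complex.I * w * s) - (c₀ ^ 2 * x / 4 : ℂ) * kernelHat Ψ w)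
        (-(c₀ ^ 2 / 4 : ℂ) * kernelHat Ψ w) x := by
      have := (((Complex.ofRealCLM.hasDerivAt (x := x)).const_mul (c₀ ^ 2 / 4 : ℂ)).mul_const
        (kernelHat Ψ w)).const_sub (-(Complex.I * w * s))
      refine (this.congr_deriv (by simp)).congr_of_eventuallyEq
        (Eventually.of_forall fun x => ?_)
      simp only [Complex.ofRealCLM_apply]
      ring
    have := h1.cexp.const_mul ((2 * Real.pi : ℂ)⁻¹ * pulseHat f w)
    exact this.congr_deriv (by ring)

theorem integral_abs_mul_le (D : IsLimitData S Ψ f) {g : ℝ → ℝ} {C : ℝ}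
    (hg : ∀ u, 0 < u → |g u| ≤ C) :
    |∫ u in Ioi (0 : ℝ), Ψ u * g u| ≤ (∫ u in Ioi (0 : ℝ), |Ψ u|) * C := by
  rw [← integral_mul_const, ← Real.norm_eq_abs]
  refine norm_integral_le_of_norm_le (D.integrableOn.abs.mul_const C) ?_
  filter_upwards [ae_restrict_mem measurableSet_Ioi] with u hu
  rw [norm_mul]
  exact mul_le_mul_of_nonneg_left (hg u hu) (norm_nonneg _)

/-- Causality: the evolution of the profile at nonpositive labels involves nonpositive labels only,
where the initial value vanishes. -/
theorem limitProfile_eq_zero (D : IsLimitData S Ψ f) {τ s : ℝ} (hτ : 0 ≤ τ) (hs : s ≤ 0) :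
    limitProfile c₀ Ψ f τ s = 0 := by
  set I := ∫ u in Ioi (0 : ℝ), |Ψ u| with hI
  have hI0 : 0 ≤ I := integral_nonneg fun u => abs_nonneg _
  refine eq_zero_of_volterra (X := Iic (0 : ℝ)) (u := fun τ s => limitProfile c₀ Ψ f τ s)
    (K := c₀ ^ 2 / 4 * I) (τ₁ := τ) (by positivity)
    (fun x hx s _ => D.abs_limitProfile_le (T := τ) (by rw [abs_of_nonneg hx.1]; exact hx.2) s)
    ?_ τ ⟨hτ, le_rfl⟩ s hs
  intro B hBc hB x hx s hs
  have hc : Continuous fun τ => limitProfile c₀ Ψ f τ s :=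
    D.continuous_limitProfile.comp (by fun_prop : Continuous fun τ : ℝ => (τ, s))
  have := abs_sub_le_integral (g := fun τ => limitProfile c₀ Ψ f τ s) hx.1 hc.continuousOn
    (fun y _ => D.hasDerivAt_limitProfile y s) (B := fun y => c₀ ^ 2 / 4 * I * B y) (by fun_prop)
    fun y hy => ?_
  · rwa [D.limitProfile_zero, D.pulse_eq_zero hs, sub_zero] at this
  · rw [abs_mul, abs_neg, abs_of_nonneg (by positivity : 0 ≤ c₀ ^ 2 / 4), mul_assoc]
    refine mul_le_mul_of_nonneg_left ?_ (by positivity)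
    refine D.integral_abs_mul_le fun u hu => hB y ⟨hy.1.le, hy.2.le.trans hx.2⟩ _ ?_
    have : s ≤ 0 := hs
    simp only [mem_Iic]; linarith

theorem integral_Ioi_eq (D : IsLimitData S Ψ f) {τ s a : ℝ} (hτ : 0 ≤ τ) (ha : 0 ≤ a)
    (hsa : s ≤ 2 * a) :
    ∫ u in Ioi (0 : ℝ), Ψ u * limitProfile c₀ Ψ f τ (s - 2 * u) =
      ∫ u in (0 : ℝ)..a, Ψ u * limitProfile c₀ Ψ f τ (s - 2 * u) := by
  rw [intervalIntegral.integral_of_le ha]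
  refine setIntegral_eq_of_subset_of_forall_sdiff_eq_zero measurableSet_Ioi
    Ioc_subset_Ioi_self fun u hu => ?_
  have hua : a < u := by
    by_contra! h
    exact hu.2 ⟨hu.1, h⟩
  rw [D.limitProfile_eq_zero hτ (by linarith), mul_zero]

/-- The Fourier formula solves the integrated limit equation; the integral over `(0, ∞)` is cut off at
`S + 1` because the profile vanishes for negative labels. -/
theorem isProfile (D : IsLimitData S Ψ f) :
    IsProfile S (fun h => c₀ ^ 2 * Ψ h) f (limitProfile c₀ Ψ f) where
  continuous := D.continuous_limitProfile
  continuous_kernel := continuous_const.mul D.continuous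
  eq_zero τ hτ s hs := D.limitProfile_eq_zero hτ hs
  eq τ hτ s hs := by
    have hjoint : Continuous fun p : ℝ × ℝ =>
        c₀ ^ 2 * Ψ p.2 * limitProfile c₀ Ψ f p.1 (s - 2 * p.2) :=
      (continuous_const.mul (D.continuous.comp continuous_snd)).mul
        (D.continuous_limitProfile.comp
          (by fun_prop : Continuous fun p : ℝ × ℝ => (p.1, s - 2 * p.2)))
    have hc : Continuous fun x => ∫ h in (0 : ℝ)..(S + 1),
        c₀ ^ 2 * Ψ h * limitProfile c₀ Ψ f x (s - 2 * h) :=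
      intervalIntegral.continuous_parametric_intervalIntegral_of_continuous'
        (f := fun x h => c₀ ^ 2 * Ψ h * limitProfile c₀ Ψ f x (s - 2 * h)) hjoint 0 (S + 1)
    have hS := D.S_pos
    have := intervalIntegral.integral_eq_sub_of_hasDerivAt (a := 0) (b := τ)
      (f := fun τ => limitProfile c₀ Ψ f τ s)
      (f' := fun x => -(1 / 4) * ∫ h in (0 : ℝ)..(S + 1),
        c₀ ^ 2 * Ψ h * limitProfile c₀ Ψ f x (s - 2 * h)) (fun x hx => ?_)
      ((continuous_const.mul hc).intervalIntegrable _ _)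
    · rw [D.limitProfile_zero, intervalIntegral.integral_const_mul] at this
      linarith
    · rw [uIcc_of_le hτ] at hx
      have hd := D.hasDerivAt_limitProfile (c₀ := c₀) x s
      rw [D.integral_Ioi_eq (a := S + 1) hx.1 (by linarith) (by linarith [hs.2])] at hd
      have e : ∫ h in (0 : ℝ)..(S + 1), c₀ ^ 2 * Ψ h * limitProfile c₀ Ψ f x (s - 2 * h) =
          c₀ ^ 2 * ∫ h in (0 : ℝ)..(S + 1), Ψ h * limitProfile c₀ Ψ f x (s - 2 * h) := by
        rw [← intervalIntegral.integral_const_mul]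
        congr 1; ext h; ring
      simp only [e]
      exact hd.congr_deriv (by ring)

theorem solvesLimitProblem (D : IsLimitData S Ψ f) :
    SolvesLimitProblem c₀ S Ψ f (limitProfile c₀ Ψ f) where
  continuous := D.continuous_limitProfile.continuousOn
  evolution τ hτ s hs := by
    have hd := D.hasDerivAt_limitProfile (c₀ := c₀) τ s
    rw [D.integral_Ioi_eq (a := s / 2) hτ.le (by linarith [hs.1]) (by linarith)] at hd
    convert hd using 1
    have := intervalIntegral.integral_comp_mul_add (a := 0) (b := s / 2)
      (fun y => limitProfile c₀ Ψ f τ y * Ψ ((s - y) / 2)) (c := -2) (by norm_num) s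
    have e : ∀ u : ℝ, limitProfile c₀ Ψ f τ (-2 * u + s) * Ψ ((s - (-2 * u + s)) / 2) =
        Ψ u * limitProfile c₀ Ψ f τ (s - 2 * u) := fun u => by
      rw [show (s - (-2 * u + s)) / 2 = u by ring, show -2 * u + s = s - 2 * u by ring, mul_comm]
    simp_rw [e] at this
    rw [this, show -2 * 0 + s = s by ring, show -2 * (s / 2) + s = 0 by ring,
      intervalIntegral.integral_symm, smul_eq_mul]
    ring
  initial s _ := D.limitProfile_zero s

theorem unique (D : IsLimitData S Ψ f) {b : ℝ → ℝ → ℝ} (hb : SolvesLimitProblem c₀ S Ψ f b)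
    {τ s : ℝ} (hτ : 0 ≤ τ) (hs : s ∈ Icc 0 S) : b τ s = limitProfile c₀ Ψ f τ s := by
  have hS := D.S_pos
  have hp := D.solvesLimitProblem (c₀ := c₀)
  obtain ⟨CΨ, hCΨ⟩ := (isCompact_Icc (a := (0 : ℝ)) (b := S)).exists_bound_of_continuousOn
    D.continuous.continuousOn
  have hCΨ0 : 0 ≤ CΨ := (norm_nonneg _).trans (hCΨ 0 ⟨le_rfl, hS.le⟩)
  have hdc : ContinuousOn (fun x : ℝ × ℝ => b x.1 x.2 - limitProfile c₀ Ψ f x.1 x.2)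
      (Ici 0 ×ˢ Icc 0 S) := hb.continuous.sub hp.continuous
  obtain ⟨C, hC⟩ := ((isCompact_Icc (a := (0 : ℝ)) (b := τ)).prod
    (isCompact_Icc (a := (0 : ℝ)) (b := S))).exists_bound_of_continuousOn
      (hdc.mono (prod_mono Icc_subset_Ici_self subset_rfl))
  refine sub_eq_zero.mp (eq_zero_of_volterra (X := Icc 0 S)
    (u := fun τ s => b τ s - limitProfile c₀ Ψ f τ s) (K := c₀ ^ 2 / 8 * (S * CΨ)) (τ₁ := τ)
    (by positivity) (fun x hx s hs => hC (x, s) ⟨hx, hs⟩) ?_ τ ⟨hτ, le_rfl⟩ s hs)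
  intro B hBc hB x hx s hs
  have hsec : ∀ y, 0 ≤ y → ContinuousOn (fun s => b y s) (Icc 0 S) := fun y hy =>
    hb.continuous.comp (f := fun s => (y, s)) (by fun_prop) fun s hs => ⟨hy, hs⟩
  have hsec' : ∀ y, Continuous fun s => limitProfile c₀ Ψ f y s := fun y =>
    D.continuous_limitProfile.comp (by fun_prop : Continuous fun s : ℝ => (y, s))
  have := abs_sub_le_integral (g := fun y => b y s - limitProfile c₀ Ψ f y s) hx.1
    (hdc.comp (f := fun y => (y, s)) (by fun_prop) fun y hy => ⟨hy.1, hs⟩)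
    (fun y hy => (hb.evolution y hy.1 s hs).sub (hp.evolution y hy.1 s hs))
    (B := fun y => c₀ ^ 2 / 8 * (S * CΨ) * B y) (by fun_prop) fun y hy => ?_
  · simpa [hb.initial s hs, hp.initial s hs] using this
  · have hy' : y ∈ Icc 0 τ := ⟨hy.1.le, hy.2.le.trans hx.2⟩
    have hΨs : Continuous fun z => Ψ ((s - z) / 2) := D.continuous.comp (by fun_prop)
    have i1 : IntervalIntegrable (fun z => b y z * Ψ ((s - z) / 2)) volume 0 s :=
      (((hsec y hy'.1).mono (Icc_subset_Icc_right hs.2)).mul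
        hΨs.continuousOn).intervalIntegrable_of_Icc hs.1
    have i2 : IntervalIntegrable (fun z => limitProfile c₀ Ψ f y z * Ψ ((s - z) / 2)) volume 0 s :=
      ((hsec' y).mul hΨs).intervalIntegrable _ _
    rw [← mul_sub, ← intervalIntegral.integral_sub i1 i2, abs_mul, abs_neg,
      abs_of_nonneg (by positivity : 0 ≤ c₀ ^ 2 / 8), mul_assoc]
    refine mul_le_mul_of_nonneg_left ?_ (by positivity)
    have hB0 : 0 ≤ B y := (abs_nonneg _).trans (hB y hy' s hs)
    have := intervalIntegral.norm_integral_le_of_norm_le_const (a := 0) (b := s)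
      (f := fun z => b y z * Ψ ((s - z) / 2) - limitProfile c₀ Ψ f y z * Ψ ((s - z) / 2))
      (C := B y * CΨ) fun z hz => by
        rw [uIoc_of_le hs.1] at hz
        rw [← sub_mul, norm_mul]
        exact mul_le_mul (hB y hy' z ⟨hz.1.le, hz.2.trans hs.2⟩)
          (hCΨ _ ⟨by linarith [hz.2], by linarith [hz.1, hs.2]⟩) (norm_nonneg _) hB0
    rw [Real.norm_eq_abs, sub_zero, abs_of_nonneg hs.1] at this
    refine this.trans ?_
    have h1 : B y * CΨ * s ≤ B y * CΨ * S := by gcongr; exact hs.2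
    linarith

end IsLimitData

/-! ### The medium in units adapted to the regime -/

/-- A field `n x y` with continuous bounded partial derivatives `nx`, `ny` that are Lipschitz. -/
structure IsSmoothField (M : ℝ) (n nx ny : ℝ → ℝ → ℝ) : Prop where
  nonneg : 0 ≤ M
  continuous : Continuous fun p : ℝ × ℝ => n p.1 p.2
  continuous_x : Continuous fun p : ℝ × ℝ => nx p.1 p.2
  continuous_y : Continuous fun p : ℝ × ℝ => ny p.1 p.2
  hasFDerivAt : ∀ p : ℝ × ℝ, HasFDerivAt (fun p : ℝ × ℝ => n p.1 p.2)
    (nx p.1 p.2 • ContinuousLinearMap.fst ℝ ℝ ℝ + ny p.1 p.2 • ContinuousLinearMap.snd ℝ ℝ ℝ) p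
  bound : ∀ x y, |n x y| ≤ M
  bound_x : ∀ x y, |nx x y| ≤ M
  bound_y : ∀ x y, |ny x y| ≤ M
  lipschitz_x : ∀ x y x' y', |nx x y - nx x' y'| ≤ M * (|x - x'| + |y - y'|)
  lipschitz_y : ∀ x y x' y', |ny x y - ny x' y'| ≤ M * (|x - x'| + |y - y'|)

namespace IsSmoothField

variable {M : ℝ} {n nx ny : ℝ → ℝ → ℝ}

theorem hasDerivAt_comp (N : IsSmoothField M n nx ny) {u v : ℝ → ℝ} {u' v' x : ℝ}
    (hu : HasDerivAt u u' x) (hv : HasDerivAt v v' x) :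
    HasDerivAt (fun x => n (u x) (v x)) (nx (u x) (v x) * u' + ny (u x) (v x) * v') x := by
  have := (N.hasFDerivAt (u x, v x)).comp_hasDerivAt x (hu.prodMk hv)
  exact this.congr_deriv (by simp)

theorem hasDerivAt_x (N : IsSmoothField M n nx ny) (x y : ℝ) :
    HasDerivAt (fun x => n x y) (nx x y) x := by
  simpa using N.hasDerivAt_comp (hasDerivAt_id x) (hasDerivAt_const x y)

theorem hasDerivAt_y (N : IsSmoothField M n nx ny) (x y : ℝ) :
    HasDerivAt (fun y => n x y) (ny x y) y := by
  simpa using N.hasDerivAt_comp (hasDerivAt_const y x) (hasDerivAt_id y)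

theorem abs_sub_le_x (N : IsSmoothField M n nx ny) (x x' y : ℝ) :
    |n x y - n x' y| ≤ M * |x - x'| :=
  convex_univ.norm_image_sub_le_of_norm_hasDerivWithin_le (f := fun x => n x y)
    (fun x _ => (N.hasDerivAt_x x y).hasDerivWithinAt) (fun x _ => N.bound_x x y)
    (mem_univ x') (mem_univ x)

theorem abs_sub_le_y (N : IsSmoothField M n nx ny) (x y y' : ℝ) :
    |n x y - n x y'| ≤ M * |y - y'| :=
  convex_univ.norm_image_sub_le_of_norm_hasDerivWithin_le (f := fun y => n x y)
    (fun y _ => (N.hasDerivAt_y x y).hasDerivWithinAt) (fun y _ => N.bound_y x y)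
    (mem_univ y') (mem_univ y)

/-- First order Taylor expansion in the second variable. -/
theorem abs_taylor_y_le (N : IsSmoothField M n nx ny) (x y y' : ℝ) :
    |n x y' - n x y - ny x y * (y' - y)| ≤ M * |y' - y| * |y' - y| := by
  have := (convex_uIcc y y').norm_image_sub_le_of_norm_hasDerivWithin_le
    (f := fun z => n x z - ny x y * z) (f' := fun z => ny x z - ny x y) (C := M * |y' - y|)
    (fun z _ => ((N.hasDerivAt_y x z).sub
      (by simpa using (hasDerivAt_id z).const_mul (ny x y))).hasDerivWithinAt)
    (fun z hz => ?_) left_mem_uIcc right_mem_uIcc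
  · rw [Real.norm_eq_abs, Real.norm_eq_abs] at this
    convert this using 2
    ring
  · refine (N.lipschitz_y x z x y).trans ?_
    rw [sub_self, abs_zero, zero_add]
    have := abs_sub_left_of_mem_uIcc hz
    have hM := N.nonneg
    gcongr

end IsSmoothField

theorem hasFDerivAt_of_differentiableAt {m : ℝ → ℝ → ℝ} {p : ℝ × ℝ}
    (hm : DifferentiableAt ℝ (fun x : ℝ × ℝ => m x.1 x.2) p) :
    HasFDerivAt (fun x : ℝ × ℝ => m x.1 x.2)
      (timeDeriv m p.1 p.2 • ContinuousLinearMap.fst ℝ ℝ ℝ +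
        rangeDeriv m p.1 p.2 • ContinuousLinearMap.snd ℝ ℝ ℝ) p ∧
      timeDeriv m p.1 p.2 = fderiv ℝ (fun x : ℝ × ℝ => m x.1 x.2) p (1, 0) ∧
      rangeDeriv m p.1 p.2 = fderiv ℝ (fun x : ℝ × ℝ => m x.1 x.2) p (0, 1) := by
  have h := hm.hasFDerivAt
  have ht : HasDerivAt (fun t => m t p.2) (fderiv ℝ (fun x : ℝ × ℝ => m x.1 x.2) p (1, 0)) p.1 :=
    h.comp_hasDerivAt (f := fun t => (t, p.2)) p.1
      ((hasDerivAt_id p.1).prodMk (hasDerivAt_const p.1 p.2))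
  have hz : HasDerivAt (fun z => m p.1 z) (fderiv ℝ (fun x : ℝ × ℝ => m x.1 x.2) p (0, 1)) p.2 :=
    h.comp_hasDerivAt (f := fun z => (p.1, z)) p.2
      ((hasDerivAt_const p.2 p.1).prodMk (hasDerivAt_id p.2))
  have et : timeDeriv m p.1 p.2 = _ := ht.deriv
  have ez : rangeDeriv m p.1 p.2 = _ := hz.deriv
  refine ⟨h.congr_fderiv ?_, et, ez⟩
  ext
  · simp [et]
  · simp [ez]

/-- The medium as a function of the coordinate `x` of decorrelation and the other coordinate `y`,
both measured in units of time. -/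
def Regime.unitField (R : Regime) (c₀ : ℝ) (m : ℝ → ℝ → ℝ) (x y : ℝ) : ℝ :=
  match R with
  | .slow => m y (c₀ * x)
  | .rapid => m x (c₀ * y)

/-- The partial derivative of `Regime.unitField` in the coordinate of decorrelation. -/
def Regime.unitFieldX (R : Regime) (c₀ : ℝ) (m : ℝ → ℝ → ℝ) (x y : ℝ) : ℝ :=
  match R with
  | .slow => c₀ * rangeDeriv m y (c₀ * x)
  | .rapid => timeDeriv m x (c₀ * y)

/-- The partial derivative of `Regime.unitField` in the other coordinate. -/
def Regime.unitFieldY (R : Regime) (c₀ : ℝ) (m : ℝ → ℝ → ℝ) (x y : ℝ) : ℝ :=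
  match R with
  | .slow => timeDeriv m y (c₀ * x)
  | .rapid => c₀ * rangeDeriv m x (c₀ * y)

theorem exists_deriv_bounds {m : ℝ → ℝ → ℝ} {M : ℝ}
    (hm : ContDiff ℝ 2 fun x : ℝ × ℝ => m x.1 x.2)
    (hM : ∀ x : ℝ × ℝ, ∀ k : ℕ, k ≤ 2 →
      ‖iteratedFDeriv ℝ k (fun y : ℝ × ℝ => m y.1 y.2) x‖ ≤ M) :
    0 ≤ M ∧ (∀ t z, |m t z| ≤ M) ∧ (∀ t z, |timeDeriv m t z| ≤ M) ∧
      (∀ t z, |rangeDeriv m t z| ≤ M) ∧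
      (∀ t z t' z', |timeDeriv m t z - timeDeriv m t' z'| ≤ M * (|t - t'| + |z - z'|)) ∧
      (∀ t z t' z', |rangeDeriv m t z - rangeDeriv m t' z'| ≤ M * (|t - t'| + |z - z'|)) := by
  set F : ℝ × ℝ → ℝ := fun x => m x.1 x.2 with hF
  have h1 : ∀ x, ‖fderiv ℝ F x‖ ≤ M := fun x => by
    have := hM x 1 (by norm_num)
    rwa [norm_iteratedFDeriv_one] at this
  have hM0 : 0 ≤ M := (norm_nonneg _).trans (h1 0)
  have h2 : ∀ x, ‖fderiv ℝ (fderiv ℝ F) x‖ ≤ M := fun x => by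
    have := hM x 2 le_rfl
    rwa [← norm_iteratedFDeriv_fderiv, norm_iteratedFDeriv_one] at this
  have hd : Differentiable ℝ (fderiv ℝ F) :=
    (hm.fderiv_right (m := 1) (by norm_num)).differentiable (by norm_num)
  have hL : ∀ p q : ℝ × ℝ, ‖fderiv ℝ F p - fderiv ℝ F q‖ ≤ M * (|p.1 - q.1| + |p.2 - q.2|) := by
    intro p q
    refine (convex_univ.norm_image_sub_le_of_norm_fderiv_le (𝕜 := ℝ) (fun x _ => hd x)
      (fun x _ => h2 x) (mem_univ q) (mem_univ p)).trans ?_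
    refine mul_le_mul_of_nonneg_left ?_ hM0
    rw [Prod.norm_def]
    exact max_le (le_add_of_nonneg_right (abs_nonneg _)) (le_add_of_nonneg_left (abs_nonneg _))
  have hfd := fun p => hasFDerivAt_of_differentiableAt (hm.differentiable (by norm_num) p)
  have e1 : ‖((1, 0) : ℝ × ℝ)‖ = 1 := by simp [Prod.norm_def]
  have e2 : ‖((0, 1) : ℝ × ℝ)‖ = 1 := by simp [Prod.norm_def]
  refine ⟨hM0, fun t z => ?_, fun t z => ?_, fun t z => ?_, fun t z t' z' => ?_,
    fun t z t' z' => ?_⟩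
  · have := hM (t, z) 0 (by norm_num)
    rwa [norm_iteratedFDeriv_zero] at this
  · rw [(hfd (t, z)).2.1]
    have := (fderiv ℝ F (t, z)).le_opNorm (1, 0)
    rw [e1, mul_one] at this
    exact this.trans (h1 _)
  · rw [(hfd (t, z)).2.2]
    have := (fderiv ℝ F (t, z)).le_opNorm (0, 1)
    rw [e2, mul_one] at this
    exact this.trans (h1 _)
  · rw [(hfd (t, z)).2.1, (hfd (t', z')).2.1]
    have := (fderiv ℝ F (t, z) - fderiv ℝ F (t', z')).le_opNorm (1, 0)
    rw [e1, mul_one] at this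
    exact this.trans (hL _ _)
  · rw [(hfd (t, z)).2.2, (hfd (t', z')).2.2]
    have := (fderiv ℝ F (t, z) - fderiv ℝ F (t', z')).le_opNorm (0, 1)
    rw [e2, mul_one] at this
    exact this.trans (hL _ _)

theorem isSmoothField_unitField (R : Regime) {c₀ M : ℝ} (hc₀ : 0 < c₀) {m : ℝ → ℝ → ℝ}
    (hm : ContDiff ℝ 2 fun x : ℝ × ℝ => m x.1 x.2)
    (hM : ∀ x : ℝ × ℝ, ∀ k : ℕ, k ≤ 2 →
      ‖iteratedFDeriv ℝ k (fun y : ℝ × ℝ => m y.1 y.2) x‖ ≤ M) :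
    IsSmoothField (M * (1 + c₀) ^ 2) (R.unitField c₀ m) (R.unitFieldX c₀ m)
      (R.unitFieldY c₀ m) := by
  obtain ⟨hM0, b, bt, bz, lt, lz⟩ := exists_deriv_bounds hm hM
  have hfd := fun p => hasFDerivAt_of_differentiableAt (hm.differentiable (by norm_num) p)
  have hct : Continuous fun x : ℝ × ℝ => timeDeriv m x.1 x.2 := by
    simp_rw [fun p => (hfd p).2.1]
    exact (hm.continuous_fderiv (by norm_num)).clm_apply continuous_const
  have hcz : Continuous fun x : ℝ × ℝ => rangeDeriv m x.1 x.2 := by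
    simp_rw [fun p => (hfd p).2.2]
    exact (hm.continuous_fderiv (by norm_num)).clm_apply continuous_const
  have k1 : M ≤ M * (1 + c₀) ^ 2 := by
    refine le_mul_of_one_le_right hM0 ?_; nlinarith
  have k2 : c₀ * M ≤ M * (1 + c₀) ^ 2 := by
    nlinarith [mul_nonneg hM0 hc₀.le, mul_nonneg hM0 (sq_nonneg c₀)]
  have l1 : ∀ a b : ℝ, M * (|a| + c₀ * |b|) ≤ M * (1 + c₀) ^ 2 * (|a| + |b|) := fun a b => by
    rw [mul_assoc]
    refine mul_le_mul_of_nonneg_left ?_ hM0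
    have h1 : 0 ≤ c₀ * |a| := by positivity
    have h2 : 0 ≤ c₀ ^ 2 * |a| := by positivity
    have h3 : 0 ≤ c₀ ^ 2 * |b| := by positivity
    have h4 : 0 ≤ c₀ * |b| := by positivity
    linarith [abs_nonneg b]
  have l2 : ∀ a b : ℝ, c₀ * (M * (|a| + c₀ * |b|)) ≤ M * (1 + c₀) ^ 2 * (|a| + |b|) :=
    fun a b => by
      have : c₀ * (M * (|a| + c₀ * |b|)) = M * (c₀ * (|a| + c₀ * |b|)) := by ring
      rw [this, mul_assoc]
      refine mul_le_mul_of_nonneg_left ?_ hM0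
      have h1 : 0 ≤ c₀ * |a| := by positivity
      have h2 : 0 ≤ c₀ ^ 2 * |a| := by positivity
      have h4 : 0 ≤ c₀ * |b| := by positivity
      linarith [abs_nonneg b, abs_nonneg a]
  have hmul : ∀ a b : ℝ, |c₀ * a - c₀ * b| = c₀ * |a - b| := fun a b => by
    rw [← mul_sub, abs_mul, abs_of_pos hc₀]
  cases R with
  | slow =>
    refine ⟨by positivity, ?_, ?_, ?_, fun p => ?_, fun x y => (b _ _).trans k1, fun x y => ?_,
      fun x y => (bt _ _).trans k1, fun x y x' y' => ?_, fun x y x' y' => ?_⟩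
    · exact hm.continuous.comp (by fun_prop : Continuous fun p : ℝ × ℝ => (p.2, c₀ * p.1))
    · exact continuous_const.mul
        (hcz.comp (by fun_prop : Continuous fun p : ℝ × ℝ => (p.2, c₀ * p.1)))
    · exact hct.comp (by fun_prop : Continuous fun p : ℝ × ℝ => (p.2, c₀ * p.1))
    · have h1 : HasFDerivAt (fun p : ℝ × ℝ => (p.2, c₀ * p.1))
          ((ContinuousLinearMap.snd ℝ ℝ ℝ).prod (c₀ • ContinuousLinearMap.fst ℝ ℝ ℝ)) p :=
        hasFDerivAt_snd.prodMk (hasFDerivAt_fst.const_mul c₀)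
      have := (hfd (p.2, c₀ * p.1)).1.comp p h1
      refine this.congr_fderiv ?_
      ext <;> simp [Regime.unitFieldX, Regime.unitFieldY, mul_comm]
    · simp only [Regime.unitFieldX]
      rw [abs_mul, abs_of_pos hc₀]
      exact (mul_le_mul_of_nonneg_left (bz _ _) hc₀.le).trans k2
    · simp only [Regime.unitFieldX]
      rw [hmul]
      refine (mul_le_mul_of_nonneg_left (lz _ _ _ _) hc₀.le).trans ?_
      rw [hmul]
      have := l2 (y - y') (x - x')
      linarith
    · refine (lt _ _ _ _).trans ?_
      rw [hmul]
      have := l1 (y - y') (x - x')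
      linarith
  | rapid =>
    refine ⟨by positivity, ?_, ?_, ?_, fun p => ?_, fun x y => (b _ _).trans k1,
      fun x y => (bt _ _).trans k1, fun x y => ?_, fun x y x' y' => ?_, fun x y x' y' => ?_⟩
    · exact hm.continuous.comp (by fun_prop : Continuous fun p : ℝ × ℝ => (p.1, c₀ * p.2))
    · exact hct.comp (by fun_prop : Continuous fun p : ℝ × ℝ => (p.1, c₀ * p.2))
    · exact continuous_const.mul
        (hcz.comp (by fun_prop : Continuous fun p : ℝ × ℝ => (p.1, c₀ * p.2)))
    · have h1 : HasFDerivAt (fun p : ℝ × ℝ => (p.1, c₀ * p.2))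
          ((ContinuousLinearMap.fst ℝ ℝ ℝ).prod (c₀ • ContinuousLinearMap.snd ℝ ℝ ℝ)) p :=
        hasFDerivAt_fst.prodMk (hasFDerivAt_snd.const_mul c₀)
      have := (hfd (p.1, c₀ * p.2)).1.comp p h1
      refine this.congr_fderiv ?_
      ext <;> simp [Regime.unitFieldX, Regime.unitFieldY, mul_comm]
    · simp only [Regime.unitFieldY]
      rw [abs_mul, abs_of_pos hc₀]
      exact (mul_le_mul_of_nonneg_left (bz _ _) hc₀.le).trans k2
    · refine (lt _ _ _ _).trans ?_
      rw [hmul]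
      have := l1 (x - x') (y - y')
      linarith
    · simp only [Regime.unitFieldY]
      rw [hmul]
      refine (mul_le_mul_of_nonneg_left (lz _ _ _ _) hc₀.le).trans ?_
      rw [hmul]
      have := l2 (x - x') (y - y')
      linarith

/-! ### Correlations of the medium -/

section Correlations

variable {Ω : Type*} [m0 : MeasurableSpace Ω] {P : Measure Ω}

/-- Two-point correlations of a stationary field depend on the separation only. -/
theorem IsStationary.integral_mul {μ : ℝ → ℝ → Ω → ℝ} (hμ : ∀ t z, Measurable (μ t z))
    (h : IsStationary P μ) (t₁ z₁ t₂ z₂ : ℝ) :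
    ∫ ω, μ t₁ z₁ ω * μ t₂ z₂ ω ∂P = autocorr P μ (t₁ - t₂) (z₁ - z₂) := by
  have hF : Measurable fun w : ℝ × ℝ → ℝ => w (t₁ - t₂, z₁ - z₂) * w (0, 0) :=
    (measurable_pi_apply _).mul (measurable_pi_apply _)
  have h1 := integral_map (μ := P)
    (φ := fun ω (x : ℝ × ℝ) => μ (x.1 + t₂) (x.2 + z₂) ω)
    (measurable_pi_lambda _ fun x => hμ _ _).aemeasurable
    (f := fun w : ℝ × ℝ → ℝ => w (t₁ - t₂, z₁ - z₂) * w (0, 0)) hF.aestronglyMeasurable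
  have h2 := integral_map (μ := P)
    (φ := fun ω (x : ℝ × ℝ) => μ x.1 x.2 ω)
    (measurable_pi_lambda _ fun x => hμ _ _).aemeasurable
    (f := fun w : ℝ × ℝ → ℝ => w (t₁ - t₂, z₁ - z₂) * w (0, 0)) hF.aestronglyMeasurable
  rw [h t₂ z₂, h2] at h1
  simp only [sub_add_cancel, zero_add] at h1
  exact h1.symm

theorem integrable_of_abs_le [IsProbabilityMeasure P] {V : Ω → ℝ} (hV : Measurable V) {K : ℝ}
    (hK : ∀ ω, |V ω| ≤ K) :
    Integrable V P :=
  Integrable.of_bound hV.aestronglyMeasurable K (.of_forall hK)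

/-- The correlation function of the derivative of a stationary process is minus the second
derivative of the correlation function of the process. -/
theorem integral_deriv_mul_deriv [IsProbabilityMeasure P] {X X' : ℝ → Ω → ℝ} {M : ℝ} {κ : ℝ → ℝ}
    (hX : ∀ x, Measurable (X x)) (hX' : ∀ x, Measurable (X' x))
    (hM : ∀ x ω, |X x ω| ≤ M) (hM' : ∀ x ω, |X' x ω| ≤ M)
    (hd : ∀ x ω, HasDerivAt (fun x => X x ω) (X' x ω) x)
    (hκ : ∀ x₁ x₂, ∫ ω, X x₁ ω * X x₂ ω ∂P = κ (x₁ - x₂)) (x₁ x₂ : ℝ) :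
    ∫ ω, X' x₁ ω * X' x₂ ω ∂P = -iteratedDeriv 2 κ (x₁ - x₂) := by
  have hd1 : ∀ (Y : Ω → ℝ), Measurable Y → (∀ ω, |Y ω| ≤ M) → ∀ x,
      HasDerivAt (fun x => ∫ ω, Y ω * X x ω ∂P) (∫ ω, Y ω * X' x ω ∂P) x := by
    intro Y hY hYM x
    refine (hasDerivAt_integral_of_dominated_loc_of_deriv_le (F := fun x ω => Y ω * X x ω)
      (F' := fun x ω => Y ω * X' x ω) (bound := fun _ => M * M) (s := univ) univ_mem
      (.of_forall fun x => (hY.mul (hX x)).aestronglyMeasurable) ?_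
      (hY.mul (hX' x)).aestronglyMeasurable (.of_forall fun ω x _ => ?_)
      (integrable_const _) (.of_forall fun ω x _ => (hd x ω).const_mul (Y ω))).2
    · refine integrable_of_abs_le (hY.mul (hX x)) (K := M * M) fun ω => ?_
      rw [abs_mul]
      exact mul_le_mul (hYM ω) (hM x ω) (abs_nonneg _) ((abs_nonneg _).trans (hYM ω))
    · rw [Real.norm_eq_abs, abs_mul]
      exact mul_le_mul (hYM ω) (hM' x ω) (abs_nonneg _) ((abs_nonneg _).trans (hYM ω))
  have hρ : ∀ u x, deriv κ u = ∫ ω, X' x ω * X (x - u) ω ∂P := by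
    intro u x
    have h := hd1 (X (x - u)) (hX _) (hM _) x
    have : (fun y => ∫ ω, X (x - u) ω * X y ω ∂P) = fun y => κ (y - (x - u)) := by
      funext y
      rw [← hκ]
      simp_rw [mul_comm]
    rw [this] at h
    have h2 := HasDerivAt.comp_add_const (f := fun y => κ (y - (x - u))) u (x - u)
      (by simpa using h)
    simp only [add_sub_cancel_right] at h2
    rw [h2.deriv]
    simp_rw [mul_comm]
  have h2 : HasDerivAt (deriv κ) (-∫ ω, X' x₁ ω * X' x₂ ω ∂P) (x₁ - x₂) := by
    have h := hd1 (X' x₁) (hX' _) (hM' _) x₂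
    have e : deriv κ = fun u => ∫ ω, X' x₁ ω * X (x₁ - u) ω ∂P := funext fun u => hρ u x₁
    rw [e]
    exact HasDerivAt.comp_const_sub (f := fun x => ∫ ω, X' x₁ ω * X x ω ∂P) x₁ (x₁ - x₂)
      (by simpa using h)
  rw [iteratedDeriv_succ, iteratedDeriv_one, h2.deriv, neg_neg]

/-- A bounded function of the history is nearly uncorrelated with a variable of small conditional
mean. -/
theorem abs_integral_mul_le_of_condExp [IsProbabilityMeasure P] {m : MeasurableSpace Ω}
    (hm : m ≤ m0) {V Y : Ω → ℝ}
    {K c : ℝ} (hV : Measurable[m] V) (hK : ∀ ω, |V ω| ≤ K) (hY : Integrable Y P)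
    (hc : ∀ᵐ ω ∂P, |(P[Y | m]) ω| ≤ c) : |∫ ω, V ω * Y ω ∂P| ≤ K * c := by
  have hVY : Integrable (V * Y) P :=
    hY.bdd_mul (hV.mono hm le_rfl).aestronglyMeasurable (.of_forall hK)
  have h1 := condExp_mul_of_stronglyMeasurable_left hV.stronglyMeasurable hVY hY
  have h2 : ∫ ω, V ω * Y ω ∂P = ∫ ω, V ω * (P[Y | m]) ω ∂P := by
    exact (integral_condExp hm).symm.trans (integral_congr_ae h1)
  rw [h2]
  have := norm_integral_le_of_norm_le_const (μ := P) (f := fun ω => V ω * (P[Y | m]) ω)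
    (C := K * c) (by
      filter_upwards [hc] with ω hω
      rw [Real.norm_eq_abs, abs_mul]
      exact mul_le_mul (hK ω) hω (abs_nonneg _) ((abs_nonneg _).trans (hK ω)))
  simpa using this

/-- Mixing is preserved, with another constant, by scaling the decorrelating coordinate and the
values of the field, and by any reparametrization of the other coordinate. -/
theorem IsMixing.rescale {𝓗 : ℝ → MeasurableSpace Ω} {C d : ℝ} {X : ℝ → ℝ → Ω → ℝ}
    (h : IsMixing P 𝓗 C d X) {a : ℝ} (ha : 0 < a) (b : ℝ) (e : ℝ → ℝ) :
    ∃ C', IsMixing P (fun x => 𝓗 (a * x)) C' d fun x y ω => b * X (a * x) (e y) ω := by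
  have key : ∀ δ : ℝ, 0 < δ → C * (a * δ) ^ (-d) ≤ |C| * a ^ (-d) * δ ^ (-d) := fun δ hδ => by
    rw [Real.mul_rpow ha.le hδ.le, ← mul_assoc]
    have := le_abs_self C
    gcongr
  refine ⟨(|b| + |b * b|) * (|C| * a ^ (-d)), fun r q δ hδ => ?_,
    fun r δ r₁ r₂ q₁ q₂ hδ h₁ h₂ => ?_⟩
  · have h1 := condExp_smul (μ := P) b (X (a * (r + δ)) (e q)) (𝓗 (a * r))
    have h2 := h.first (a * r) (e q) (a * δ) (by positivity)
    rw [← mul_add] at h2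
    filter_upwards [h1, h2] with ω w1 w2
    have e1 : (P[fun ω => b * X (a * (r + δ)) (e q) ω | 𝓗 (a * r)]) ω
        = b * (P[X (a * (r + δ)) (e q) | 𝓗 (a * r)]) ω := w1
    rw [e1, abs_mul]
    have h3 := w2.trans (key δ hδ)
    have h4 : 0 ≤ |C| * a ^ (-d) * δ ^ (-d) := by positivity
    calc _ ≤ |b| * (|C| * a ^ (-d) * δ ^ (-d)) := by gcongr
      _ ≤ (|b| + |b * b|) * (|C| * a ^ (-d) * δ ^ (-d)) := by
        gcongr
        exact le_add_of_nonneg_right (abs_nonneg _)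
      _ = _ := by ring
  · have h1 := condExp_smul (μ := P) (b * b)
      (fun ω => X (a * r₁) (e q₁) ω * X (a * r₂) (e q₂) ω) (𝓗 (a * r))
    have h2 := h.second (a * r) (a * δ) (a * r₁) (a * r₂) (e q₁) (e q₂) (by positivity)
      (by rw [← mul_add]; gcongr) (by rw [← mul_add]; gcongr)
    have e0 : (fun ω => b * X (a * r₁) (e q₁) ω * (b * X (a * r₂) (e q₂) ω))
        = (b * b) • fun ω => X (a * r₁) (e q₁) ω * X (a * r₂) (e q₂) ω := by
      funext ω; simp only [Pi.smul_apply, smul_eq_mul]; ring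
    simp only [e0]
    filter_upwards [h1, h2] with ω w1 w2
    rw [w1]
    simp only [Pi.smul_apply, smul_eq_mul]
    have e2 : integral P ((b * b) • fun ω => X (a * r₁) (e q₁) ω * X (a * r₂) (e q₂) ω)
        = b * b * ∫ ω, X (a * r₁) (e q₁) ω * X (a * r₂) (e q₂) ω ∂P := integral_const_mul _ _
    rw [e2, ← mul_sub, abs_mul]
    have h3 := w2.trans (key δ hδ)
    have h4 : 0 ≤ |C| * a ^ (-d) * δ ^ (-d) := by positivity
    calc _ ≤ |b * b| * (|C| * a ^ (-d) * δ ^ (-d)) := by gcongr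
      _ ≤ (|b| + |b * b|) * (|C| * a ^ (-d) * δ ^ (-d)) := by
        gcongr
        exact le_add_of_nonneg_left (abs_nonneg _)
      _ = _ := by ring

/-- The derivative of a process is determined by the past of the process. -/
theorem measurable_of_hasDerivAt {Ω' : Type*} {m : MeasurableSpace Ω'} {X : ℝ → Ω' → ℝ}
    {X' : Ω' → ℝ} {x : ℝ}
    (hX : ∀ x' ≤ x, Measurable[m] (X x')) (hd : ∀ ω, HasDerivAt (fun x => X x ω) (X' ω) x) :
    Measurable[m] X' := by
  have hu : Tendsto (fun j : ℕ => -((j : ℝ) + 1)⁻¹) atTop (𝓝[≠] 0) := by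
    refine tendsto_nhdsWithin_iff.2 ⟨?_, .of_forall fun j => ?_⟩
    · simpa using (tendsto_one_div_add_atTop_nhds_zero_nat (𝕜 := ℝ)).neg
    · have : ((j : ℝ) + 1)⁻¹ ≠ 0 := by positivity
      simpa using this
  refine measurable_of_tendsto_metrizable (f := fun (j : ℕ) ω =>
    (-((j : ℝ) + 1)⁻¹)⁻¹ * (X (x + -((j : ℝ) + 1)⁻¹) ω - X x ω)) (fun j => ?_)
    (tendsto_pi_nhds.2 fun ω => (hasDerivAt_iff_tendsto_slope_zero.1 (hd ω)).comp hu)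
  have : (0 : ℝ) ≤ ((j : ℝ) + 1)⁻¹ := by positivity
  exact ((hX _ (by linarith)).sub (hX _ le_rfl)).const_mul _

/-- The medium in the coordinates of `Regime.unitField`: a random field `n` with derivatives `nx`
and `ny` that decorrelates along `x`, the correlation function of `nx` being
`E[nx(x,y) nx(x + σh,y)] = σ k(h)` with a sign `σ`. -/
structure IsMixingMedium (P : Measure Ω) (M d σ : ℝ) (k : ℝ → ℝ) (n nx ny : Ω → ℝ → ℝ → ℝ)
    (𝓖 : ℝ → MeasurableSpace Ω) : Prop where
  smooth : ∀ ω, IsSmoothField M (n ω) (nx ω) (ny ω)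
  history_le : ∀ x, 𝓖 x ≤ m0
  history_mono : Monotone 𝓖
  adapted : ∀ x y, Measurable[𝓖 x] fun ω => n ω x y
  adapted_x : ∀ x y, Measurable[𝓖 x] fun ω => nx ω x y
  adapted_y : ∀ x y, Measurable[𝓖 x] fun ω => ny ω x y
  decay_gt : 2 < d
  mixing : ∃ C, IsMixing P 𝓖 C d fun x y ω => n ω x y
  mixing_x : ∃ C, IsMixing P 𝓖 C d fun x y ω => nx ω x y
  mixing_y : ∃ C, IsMixing P 𝓖 C d fun x y ω => ny ω x y
  sign : σ = 1 ∨ σ = -1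
  correlation : ∀ x y h, ∫ ω, nx ω x y * nx ω (x + σ * h) y ∂P = σ * k h

/-- The σ-algebra of the medium up to the value `x` of the coordinate of decorrelation. -/
abbrev Regime.history (R : Regime) (c₀ : ℝ) (μ : ℝ → ℝ → Ω → ℝ) (x : ℝ) : MeasurableSpace Ω :=
  match R with
  | .slow => rangeHistory μ (c₀ * x)
  | .rapid => timeHistory μ x

/-- The sign in the relation between the two coupling coefficients of the right and left going
waves. -/
def Regime.sign (R : Regime) : ℝ :=
  match R with
  | .slow => 1
  | .rapid => -1

theorem isMixingMedium_unitField [IsProbabilityMeasure P] {R : Regime} {c₀ : ℝ}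
    (hc₀ : 0 < c₀) {μ : ℝ → ℝ → Ω → ℝ} (hμ : IsRandomMedium R P μ) :
    ∃ M d, IsMixingMedium P M d R.sign (fun h => c₀ ^ 2 * R.kernel c₀ (autocorr P μ) h)
      (fun ω => R.unitField c₀ fun t z => μ t z ω) (fun ω => R.unitFieldX c₀ fun t z => μ t z ω)
      (fun ω => R.unitFieldY c₀ fun t z => μ t z ω) (R.history c₀ μ) := by
  obtain ⟨M, hM⟩ := hμ.bounded
  obtain ⟨C, d, hd, h1, h2, h3⟩ := hμ.mixing
  have smooth : ∀ ω, IsSmoothField (M * (1 + c₀) ^ 2) (R.unitField c₀ fun t z => μ t z ω)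
      (R.unitFieldX c₀ fun t z => μ t z ω) (R.unitFieldY c₀ fun t z => μ t z ω) := fun ω =>
    isSmoothField_unitField R hc₀ (hμ.smooth ω) (hM ω)
  have history_le : ∀ x, R.history c₀ μ x ≤ m0 := fun x => by
    cases R <;>
      exact iSup_le fun _ => iSup_le fun _ => iSup_le fun _ => (hμ.measurable _ _).comap_le
  have history_mono : Monotone (R.history c₀ μ) := fun x x' hx => by
    cases R with
    | slow => exact biSup_mono fun z hz => hz.trans (by gcongr)
    | rapid => exact biSup_mono fun z hz => hz.trans (by gcongr)
  have adapted : ∀ x x' y, x' ≤ x → Measurable[R.history c₀ μ x]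
      fun ω => R.unitField c₀ (fun t z => μ t z ω) x' y := fun x x' y hx => by
    cases R with
    | slow =>
      exact (comap_measurable (μ y (c₀ * x'))).mono
        (le_iSup₂_of_le (c₀ * x') (by gcongr) (le_iSup_of_le y le_rfl)) le_rfl
    | rapid =>
      exact (comap_measurable (μ x' (c₀ * y))).mono
        (le_iSup₂_of_le x' (by simpa using hx) (le_iSup_of_le (c₀ * y) le_rfl)) le_rfl
  have adapted_x : ∀ x y, Measurable[R.history c₀ μ x]
      fun ω => R.unitFieldX c₀ (fun t z => μ t z ω) x y := fun x y =>
    measurable_of_hasDerivAt (fun x' hx' => adapted x x' y hx')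
      fun ω => (smooth ω).hasDerivAt_x x y
  have corr : ∀ x₁ x₂ y, ∫ ω, R.unitFieldX c₀ (fun t z => μ t z ω) x₁ y *
      R.unitFieldX c₀ (fun t z => μ t z ω) x₂ y ∂P = -iteratedDeriv 2 (fun x =>
        ∫ ω, R.unitField c₀ (fun t z => μ t z ω) x y *
          R.unitField c₀ (fun t z => μ t z ω) 0 y ∂P) (x₁ - x₂) := fun x₁ x₂ y =>
    integral_deriv_mul_deriv (M := M * (1 + c₀) ^ 2)
      (fun x => (adapted x x y le_rfl).mono (history_le x) le_rfl)
      (fun x => (adapted_x x y).mono (history_le x) le_rfl)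
      (fun x ω => (smooth ω).bound x y) (fun x ω => (smooth ω).bound_x x y)
      (fun x ω => (smooth ω).hasDerivAt_x x y) (fun x₁ x₂ => by
        cases R with
        | slow =>
          simp only [Regime.unitField, hμ.stationary.integral_mul hμ.measurable]
          congr 1; ring
        | rapid =>
          simp only [Regime.unitField, hμ.stationary.integral_mul hμ.measurable]
          congr 1; ring) x₁ x₂
  refine ⟨M * (1 + c₀) ^ 2, d, smooth, history_le, history_mono,
    fun x y => adapted x x y le_rfl, adapted_x, fun x y => ?_, hd, ?_, ?_, ?_, ?_, ?_⟩
  · exact measurable_of_hasDerivAt (x := y) (X := fun y ω => R.unitField c₀ _ x y)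
      (fun y' _ => adapted x x y' le_rfl) fun ω => (smooth ω).hasDerivAt_y x y
  · cases R with
    | slow =>
      obtain ⟨C', h⟩ := IsMixing.rescale h1 hc₀ 1 id
      exact ⟨C', by simp only [one_mul] at h; exact h⟩
    | rapid =>
      obtain ⟨C', h⟩ := IsMixing.rescale h1 one_pos 1 fun y => c₀ * y
      exact ⟨C', by simp only [one_mul] at h; exact h⟩
  · cases R with
    | slow => exact IsMixing.rescale h3 hc₀ c₀ id
    | rapid =>
      obtain ⟨C', h⟩ := IsMixing.rescale h2 one_pos 1 fun y => c₀ * y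
      exact ⟨C', by simp only [one_mul] at h; exact h⟩
  · cases R with
    | slow =>
      obtain ⟨C', h⟩ := IsMixing.rescale h2 hc₀ 1 id
      exact ⟨C', by simp only [one_mul] at h; exact h⟩
    | rapid =>
      obtain ⟨C', h⟩ := IsMixing.rescale h3 one_pos c₀ fun y => c₀ * y
      exact ⟨C', by simp only [one_mul] at h; exact h⟩
  · cases R
    · exact Or.inl rfl
    · exact Or.inr rfl
  · intro x y h
    cases R with
    | slow =>
      simp_rw [mul_comm (Regime.unitFieldX .slow c₀ _ x y)]
      rw [corr]
      simp only [Regime.unitField, hμ.stationary.integral_mul hμ.measurable, Regime.sign,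
        Regime.kernel, one_mul, sub_self, mul_zero, sub_zero, add_sub_cancel_left]
      have e : ∀ g : ℝ → ℝ, deriv (fun x => g (c₀ * x)) = fun x => c₀ * deriv g (c₀ * x) :=
        fun g => funext fun x => by simpa using deriv_comp_mul_left c₀ g x
      rw [iteratedDeriv_succ, iteratedDeriv_one, iteratedDeriv_succ, iteratedDeriv_one, e,
        deriv_const_mul_field, e]
      ring
    | rapid =>
      rw [corr]
      simp only [Regime.unitField, hμ.stationary.integral_mul hμ.measurable, Regime.sign,
        Regime.kernel, sub_self, sub_zero]
      have : x - (x + -1 * h) = h := by ring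
      rw [this]
      field_simp

namespace IsMixingMedium

variable {M d σ : ℝ} {k : ℝ → ℝ} {n nx ny : Ω → ℝ → ℝ → ℝ} {𝓖 : ℝ → MeasurableSpace Ω}

theorem abs_correlation_le [IsProbabilityMeasure P] (H : IsMixingMedium P M d σ k n nx ny 𝓖) :
    ∃ C, ∀ h, 0 < h → |k h| ≤ C * h ^ (-d) := by
  obtain ⟨C, hC⟩ := H.mixing_x
  have key : ∀ h, 0 < h → |∫ ω, nx ω 0 0 * nx ω h 0 ∂P| ≤ M * (C * h ^ (-d)) := fun h hh => by
    refine abs_integral_mul_le_of_condExp (H.history_le 0) (H.adapted_x 0 0)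
      (fun ω => (H.smooth ω).bound_x 0 0)
      (integrable_of_abs_le ((H.adapted_x h 0).mono (H.history_le h) le_rfl)
        fun ω => (H.smooth ω).bound_x h 0) ?_
    have := hC.first 0 0 h hh
    rwa [zero_add] at this
  refine ⟨M * C, fun h hh => ?_⟩
  rw [mul_assoc]
  rcases H.sign with rfl | rfl
  · have := H.correlation 0 0 h
    rw [one_mul, one_mul, zero_add] at this
    rw [← this]
    exact key h hh
  · have := H.correlation h 0 h
    rw [neg_one_mul, neg_one_mul, add_neg_cancel] at this
    rw [← abs_neg, ← this]
    simp_rw [mul_comm (nx _ h 0)]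
    exact key h hh

theorem measurable_x (H : IsMixingMedium P M d σ k n nx ny 𝓖) (x y : ℝ) :
    Measurable fun ω => nx ω x y := (H.adapted_x x y).mono (H.history_le x) le_rfl

theorem continuous_correlation [IsProbabilityMeasure P] (H : IsMixingMedium P M d σ k n nx ny 𝓖) :
    Continuous k := by
  have hσ : σ * σ = 1 := by rcases H.sign with rfl | rfl <;> norm_num
  have : k = fun h => σ * ∫ ω, nx ω 0 0 * nx ω (0 + σ * h) 0 ∂P := by
    funext h
    rw [H.correlation, ← mul_assoc, hσ, one_mul]
  rw [this]
  refine continuous_const.mul (continuous_of_dominated (bound := fun _ => M * M)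
    (fun h => ((H.measurable_x _ _).mul (H.measurable_x _ _)).aestronglyMeasurable)
    (fun h => .of_forall fun ω => ?_) (integrable_const _) (.of_forall fun ω => ?_))
  · rw [Real.norm_eq_abs, abs_mul]
    exact mul_le_mul ((H.smooth ω).bound_x _ _) ((H.smooth ω).bound_x _ _) (abs_nonneg _)
      (H.smooth ω).nonneg
  · exact continuous_const.mul ((H.smooth ω).continuous_x.comp
      (by fun_prop : Continuous fun h : ℝ => (0 + σ * h, (0 : ℝ))))

theorem integrableOn_correlation [IsProbabilityMeasure P] (H : IsMixingMedium P M d σ k n nx ny 𝓖) :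
    IntegrableOn k (Ioi 0) := by
  obtain ⟨C, hC⟩ := H.abs_correlation_le
  rw [← Ioc_union_Ioi_eq_Ioi zero_le_one]
  refine (H.continuous_correlation.integrableOn_Ioc).union ?_
  refine Integrable.mono' ((integrableOn_Ioi_rpow_of_lt (a := -d) (by linarith [H.decay_gt])
    one_pos).const_mul C) H.continuous_correlation.aestronglyMeasurable ?_
  filter_upwards [ae_restrict_mem measurableSet_Ioi] with h hh
  exact hC h (one_pos.trans hh)

end IsMixingMedium

end Correlations

/-! ### Averaging over the medium -/

section Averaging

variable {Ω : Type*} [m0 : MeasurableSpace Ω] {P : Measure Ω}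

/-- Weak law of large numbers: integrals over a finite measure of fields that decorrelate in the
limit tend to zero in probability. The decorrelation is only required between points with
different values of a coordinate `ρ` whose fibres are null sets. -/
theorem tendsto_measure_integral_of_decorrelated [IsProbabilityMeasure P]
    {𝒟 : Type*} [MeasurableSpace 𝒟] {ν : Measure 𝒟}
    [IsFiniteMeasure ν] {ρ : 𝒟 → ℝ} (hρ : Measurable ρ) (hν : ∀ x, ν (ρ ⁻¹' {x}) = 0)
    {y : ℝ → 𝒟 → Ω → ℝ} {K : ℝ} (hy : ∀ ε, Measurable fun q : 𝒟 × Ω => y ε q.1 q.2)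
    (hK : ∀ ε p ω, |y ε p ω| ≤ K)
    (hcorr : ∀ p q, ρ p < ρ q →
      Tendsto (fun ε => ∫ ω, y ε p ω * y ε q ω ∂P) (𝓝[>] 0) (𝓝 0)) {η : ℝ} (hη : 0 < η) :
    Tendsto (fun ε => P {ω | η ≤ |∫ p, y ε p ω ∂ν|}) (𝓝[>] 0) (𝓝 0) := by
  have hyy : ∀ ε, Measurable fun x : (𝒟 × 𝒟) × Ω => y ε x.1.1 x.2 * y ε x.1.2 x.2 := fun ε =>
    ((hy ε).comp (by fun_prop : Measurable fun x : (𝒟 × 𝒟) × Ω => (x.1.1, x.2))).mul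
      ((hy ε).comp (by fun_prop : Measurable fun x : (𝒟 × 𝒟) × Ω => (x.1.2, x.2)))
  have hKK : ∀ ε p q ω, |y ε p ω * y ε q ω| ≤ K * K := fun ε p q ω => by
    rw [abs_mul]
    exact mul_le_mul (hK ε p ω) (hK ε q ω) (abs_nonneg _) ((abs_nonneg _).trans (hK ε p ω))
  have hne : ∀ᵐ x ∂(ν.prod ν), ρ x.1 ≠ ρ x.2 := by
    have hm : MeasurableSet {x : 𝒟 × 𝒟 | ρ x.1 = ρ x.2} :=
      measurableSet_eq_fun (hρ.comp measurable_fst) (hρ.comp measurable_snd)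
    rw [ae_iff]
    simp only [ne_eq, not_not]
    rw [Measure.measure_prod_null hm]
    refine .of_forall fun p => ?_
    have : Prod.mk p ⁻¹' {x : 𝒟 × 𝒟 | ρ x.1 = ρ x.2} = ρ ⁻¹' {ρ p} := by
      ext q
      simp [eq_comm]
    exact (congrArg ν this).trans (hν _)
  have hlim : Tendsto (fun ε => ∫ x, (∫ ω, y ε x.1 ω * y ε x.2 ω ∂P) ∂(ν.prod ν))
      (𝓝[>] 0) (𝓝 (∫ _, (0 : ℝ) ∂(ν.prod ν))) := by
    refine tendsto_integral_filter_of_dominated_convergence (fun _ => K * K)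
      (.of_forall fun ε => ((hyy ε).stronglyMeasurable.integral_prod_right).aestronglyMeasurable)
      (.of_forall fun ε => .of_forall fun x => ?_) (integrable_const _) ?_
    · simpa using norm_integral_le_of_norm_le_const (μ := P)
        (f := fun ω => y ε x.1 ω * y ε x.2 ω) (.of_forall fun ω => hKK ε x.1 x.2 ω)
    · filter_upwards [hne] with x hx
      rcases lt_or_gt_of_ne hx with h | h
      · exact hcorr _ _ h
      · simpa only [mul_comm] using hcorr _ _ h
  rw [integral_zero] at hlim
  have hsq : ∀ ε, ∫ x, (∫ ω, y ε x.1 ω * y ε x.2 ω ∂P) ∂(ν.prod ν)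
      = ∫ ω, (∫ p, y ε p ω ∂ν) ^ 2 ∂P := fun ε => by
    rw [integral_integral_swap (f := fun (x : 𝒟 × 𝒟) ω => y ε x.1 ω * y ε x.2 ω)]
    · refine integral_congr_ae (.of_forall fun ω => ?_)
      simp only
      rw [integral_prod_mul (μ := ν) (ν := ν) (fun p => y ε p ω) (fun p => y ε p ω), sq]
    · exact Integrable.of_bound (hyy ε).aestronglyMeasurable (K * K)
        (.of_forall fun x => hKK ε _ _ _)
  have hint : ∀ ε, Integrable (fun ω => (∫ p, y ε p ω ∂ν) ^ 2) P := fun ε => by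
    have hm : StronglyMeasurable fun ω => ∫ p, y ε p ω ∂ν :=
      StronglyMeasurable.integral_prod_left (f := fun p ω => y ε p ω) (hy ε).stronglyMeasurable
    refine Integrable.of_bound (hm.pow 2).aestronglyMeasurable ((K * ν.real univ) ^ 2)
      (.of_forall fun ω => ?_)
    rw [norm_pow]
    gcongr
    exact norm_integral_le_of_norm_le_const (.of_forall fun p => hK ε p ω)
  have hreal : Tendsto (fun ε => P.real {ω | η ≤ |∫ p, y ε p ω ∂ν|}) (𝓝[>] 0) (𝓝 0) := by
    refine squeeze_zero (fun ε => measureReal_nonneg) (fun ε => ?_)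
      (by simpa using hlim.const_mul (η ^ 2)⁻¹)
    have h := mul_meas_ge_le_integral_of_nonneg (.of_forall fun ω => sq_nonneg _) (hint ε) (η ^ 2)
    rw [hsq, le_inv_mul_iff₀ (by positivity)]
    refine le_trans (le_of_eq ?_) h
    congr 2
    ext ω
    simp only [mem_ofPred_eq]
    rw [← sq_abs (∫ p, y ε p ω ∂ν)]
    exact (pow_le_pow_iff_left₀ hη.le (abs_nonneg _) (by norm_num)).symm
  have := ENNReal.tendsto_ofReal hreal
  simpa [ofReal_measureReal] using this

/-- Pointwise convergence in probability is uniform on compact sets for equicontinuous fields. -/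
theorem tendsto_measure_exists_of_equicontinuous {X : Type*} [PseudoMetricSpace X] {K : Set X}
    (hK : IsCompact K) {Z : ℝ → X → Ω → ℝ}
    (hequi : ∀ η > 0, ∃ δ > 0, ∀ ε ω, ∀ p ∈ K, ∀ q ∈ K, dist p q < δ →
      |Z ε p ω - Z ε q ω| ≤ η)
    (hZ : ∀ p ∈ K, ∀ η > 0, Tendsto (fun ε => P {ω | η ≤ |Z ε p ω|}) (𝓝[>] 0) (𝓝 0)) {η : ℝ}
    (hη : 0 < η) :
    Tendsto (fun ε => P {ω | ∃ p ∈ K, η ≤ |Z ε p ω|}) (𝓝[>] 0) (𝓝 0) := by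
  obtain ⟨δ, hδ, hδZ⟩ := hequi (η / 2) (by positivity)
  obtain ⟨t, htK, ht, hcover⟩ := hK.finite_cover_balls hδ
  have hsum : Tendsto (fun ε => ∑ q ∈ ht.toFinset, P {ω | η / 2 ≤ |Z ε q ω|}) (𝓝[>] 0) (𝓝 0) := by
    have := tendsto_finsetSum (f := fun q ε => P {ω | η / 2 ≤ |Z ε q ω|}) ht.toFinset
      (a := fun _ => 0) (x := 𝓝[>] (0 : ℝ))
      fun q hq => hZ q (htK (ht.mem_toFinset.1 hq)) (η / 2) (by positivity)
    simpa using this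
  refine tendsto_of_tendsto_of_tendsto_of_le_of_le tendsto_const_nhds hsum (fun _ => zero_le)
    fun ε => (measure_mono ?_).trans (measure_biUnion_finset_le ht.toFinset _)
  rintro ω ⟨p, hp, hpη⟩
  obtain ⟨q, hq, hpq⟩ := mem_iUnion₂.1 (hcover hp)
  refine mem_iUnion₂.2 ⟨q, ht.mem_toFinset.2 hq, ?_⟩
  have h1 := hδZ ε ω p hp q (htK hq) hpq
  have h2 := abs_sub_abs_le_abs_sub (Z ε p ω) (Z ε q ω)
  change η / 2 ≤ |Z ε q ω|
  linarith

theorem tendsto_decay {a b d : ℝ} (ha : 0 < a) (hd : 0 < d) :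
    Tendsto (fun ε : ℝ => a / ε ^ 2 - b) (𝓝[>] 0) atTop ∧
      Tendsto (fun ε : ℝ => (a / ε ^ 2 - b) ^ (-d)) (𝓝[>] 0) (𝓝 0) := by
  have h : Tendsto (fun ε : ℝ => a / ε ^ 2 - b) (𝓝[>] 0) atTop := by
    have h1 : Tendsto (fun ε : ℝ => ε ^ 2) (𝓝[>] 0) (𝓝[>] 0) := by
      refine tendsto_nhdsWithin_iff.2 ⟨?_, ?_⟩
      · have : Tendsto (fun ε : ℝ => ε ^ 2) (𝓝 0) (𝓝 (0 ^ 2)) := (continuous_pow 2).tendsto 0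
        simpa using this.mono_left nhdsWithin_le_nhds
      · filter_upwards [self_mem_nhdsWithin] with ε hε
        exact pow_pos (mem_Ioi.1 hε) 2
    have h2 := (tendsto_inv_nhdsGT_zero.comp h1).const_mul_atTop ha
    exact tendsto_atTop_add_const_right _ (-b) h2
  exact ⟨h, (tendsto_rpow_neg_atTop hd).comp h⟩

theorem abs_iterated_integral_sub_le {G b : ℝ → ℝ → ℝ} {K B e R H r r₁ s s₁ : ℝ}
    (hG : Continuous fun p : ℝ × ℝ => G p.1 p.2) (hb : Continuous fun p : ℝ × ℝ => b p.1 p.2)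
    (hK : ∀ x h, |G x h| ≤ K) (hr : r ∈ Icc 0 R) (hr₁ : r₁ ∈ Icc 0 R) (hH : 0 ≤ H)
    (hB : ∀ x ∈ Icc 0 R, ∀ h ∈ Icc 0 H, |b x (s - 2 * h)| ≤ B)
    (he : ∀ x ∈ Icc 0 R, ∀ h ∈ Icc 0 H, |b x (s - 2 * h) - b x (s₁ - 2 * h)| ≤ e) :
    |(∫ x in (0 : ℝ)..r, ∫ h in (0 : ℝ)..H, G x h * b x (s - 2 * h)) -
      ∫ x in (0 : ℝ)..r₁, ∫ h in (0 : ℝ)..H, G x h * b x (s₁ - 2 * h)| ≤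
      K * B * H * |r - r₁| + K * e * H * R := by
  have hc : ∀ s, Continuous fun p : ℝ × ℝ => G p.1 p.2 * b p.1 (s - 2 * p.2) := fun s =>
    hG.mul (hb.comp (by fun_prop : Continuous fun p : ℝ × ℝ => (p.1, s - 2 * p.2)))
  have hci : ∀ s, Continuous fun x => ∫ h in (0 : ℝ)..H, G x h * b x (s - 2 * h) := fun s =>
    intervalIntegral.continuous_parametric_intervalIntegral_of_continuous' (hc s) 0 H
  have hch : ∀ s x a c, IntervalIntegrable (fun h => G x h * b x (s - 2 * h)) volume a c :=
    fun s x a c => ((hc s).comp (by fun_prop : Continuous fun h : ℝ => (x, h))).intervalIntegrable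
      a c
  have hK0 : 0 ≤ K := (abs_nonneg _).trans (hK 0 0)
  have h1 : |∫ x in r₁..r, ∫ h in (0 : ℝ)..H, G x h * b x (s - 2 * h)| ≤
      K * B * H * |r - r₁| := by
    refine intervalIntegral.norm_integral_le_of_norm_le_const (E := ℝ) fun x hx => ?_
    have hx' : x ∈ Icc 0 R := (uIoc_subset_uIcc.trans (uIcc_subset_Icc hr₁ hr)) hx
    refine (intervalIntegral.norm_integral_le_of_norm_le_const (E := ℝ) (C := K * B)
      fun h hh => ?_).trans_eq (by rw [sub_zero, abs_of_nonneg hH])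
    rw [uIoc_of_le hH] at hh
    rw [Real.norm_eq_abs, abs_mul]
    exact mul_le_mul (hK _ _) (hB x hx' h (Ioc_subset_Icc_self hh)) (abs_nonneg _) hK0
  have h2 : |∫ x in (0 : ℝ)..r₁, ((∫ h in (0 : ℝ)..H, G x h * b x (s - 2 * h)) -
      ∫ h in (0 : ℝ)..H, G x h * b x (s₁ - 2 * h))| ≤ K * e * H * |r₁ - 0| := by
    refine intervalIntegral.norm_integral_le_of_norm_le_const (E := ℝ) fun x hx => ?_
    rw [uIoc_of_le hr₁.1] at hx
    have hx' : x ∈ Icc 0 R := ⟨hx.1.le, hx.2.trans hr₁.2⟩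
    rw [← intervalIntegral.integral_sub (hch _ _ _ _) (hch _ _ _ _)]
    refine (intervalIntegral.norm_integral_le_of_norm_le_const (E := ℝ) (C := K * e)
      fun h hh => ?_).trans_eq (by rw [sub_zero, abs_of_nonneg hH])
    rw [uIoc_of_le hH] at hh
    rw [Real.norm_eq_abs, ← mul_sub, abs_mul]
    exact mul_le_mul (hK _ _) (he x hx' h (Ioc_subset_Icc_self hh)) (abs_nonneg _) hK0
  have he0 : 0 ≤ e := (abs_nonneg _).trans (he r hr 0 ⟨le_rfl, hH⟩)
  have h3 : K * e * H * |r₁ - 0| ≤ K * e * H * R := by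
    rw [sub_zero, abs_of_nonneg hr₁.1]
    exact mul_le_mul_of_nonneg_left hr₁.2 (by positivity)
  rw [intervalIntegral.integral_sub ((hci _).intervalIntegrable _ _)
    ((hci _).intervalIntegrable _ _)] at h2
  have h4 := intervalIntegral.integral_add_adjacent_intervals (μ := volume)
    ((hci s).intervalIntegrable 0 r₁) ((hci s).intervalIntegrable r₁ r)
  rw [← h4]
  calc _ = |(∫ x in r₁..r, ∫ h in (0 : ℝ)..H, G x h * b x (s - 2 * h)) +
        ((∫ x in (0 : ℝ)..r₁, ∫ h in (0 : ℝ)..H, G x h * b x (s - 2 * h)) -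
        ∫ x in (0 : ℝ)..r₁, ∫ h in (0 : ℝ)..H, G x h * b x (s₁ - 2 * h))| := by
        congr 1; ring
    _ ≤ _ := (abs_add_le _ _).trans (add_le_add h1 (h2.trans h3))

/-- Averages of a mixing field along a line vanish, uniformly over segments of bounded length. -/
theorem tendsto_measure_average [IsProbabilityMeasure P]
    {Y : Ω → ℝ → ℝ → ℝ} {𝓖 : ℝ → MeasurableSpace Ω} {M C d : ℝ}
    (hc : ∀ ω, Continuous fun p : ℝ × ℝ => Y ω p.1 p.2) (hM : ∀ ω x y, |Y ω x y| ≤ M)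
    (hle : ∀ x, 𝓖 x ≤ m0) (hY : ∀ x y, Measurable[𝓖 x] fun ω => Y ω x y)
    (hd : 0 < d) (hmix : IsMixing P 𝓖 C d fun x y ω => Y ω x y) (κ : ℝ → ℝ) (R : ℝ) {η : ℝ}
    (hη : 0 < η) :
    Tendsto (fun ε : ℝ => P {ω | ∃ r ∈ Icc 0 R,
      η ≤ |∫ x in (0 : ℝ)..r, Y ω (x / ε ^ 2) (x / κ ε)|}) (𝓝[>] 0) (𝓝 0) := by
  have hmeas : Measurable fun q : (ℝ × ℝ) × Ω => Y q.2 q.1.1 q.1.2 :=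
    measurable_uncurry_of_continuous_of_measurable (u := fun (p : ℝ × ℝ) ω => Y ω p.1 p.2)
      hc fun p => (hY _ _).mono (hle _) le_rfl
  have hcx : ∀ ε ω, Continuous fun x : ℝ => Y ω (x / ε ^ 2) (x / κ ε) := fun ε ω =>
    (hc ω).comp (by fun_prop : Continuous fun x : ℝ => (x / ε ^ 2, x / κ ε))
  rcases isEmpty_or_nonempty Ω with hΩ | ⟨⟨ω₀⟩⟩
  · simp [Measure.eq_zero_of_isEmpty P]
  have hM0 : 0 ≤ M := (abs_nonneg _).trans (hM ω₀ 0 0)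
  refine tendsto_measure_exists_of_equicontinuous (isCompact_Icc (a := (0 : ℝ)) (b := R))
    (Z := fun ε r ω => ∫ x in (0 : ℝ)..r, Y ω (x / ε ^ 2) (x / κ ε)) (fun η hη => ?_)
    (fun r hr η hη => ?_) hη
  · refine ⟨η / (M + 1), by positivity, fun ε ω p _ q _ hpq => ?_⟩
    rw [intervalIntegral.integral_interval_sub_left ((hcx ε ω).intervalIntegrable _ _)
      ((hcx ε ω).intervalIntegrable _ _)]
    refine (intervalIntegral.norm_integral_le_of_norm_le_const (E := ℝ) (C := M) fun x _ =>
      hM ω (x / ε ^ 2) (x / κ ε)).trans ?_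
    rw [Real.dist_eq, lt_div_iff₀ (by positivity)] at hpq
    nlinarith [abs_nonneg (p - q)]
  · simp only [intervalIntegral.integral_of_le hr.1]
    refine tendsto_measure_integral_of_decorrelated (ρ := id) (K := M) measurable_id
      (fun x => ?_) (fun ε => ?_) (fun ε p ω => hM _ _ _) (fun p q hpq => ?_) hη
    · rw [preimage_id]
      exact measure_singleton x
    · exact hmeas.comp (by fun_prop : Measurable fun q : ℝ × Ω => ((q.1 / ε ^ 2, q.1 / κ ε), q.2))
    · have hpq' : 0 < q - p := sub_pos.2 hpq
      have hlim := ((tendsto_decay (b := 0) hpq' hd).2.const_mul C).const_mul M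
      rw [mul_zero, mul_zero] at hlim
      refine squeeze_zero_norm' ?_ hlim
      filter_upwards [self_mem_nhdsWithin] with ε hε
      have hε' : (0 : ℝ) < ε := hε
      refine abs_integral_mul_le_of_condExp (hle (p / ε ^ 2)) (hY _ _) (fun ω => hM _ _ _)
        (integrable_of_abs_le ((hY _ _).mono (hle _) le_rfl) fun ω => hM _ _ _) ?_
      have := hmix.first (p / ε ^ 2) (q / κ ε) ((q - p) / ε ^ 2) (by positivity)
      rw [← add_div, add_sub_cancel] at this
      simpa using this

theorem IsMixingMedium.abs_correlation_le_sq [IsProbabilityMeasure P] {M d σ : ℝ} {k : ℝ → ℝ}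
    {n nx ny : Ω → ℝ → ℝ → ℝ} {𝓖 : ℝ → MeasurableSpace Ω}
    (H : IsMixingMedium P M d σ k n nx ny 𝓖) (h : ℝ) : |k h| ≤ M * M := by
  have h1 : |k h| = |σ * k h| := by rcases H.sign with rfl | rfl <;> simp
  rw [h1, ← H.correlation 0 0 h]
  have := norm_integral_le_of_norm_le_const (μ := P)
    (f := fun ω => nx ω 0 0 * nx ω (0 + σ * h) 0) (C := M * M) (.of_forall fun ω => by
      rw [norm_mul]
      exact mul_le_mul ((H.smooth ω).bound_x _ _) ((H.smooth ω).bound_x _ _) (abs_nonneg _)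
        (H.smooth ω).nonneg)
  simpa using this

/-- The fluctuations of the product `nx(x,y) nx(x + σh,y)` about its mean, averaged along a line
against a continuous weight, vanish uniformly. -/
theorem IsMixingMedium.tendsto_measure_average_mul [IsProbabilityMeasure P] {M d σ : ℝ}
    {k : ℝ → ℝ} {n nx ny : Ω → ℝ → ℝ → ℝ} {𝓖 : ℝ → MeasurableSpace Ω}
    (H : IsMixingMedium P M d σ k n nx ny 𝓖) (κ : ℝ → ℝ) {b : ℝ → ℝ → ℝ}
    (hb : Continuous fun p : ℝ × ℝ => b p.1 p.2) (R S : ℝ) {h₀ : ℝ} (hh₀ : 0 ≤ h₀) {η : ℝ}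
    (hη : 0 < η) :
    Tendsto (fun ε : ℝ => P {ω | ∃ p ∈ Icc 0 R ×ˢ Icc 0 S,
      η ≤ |∫ x in (0 : ℝ)..p.1, ∫ h in (0 : ℝ)..h₀,
        (σ * (nx ω (x / ε ^ 2) (x / κ ε) * nx ω (x / ε ^ 2 + σ * h) (x / κ ε)) - k h) *
          b x (p.2 - 2 * h)|}) (𝓝[>] 0) (𝓝 0) := by
  rcases isEmpty_or_nonempty Ω with hΩ | ⟨⟨ω₀⟩⟩
  · simp [Measure.eq_zero_of_isEmpty P]
  have hM0 : 0 ≤ M := (H.smooth ω₀).nonneg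
  have hσ : |σ| = 1 := by rcases H.sign with rfl | rfl <;> simp
  obtain ⟨C, hC⟩ := H.mixing_x
  have hd : 0 < d := by linarith [H.decay_gt]
  have hk := H.continuous_correlation
  set G : ℝ → Ω → ℝ → ℝ → ℝ := fun ε ω x h =>
    σ * (nx ω (x / ε ^ 2) (x / κ ε) * nx ω (x / ε ^ 2 + σ * h) (x / κ ε)) - k h with hG
  have hGc : ∀ ε ω, Continuous fun p : ℝ × ℝ => G ε ω p.1 p.2 := fun ε ω => by
    refine (continuous_const.mul (((H.smooth ω).continuous_x.comp
      (by fun_prop : Continuous fun p : ℝ × ℝ => (p.1 / ε ^ 2, p.1 / κ ε))).mul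
      ((H.smooth ω).continuous_x.comp (by fun_prop : Continuous fun p : ℝ × ℝ =>
        (p.1 / ε ^ 2 + σ * p.2, p.1 / κ ε))))).sub (hk.comp continuous_snd)
  have hprod : ∀ ω x y x' y', |nx ω x y * nx ω x' y'| ≤ M * M := fun ω x y x' y' => by
    rw [abs_mul]
    exact mul_le_mul ((H.smooth ω).bound_x _ _) ((H.smooth ω).bound_x _ _) (abs_nonneg _) hM0
  have hGM : ∀ ε ω x h, |G ε ω x h| ≤ 2 * (M * M) := fun ε ω x h => by
    have h1 : |σ * (nx ω (x / ε ^ 2) (x / κ ε) * nx ω (x / ε ^ 2 + σ * h) (x / κ ε))| ≤ M * M := by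
      rw [abs_mul, hσ, one_mul]
      exact hprod _ _ _ _ _
    have := abs_sub _ _ |>.trans (add_le_add h1 (H.abs_correlation_le_sq h))
    simpa [hG, two_mul] using this
  obtain ⟨B, hB⟩ : ∃ B, ∀ p ∈ Icc 0 R ×ˢ Icc (0 - 2 * h₀) S, |b p.1 p.2| ≤ B :=
    (isCompact_Icc.prod isCompact_Icc).exists_bound_of_continuousOn hb.continuousOn
  refine tendsto_measure_exists_of_equicontinuous
    ((isCompact_Icc (a := (0 : ℝ)) (b := R)).prod (isCompact_Icc (a := (0 : ℝ)) (b := S)))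
    (Z := fun ε p ω => ∫ x in (0 : ℝ)..p.1, ∫ h in (0 : ℝ)..h₀, G ε ω x h * b x (p.2 - 2 * h))
    (fun η hη => ?_) (fun p hp η hη => ?_) hη
  · by_cases hR : 0 ≤ R
    swap
    · refine ⟨1, one_pos, fun ε ω p hp => ?_⟩
      exact absurd (hp.1.1.trans hp.1.2) hR
    by_cases hS : 0 ≤ S
    swap
    · refine ⟨1, one_pos, fun ε ω p hp => ?_⟩
      exact absurd (hp.2.1.trans hp.2.2) hS
    have hB0 : 0 ≤ B := (abs_nonneg _).trans (hB (0, 0) ⟨⟨le_rfl, hR⟩, by simp [hh₀, hS]⟩)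
    set e := η / 2 / (2 * (M * M) * h₀ * R + 1) with he
    have he0 : 0 < e := by positivity
    obtain ⟨δ, hδ, hbδ⟩ := Metric.uniformContinuousOn_iff.1
      ((isCompact_Icc.prod isCompact_Icc).uniformContinuousOn_of_continuous
        (hb.continuousOn (s := Icc 0 R ×ˢ Icc (0 - 2 * h₀) S))) e he0
    refine ⟨min δ (η / 2 / (2 * (M * M) * B * h₀ + 1)), by positivity, fun ε ω p hp q hq hpq => ?_⟩
    obtain ⟨r, s⟩ := p
    obtain ⟨r₁, s₁⟩ := q
    have hd1 : |r - r₁| < η / 2 / (2 * (M * M) * B * h₀ + 1) :=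
      (le_max_left _ _).trans_lt (hpq.trans_le (min_le_right _ _))
    have hd2 : |s - s₁| < δ :=
      (le_max_right _ _).trans_lt (hpq.trans_le (min_le_left _ _))
    refine (abs_iterated_integral_sub_le (hGc ε ω) hb (hGM ε ω) hp.1 hq.1 hh₀ (B := B) (e := e)
      (fun x hx h hh => hB (x, s - 2 * h) ⟨hx, by linarith [hp.2.1, hh.2], by
        linarith [hp.2.2, hh.1]⟩) (fun x hx h hh => ?_)).trans ?_
    · refine (hbδ (x, s - 2 * h) ⟨hx, by linarith [hp.2.1, hh.2], by linarith [hp.2.2, hh.1]⟩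
        (x, s₁ - 2 * h) ⟨hx, by linarith [hq.2.1, hh.2], by linarith [hq.2.2, hh.1]⟩ ?_).le
      rw [Prod.dist_eq, dist_self, Real.dist_eq, sub_sub_sub_cancel_right]
      exact max_lt hδ hd2
    · rw [lt_div_iff₀ (by positivity)] at hd1
      have he1 : e * (2 * (M * M) * h₀ * R + 1) = η / 2 := div_mul_cancel₀ _ (by positivity)
      nlinarith [abs_nonneg (r - r₁)]
  · set g : ℝ × ℝ → ℝ := (Icc 0 R ×ˢ Icc 0 h₀).indicator fun q => b q.1 (p.2 - 2 * q.2) with hg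
    have hgm : Measurable g := Measurable.indicator
      (hb.comp (by fun_prop : Continuous fun q : ℝ × ℝ => (q.1, p.2 - 2 * q.2))).measurable
      (measurableSet_Icc.prod measurableSet_Icc)
    have hgB : ∀ q, |g q| ≤ |B| := fun q => by
      by_cases hq : q ∈ Icc 0 R ×ˢ Icc 0 h₀
      · rw [hg, indicator_of_mem hq]
        exact (hB (q.1, p.2 - 2 * q.2) ⟨hq.1, by linarith [hp.2.1, hq.2.2], by
          linarith [hp.2.2, hq.2.1]⟩).trans (le_abs_self B)
      · rw [hg, indicator_of_notMem hq, abs_zero]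
        exact abs_nonneg B
    have hmx : Measurable fun q : (ℝ × ℝ) × Ω => nx q.2 q.1.1 q.1.2 :=
      measurable_uncurry_of_continuous_of_measurable (u := fun (p : ℝ × ℝ) ω => nx ω p.1 p.2)
        (fun ω => (H.smooth ω).continuous_x) fun p => H.measurable_x _ _
    have hmG : ∀ ε, Measurable fun q : (ℝ × ℝ) × Ω => G ε q.2 q.1.1 q.1.2 := fun ε => by
      refine (Measurable.const_mul ((hmx.comp (by fun_prop : Measurable fun q : (ℝ × ℝ) × Ω =>
        ((q.1.1 / ε ^ 2, q.1.1 / κ ε), q.2))).mul (hmx.comp (by fun_prop : Measurable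
        fun q : (ℝ × ℝ) × Ω => ((q.1.1 / ε ^ 2 + σ * q.1.2, q.1.1 / κ ε), q.2)))) _).sub
        (hk.measurable.comp (by fun_prop : Measurable fun q : (ℝ × ℝ) × Ω => q.1.2))
    have hZ : ∀ ε ω, ∫ x in (0 : ℝ)..p.1, ∫ h in (0 : ℝ)..h₀, G ε ω x h * b x (p.2 - 2 * h)
        = ∫ q, G ε ω q.1 q.2 * g q ∂((volume.restrict (Ioc 0 p.1)).prod
          (volume.restrict (Ioc 0 h₀))) := fun ε ω => by
      rw [integral_prod, intervalIntegral.integral_of_le hp.1.1]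
      · refine setIntegral_congr_fun measurableSet_Ioc fun x hx => ?_
        simp only
        rw [intervalIntegral.integral_of_le hh₀]
        refine setIntegral_congr_fun measurableSet_Ioc fun h hh => ?_
        simp only [hg]
        rw [indicator_of_mem]
        exact ⟨⟨hx.1.le, hx.2.trans hp.1.2⟩, hh.1.le, hh.2⟩
      · refine Integrable.of_bound (((hGc ε ω).measurable.mul hgm).aestronglyMeasurable)
          (2 * (M * M) * |B|) (.of_forall fun q => ?_)
        rw [norm_mul]
        exact mul_le_mul (hGM _ _ _ _) (hgB q) (abs_nonneg _) (by positivity)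
    simp only [hZ]
    refine tendsto_measure_integral_of_decorrelated (ρ := Prod.fst) (K := 2 * (M * M) * |B|)
      measurable_fst (fun x => ?_) (fun ε => (hmG ε).mul (hgm.comp measurable_fst))
      (fun ε q ω => ?_) (fun q q' hqq => ?_) hη
    · have : Prod.fst ⁻¹' {x} = ({x} : Set ℝ) ×ˢ (univ : Set ℝ) := by ext; simp
      rw [this, Measure.prod_prod, measure_singleton, zero_mul]
    · rw [abs_mul]
      exact mul_le_mul (hGM _ _ _ _) (hgB q) (abs_nonneg _) (by positivity)
    · obtain ⟨x, h⟩ := q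
      obtain ⟨x', h'⟩ := q'
      have hpos : 0 < x' - x := sub_pos.2 hqq
      obtain ⟨hinf, hlim⟩ := tendsto_decay (b := |h| + |h'|) hpos hd
      have hlim := ((hlim.const_mul C).const_mul (2 * (M * M) * |B|)).mul_const (|g (x', h')|)
      rw [mul_zero, mul_zero, zero_mul] at hlim
      refine squeeze_zero_norm' ?_ hlim
      filter_upwards [hinf.eventually_gt_atTop 0] with ε hε
      set δ := (x' - x) / ε ^ 2 - (|h| + |h'|) with hδ
      have hmh : |σ * h| = |h| := by rw [abs_mul, hσ, one_mul]
      have hmh' : |σ * h'| = |h'| := by rw [abs_mul, hσ, one_mul]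
      have hle := le_abs_self (σ * h)
      have hle' := neg_abs_le (σ * h')
      rw [hmh] at hle
      rw [hmh'] at hle'
      have hX : x / ε ^ 2 + |h| + δ = x' / ε ^ 2 - |h'| := by rw [hδ]; ring
      set c₁ := ∫ ω, nx ω (x' / ε ^ 2) (x' / κ ε) * nx ω (x' / ε ^ 2 + σ * h') (x' / κ ε) ∂P
        with hc₁
      have hc : c₁ = σ * k h' := H.correlation _ _ _
      have hσσ : σ * σ = 1 := by rcases H.sign with rfl | rfl <;> norm_num
      have hsplit : ∀ ω, G ε ω x h * g (x, h) * (G ε ω x' h' * g (x', h'))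
          = (G ε ω x h * g (x, h)) * (nx ω (x' / ε ^ 2) (x' / κ ε) *
            nx ω (x' / ε ^ 2 + σ * h') (x' / κ ε) - c₁) * (σ * g (x', h')) := fun ω => by
        simp only [hG]
        rw [hc]
        linear_combination ((σ * (nx ω (x / ε ^ 2) (x / κ ε) * nx ω (x / ε ^ 2 + σ * h)
          (x / κ ε)) - k h) * g (x, h) * k h' * g (x', h')) * hσσ
      simp only [hsplit]
      rw [integral_mul_const, norm_mul, norm_mul, Real.norm_eq_abs, Real.norm_eq_abs σ, hσ,
        one_mul, Real.norm_eq_abs]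
      refine mul_le_mul_of_nonneg_right ?_ (abs_nonneg _)
      have hmono : ∀ z ≤ x / ε ^ 2 + |h|, ∀ y,
          Measurable[𝓖 (x / ε ^ 2 + |h|)] fun ω => nx ω z y := fun z hz y =>
        (H.adapted_x z y).mono (H.history_mono hz) le_rfl
      have hint : Integrable (fun ω => nx ω (x' / ε ^ 2) (x' / κ ε) *
          nx ω (x' / ε ^ 2 + σ * h') (x' / κ ε)) P :=
        integrable_of_abs_le ((H.measurable_x _ _).mul (H.measurable_x _ _))
          fun ω => hprod _ _ _ _ _
      refine abs_integral_mul_le_of_condExp (H.history_le (x / ε ^ 2 + |h|)) ?_ (fun ω => ?_)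
        (hint.sub (integrable_const c₁)) ?_
      · refine Measurable.mul_const (Measurable.sub_const (Measurable.const_mul
          ((hmono _ ?_ _).mul (hmono _ ?_ _)) _) _) _
        · linarith [abs_nonneg h]
        · linarith
      · rw [abs_mul]
        exact mul_le_mul (hGM _ _ _ _) (hgB _) (abs_nonneg _) (by positivity)
      · have hmix := hC.second (x / ε ^ 2 + |h|) δ (x' / ε ^ 2) (x' / ε ^ 2 + σ * h') (x' / κ ε)
          (x' / κ ε) hε (by rw [hX]; linarith [abs_nonneg h']) (by rw [hX]; linarith)
        have hcs := condExp_sub (μ := P) hint (integrable_const c₁) (𝓖 (x / ε ^ 2 + |h|))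
        filter_upwards [hmix, hcs] with ω w1 w2
        rw [condExp_const (H.history_le _)] at w2
        have e : (P[fun ω => nx ω (x' / ε ^ 2) (x' / κ ε) *
          nx ω (x' / ε ^ 2 + σ * h') (x' / κ ε) - c₁ | 𝓖 (x / ε ^ 2 + |h|)]) ω = _ := w2
        rw [e]
        exact w1

end Averaging

/-! ### Characteristics in a decorrelating medium -/

/-- Grönwall's inequality for a scalar function. -/
theorem abs_le_of_abs_deriv_le {v v' : ℝ → ℝ} {a b K e : ℝ} (hK : 1 ≤ K) (he : 0 ≤ e)
    (hv : ∀ r ∈ Icc a b, HasDerivAt v (v' r) r) (hb : ∀ r ∈ Icc a b, |v' r| ≤ K * |v r| + e)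
    {r : ℝ} (hr : r ∈ Icc a b) : |v r| ≤ (|v a| + e) * Real.exp (K * (b - a)) := by
  have hK0 : (0 : ℝ) < K := by linarith
  have := norm_le_gronwallBound_of_norm_deriv_right_le (f := v) (f' := v') (δ := |v a|) (K := K)
    (ε := e) (fun x hx => (hv x hx).continuousAt.continuousWithinAt)
    (fun x hx => (hv x (Ico_subset_Icc_self hx)).hasDerivWithinAt) le_rfl
    (fun x hx => hb x (Ico_subset_Icc_self hx)) r hr
  rw [gronwallBound_of_K_ne_0 hK0.ne'] at this
  have h1 : Real.exp (K * (r - a)) ≤ Real.exp (K * (b - a)) := by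
    gcongr; exact hr.2
  have h2 : e / K ≤ e := div_le_self he hK
  have h3 : 0 ≤ e / K := by positivity
  have h4 := Real.exp_pos (K * (r - a))
  have h5 : e / K * (Real.exp (K * (r - a)) - 1) ≤ e * Real.exp (K * (r - a)) := by nlinarith
  calc |v r| ≤ _ := this
    _ ≤ (|v a| + e) * Real.exp (K * (r - a)) := by linarith
    _ ≤ _ := by gcongr

/-- The right-hand side `F r q` of an equation `q' = F(r, q)` that agrees with
`1 + σ ε n(r/ε², q/κ)` up to errors of second order, where the averages of `n` and of `ny` along
the diagonal are at most `η` on `[0, R]`. -/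
structure IsDriftField (M K ε κ η R σ : ℝ) (n nx ny F : ℝ → ℝ → ℝ) : Prop where
  smooth : IsSmoothField M n nx ny
  pos : 0 < ε
  le : ε ≤ κ
  le_one : ε ≤ 1
  sign : |σ| = 1
  K_nonneg : 0 ≤ K
  R_nonneg : 0 ≤ R
  eta_nonneg : 0 ≤ η
  eta_le : η ≤ 1 / 2
  approx : ∀ r q, |F r q - 1 - σ * ε * n (r / ε ^ 2) (q / κ)| ≤ K * ε ^ 2
  approx_sub : ∀ r q q', |F r q - F r q' -
    σ * ε * (n (r / ε ^ 2) (q / κ) - n (r / ε ^ 2) (q' / κ))| ≤ K * ε * |q - q'|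
  average : ∀ r ∈ Icc 0 R, |∫ x in (0 : ℝ)..r, n (x / ε ^ 2) (x / κ)| ≤ η
  average_y : ∀ r ∈ Icc 0 R, |∫ x in (0 : ℝ)..r, ny (x / ε ^ 2) (x / κ)| ≤ η

namespace IsDriftField

variable {M K ε κ η R σ : ℝ} {n nx ny F : ℝ → ℝ → ℝ}

theorem kappa_pos (D : IsDriftField M K ε κ η R σ n nx ny F) : 0 < κ := D.pos.trans_le D.le

theorem eps_div_le (D : IsDriftField M K ε κ η R σ n nx ny F) {a : ℝ} (ha : 0 ≤ a) :
    ε * (a / κ) ≤ a := by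
  have := D.kappa_pos
  rw [mul_div_left_comm]
  exact mul_le_of_le_one_right ha (div_le_one_of_le₀ D.le this.le)

/-- The solution through the origin stays close to the diagonal on the scale `κ`. -/
theorem abs_sub_diagonal_le (D : IsDriftField M K ε κ η R σ n nx ny F) {q : ℝ → ℝ}
    (hq : ∀ r, HasDerivAt q (F r (q r)) r) (h0 : q 0 = 0) {r : ℝ} (hr : r ∈ Icc 0 R) :
    |q r - r| ≤ (M + 1 + K) * Real.exp ((M + 1) * R) * (η + ε) * ε := by
  have hε := D.pos
  have hκ := D.kappa_pos
  have hM := D.smooth.nonneg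
  have hK := D.K_nonneg
  have hη := D.eta_nonneg
  have hc : Continuous fun x : ℝ => n (x / ε ^ 2) (x / κ) :=
    D.smooth.continuous.comp (by fun_prop : Continuous fun x : ℝ => (x / ε ^ 2, x / κ))
  set A : ℝ → ℝ := fun r => σ * ε * ∫ x in (0 : ℝ)..r, n (x / ε ^ 2) (x / κ) with hA
  have hAd : ∀ r, HasDerivAt A (σ * ε * n (r / ε ^ 2) (r / κ)) r := fun r =>
    (hc.integral_hasStrictDerivAt 0 r).hasDerivAt.const_mul _
  have hAb : ∀ r ∈ Icc 0 R, |A r| ≤ ε * η := fun r hr => by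
    rw [hA, abs_mul, abs_mul, D.sign, one_mul, abs_of_pos hε]
    exact mul_le_mul_of_nonneg_left (D.average r hr) hε.le
  have hv := abs_le_of_abs_deriv_le (v := fun r => q r - r - A r)
    (v' := fun r => F r (q r) - 1 - σ * ε * n (r / ε ^ 2) (r / κ)) (a := 0) (b := R)
    (K := M + 1) (e := M * (ε * η) + K * ε ^ 2) (by linarith) (by positivity)
    (fun r _ => ((hq r).sub (hasDerivAt_id r)).sub (hAd r)) (fun r hr => ?_) hr
  · have hA0 : A 0 = 0 := by simp [hA]
    simp only [h0, hA0, sub_zero, abs_zero, zero_add] at hv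
    have h1 : |q r - r| ≤ |q r - r - A r| + |A r| := by
      have := abs_add_le (q r - r - A r) (A r)
      rwa [sub_add_cancel] at this
    have h2 := hAb r hr
    have h3 : 1 ≤ Real.exp ((M + 1) * R) := Real.one_le_exp (by have := D.R_nonneg; positivity)
    have h4 : ε * η ≤ ε * η * Real.exp ((M + 1) * R) := le_mul_of_one_le_right (by positivity) h3
    have h5 : (M * (ε * η) + K * ε ^ 2 + ε * η) * Real.exp ((M + 1) * R) ≤
        ((M + 1 + K) * (η + ε) * ε) * Real.exp ((M + 1) * R) := by
      gcongr
      have : 0 ≤ K * η * ε + M * ε * ε + ε * ε := by positivity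
      nlinarith
    linarith
  · have h1 := D.approx r (q r)
    have h2 : |σ * ε * (n (r / ε ^ 2) (q r / κ) - n (r / ε ^ 2) (r / κ))| ≤ M * |q r - r| := by
      rw [abs_mul, abs_mul, D.sign, one_mul, abs_of_pos hε]
      have h3 := D.smooth.abs_sub_le_y (r / ε ^ 2) (q r / κ) (r / κ)
      rw [← sub_div, abs_div, abs_of_pos hκ] at h3
      have h4 := D.eps_div_le (abs_nonneg (q r - r))
      calc _ ≤ ε * (M * (|q r - r| / κ)) := by gcongr
        _ = M * (ε * (|q r - r| / κ)) := by ring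
        _ ≤ _ := by gcongr
    have h3 : |q r - r| ≤ |q r - r - A r| + |A r| := by
      have := abs_add_le (q r - r - A r) (A r)
      rwa [sub_add_cancel] at this
    have h4 := hAb r hr
    have h5 : F r (q r) - 1 - σ * ε * n (r / ε ^ 2) (r / κ) =
        (F r (q r) - 1 - σ * ε * n (r / ε ^ 2) (q r / κ)) +
        σ * ε * (n (r / ε ^ 2) (q r / κ) - n (r / ε ^ 2) (r / κ)) := by ring
    rw [h5]
    have h6 : M * |q r - r| ≤ M * (|q r - r - A r| + ε * η) := by gcongr; linarith
    have h7 := abs_nonneg (q r - r - A r)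
    refine (abs_add_le _ _).trans ?_
    linarith

/-- Solutions that start at a distance `O(ε²)` keep that distance, and their difference is
asymptotically constant: along the diagonal the linearized equation has an averaged coefficient. -/
theorem abs_sub_sub_le (D : IsDriftField M K ε κ η R σ n nx ny F) {q q₀ : ℝ → ℝ}
    (hq : ∀ r, HasDerivAt q (F r (q r)) r) (hq₀ : ∀ r, HasDerivAt q₀ (F r (q₀ r)) r)
    (h0 : q₀ 0 = 0) {r₁ r E E' C : ℝ} (hr₁ : 0 ≤ r₁) (hr : r₁ ≤ r) (hrR : r ≤ R)
    (hE : |q r₁ - q₀ r₁| ≤ E * ε ^ 2) (hE' : E' = E * Real.exp ((M + K + 1) * R))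
    (hC : C = (M + 1 + K) * Real.exp ((M + 1) * R)) :
    |q r - q₀ r| ≤ E' * ε ^ 2 ∧ |(q r - q₀ r) - (q r₁ - q₀ r₁)| ≤
      E' * (3 * R * (M * (E' + C) + K) + 4) * (η + ε) * ε ^ 2 := by
  have hε := D.pos
  have hε2 : 0 < ε ^ 2 := by positivity
  have hκ := D.kappa_pos
  have hM := D.smooth.nonneg
  have hK := D.K_nonneg
  have hη := D.eta_nonneg
  have hR := D.R_nonneg
  have hE0 : 0 ≤ E := by
    have := (abs_nonneg _).trans hE
    by_contra! h
    nlinarith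
  have hC0 : 0 ≤ C := by rw [hC]; positivity
  have hE'0 : 0 ≤ E' := by rw [hE']; positivity
  set δ : ℝ → ℝ := fun r => q r - q₀ r with hδ
  have hδd : ∀ r, HasDerivAt δ (F r (q r) - F r (q₀ r)) r := fun r => (hq r).sub (hq₀ r)
  have hsplit : ∀ r, |F r (q r) - F r (q₀ r)| ≤ (M + K + 1) * |δ r| + 0 := fun r => by
    have h1 := D.approx_sub r (q r) (q₀ r)
    have h2 : |σ * ε * (n (r / ε ^ 2) (q r / κ) - n (r / ε ^ 2) (q₀ r / κ))| ≤ M * |δ r| := by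
      rw [abs_mul, abs_mul, D.sign, one_mul, abs_of_pos hε]
      have h3 := D.smooth.abs_sub_le_y (r / ε ^ 2) (q r / κ) (q₀ r / κ)
      rw [← sub_div, abs_div, abs_of_pos hκ] at h3
      have h4 := D.eps_div_le (abs_nonneg (q r - q₀ r))
      calc _ ≤ ε * (M * (|q r - q₀ r| / κ)) := by gcongr
        _ = M * (ε * (|q r - q₀ r| / κ)) := by ring
        _ ≤ _ := by gcongr
    have h3 : K * ε * |δ r| ≤ K * 1 * |δ r| := by
      have := D.le_one
      gcongr
    have h5 := abs_add_le (F r (q r) - F r (q₀ r) -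
      σ * ε * (n (r / ε ^ 2) (q r / κ) - n (r / ε ^ 2) (q₀ r / κ)))
      (σ * ε * (n (r / ε ^ 2) (q r / κ) - n (r / ε ^ 2) (q₀ r / κ)))
    rw [sub_add_cancel] at h5
    have h6 := abs_nonneg (δ r)
    simp only [hδ] at *
    linarith
  have hcrude : ∀ x ∈ Icc r₁ R, |δ x| ≤ E' * ε ^ 2 := fun x hx => by
    refine (abs_le_of_abs_deriv_le (by linarith) le_rfl (fun x _ => hδd x)
      (fun x _ => hsplit x) hx).trans ?_
    rw [add_zero, hE', mul_right_comm]
    have : (M + K + 1) * (R - r₁) ≤ (M + K + 1) * R := by gcongr; linarith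
    have h2 := Real.exp_le_exp.2 this
    have h3 : |δ r₁| ≤ E * ε ^ 2 := hE
    gcongr
  refine ⟨hcrude r ⟨hr, hrR⟩, ?_⟩
  have hcy : Continuous fun x : ℝ => ny (x / ε ^ 2) (x / κ) :=
    D.smooth.continuous_y.comp (by fun_prop : Continuous fun x : ℝ => (x / ε ^ 2, x / κ))
  set G : ℝ → ℝ := fun x => σ * ε / κ * ny (x / ε ^ 2) (x / κ) with hG
  set Γ : ℝ → ℝ := fun x => σ * ε / κ * ∫ y in r₁..x, ny (y / ε ^ 2) (y / κ) with hΓ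
  have hΓd : ∀ x, HasDerivAt Γ (G x) x := fun x =>
    (hcy.integral_hasStrictDerivAt r₁ x).hasDerivAt.const_mul _
  have hΓb : ∀ x ∈ Icc r₁ R, |Γ x| ≤ 2 * η := fun x hx => by
    have h1 : ∫ y in r₁..x, ny (y / ε ^ 2) (y / κ) = (∫ y in (0 : ℝ)..x, ny (y / ε ^ 2) (y / κ)) -
        ∫ y in (0 : ℝ)..r₁, ny (y / ε ^ 2) (y / κ) :=
      (intervalIntegral.integral_interval_sub_left (hcy.intervalIntegrable _ _)
        (hcy.intervalIntegrable _ _)).symm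
    have h2 := D.average_y x ⟨hr₁.trans hx.1, hx.2⟩
    have h3 := D.average_y r₁ ⟨hr₁, hr.trans hrR⟩
    have h4 : |σ * ε / κ| ≤ 1 := by
      rw [abs_div, abs_mul, D.sign, one_mul, abs_of_pos hε, abs_of_pos hκ]
      exact div_le_one_of_le₀ D.le hκ.le
    rw [hΓ, abs_mul, h1]
    calc _ ≤ 1 * (η + η) := mul_le_mul h4 ((abs_sub _ _).trans (add_le_add h2 h3))
          (abs_nonneg _) zero_le_one
      _ = _ := by ring
  set e := (M * (E' + C) + K) * (η + ε) with he
  have he0 : 0 ≤ e := by positivity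
  -- the remainder of the linearization
  have hrem : ∀ x ∈ Icc r₁ R, |F x (q x) - F x (q₀ x) - G x * δ x| ≤ e * (E' * ε ^ 2) := by
    intro x hx
    have h1 := D.approx_sub x (q x) (q₀ x)
    have h2 := D.smooth.abs_taylor_y_le (x / ε ^ 2) (q₀ x / κ) (q x / κ)
    have h3 := D.smooth.lipschitz_y (x / ε ^ 2) (q₀ x / κ) (x / ε ^ 2) (x / κ)
    have h4 := D.abs_sub_diagonal_le hq₀ h0 ⟨hr₁.trans hx.1, hx.2⟩
    have h5 := hcrude x hx
    rw [← hC] at h4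
    rw [← sub_div, abs_div, abs_of_pos hκ] at h2
    rw [sub_self, abs_zero, zero_add, ← sub_div, abs_div, abs_of_pos hκ] at h3
    change |n (x / ε ^ 2) (q x / κ) - n (x / ε ^ 2) (q₀ x / κ) -
      ny (x / ε ^ 2) (q₀ x / κ) * (δ x / κ)| ≤ M * (|δ x| / κ) * (|δ x| / κ) at h2
    have h6 : |δ x| / κ ≤ E' * (η + ε) := by
      rw [div_le_iff₀ hκ]
      calc |δ x| ≤ E' * (ε * ε) := by rw [← sq]; exact h5
        _ ≤ E' * ((η + ε) * κ) := by
          gcongr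
          · linarith
          · exact D.le
        _ = _ := by ring
    have h7 : |q₀ x - x| / κ ≤ C * (η + ε) := by
      rw [div_le_iff₀ hκ]
      refine h4.trans ?_
      gcongr
      exact D.le
    have h8 : F x (q x) - F x (q₀ x) - G x * δ x =
        (F x (q x) - F x (q₀ x) - σ * ε * (n (x / ε ^ 2) (q x / κ) - n (x / ε ^ 2) (q₀ x / κ))) +
        σ * ε * (n (x / ε ^ 2) (q x / κ) - n (x / ε ^ 2) (q₀ x / κ) -
          ny (x / ε ^ 2) (q₀ x / κ) * (δ x / κ)) +
        σ * ε * ((ny (x / ε ^ 2) (q₀ x / κ) - ny (x / ε ^ 2) (x / κ)) * (δ x / κ)) := by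
      simp only [hG]; ring
    rw [h8]
    refine (abs_add_three _ _ _).trans ?_
    rw [abs_mul (σ * ε), abs_mul (σ * ε), abs_mul σ, D.sign, one_mul, abs_of_pos hε, abs_mul,
      abs_div, abs_of_pos hκ]
    have i1 : ε * |n (x / ε ^ 2) (q x / κ) - n (x / ε ^ 2) (q₀ x / κ) -
        ny (x / ε ^ 2) (q₀ x / κ) * (δ x / κ)| ≤ M * (E' * (η + ε)) * (E' * ε ^ 2) := by
      calc _ ≤ ε * (M * (|δ x| / κ) * (|δ x| / κ)) := by gcongr
        _ = M * (|δ x| / κ) * (ε * (|δ x| / κ)) := by ring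
        _ ≤ M * (E' * (η + ε)) * (E' * ε ^ 2) :=
          mul_le_mul (by gcongr) ((D.eps_div_le (abs_nonneg _)).trans h5) (by positivity)
            (by positivity)
    have i2 : ε * (|ny (x / ε ^ 2) (q₀ x / κ) - ny (x / ε ^ 2) (x / κ)| * (|δ x| / κ)) ≤
        M * (C * (η + ε)) * (E' * ε ^ 2) := by
      calc _ ≤ ε * (M * (|q₀ x - x| / κ) * (|δ x| / κ)) := by gcongr
        _ = M * (|q₀ x - x| / κ) * (ε * (|δ x| / κ)) := by ring
        _ ≤ _ :=
          mul_le_mul (by gcongr) ((D.eps_div_le (abs_nonneg _)).trans h5) (by positivity)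
            (by positivity)
    have i3 : K * ε * |q x - q₀ x| ≤ K * (η + ε) * (E' * ε ^ 2) := by
      gcongr
      linarith
    calc _ ≤ K * (η + ε) * (E' * ε ^ 2) + M * (E' * (η + ε)) * (E' * ε ^ 2) +
          M * (C * (η + ε)) * (E' * ε ^ 2) := add_le_add_three (h1.trans i3) i1 i2
      _ = _ := by rw [he]; ring
  have hexp : ∀ x ∈ Icc r₁ R, |Real.exp (-Γ x) - 1| ≤ 4 * η ∧ Real.exp (-Γ x) ≤ 3 := by
    intro x hx
    have h1 := hΓb x hx
    have h2 : |-Γ x| ≤ 1 := by rw [abs_neg]; linarith [D.eta_le]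
    have h3 := Real.abs_exp_sub_one_le h2
    rw [abs_neg] at h3
    exact ⟨by linarith, by linarith [(abs_le.1 h3).2, D.eta_le]⟩
  have hu := (convex_Icc r₁ r).norm_image_sub_le_of_norm_hasDerivWithin_le
    (f := fun x => δ x * Real.exp (-Γ x))
    (f' := fun x => (F x (q x) - F x (q₀ x) - G x * δ x) * Real.exp (-Γ x))
    (C := e * (E' * ε ^ 2) * 3) (fun x _ => by
      refine (((hδd x).mul (hΓd x).neg.exp).congr_deriv ?_).hasDerivWithinAt
      simp only [Pi.neg_apply]
      ring) (fun x hx => ?_) (left_mem_Icc.2 hr) (right_mem_Icc.2 hr)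
  · have hΓ0 : Γ r₁ = 0 := by simp [hΓ]
    simp only [hΓ0, neg_zero, Real.exp_zero, mul_one, Real.norm_eq_abs] at hu
    rw [abs_of_nonneg (by linarith : 0 ≤ r - r₁)] at hu
    have h1 := hexp r ⟨hr, hrR⟩
    have h2 : |δ r * (Real.exp (-Γ r) - 1)| ≤ E' * ε ^ 2 * (4 * η) := by
      rw [abs_mul]
      exact mul_le_mul (hcrude r ⟨hr, hrR⟩) h1.1 (abs_nonneg _) (by positivity)
    have h3 : δ r - δ r₁ = (δ r * Real.exp (-Γ r) - δ r₁) - δ r * (Real.exp (-Γ r) - 1) := by ring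
    change |δ r - δ r₁| ≤ _
    rw [h3]
    have h4 : e * (E' * ε ^ 2) * 3 * (r - r₁) ≤ e * (E' * ε ^ 2) * 3 * R := by
      gcongr; linarith
    have h5 : E' * ε ^ 2 * (4 * η) ≤ E' * ε ^ 2 * (4 * (η + ε)) := by
      gcongr; linarith
    calc _ ≤ e * (E' * ε ^ 2) * 3 * R + E' * ε ^ 2 * (4 * (η + ε)) :=
        (abs_sub _ _).trans (add_le_add (hu.trans h4) (h2.trans h5))
      _ = _ := by rw [he]; ring
  · have hx' : x ∈ Icc r₁ R := ⟨hx.1, hx.2.trans hrR⟩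
    rw [norm_mul, Real.norm_eq_abs, Real.norm_eq_abs, Real.abs_exp]
    exact mul_le_mul (hrem x hx') (hexp x hx').2 (Real.exp_pos _).le (by positivity)

end IsDriftField

/-! ### The characteristics and the averaged kernel in the two regimes -/

/-- A field of the coordinates `x`, `y` of `Regime.unitField`, as a function of time `t` and scaled
range `ξ`; the coordinate `x` is measured in units of `ε²`, the coordinate `y` in units of `κ`. -/
def Regime.eval (R : Regime) (ε κ : ℝ) (g : ℝ → ℝ → ℝ) (t ξ : ℝ) : ℝ :=
  match R with
  | .slow => g (ξ / ε ^ 2) (t / κ)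
  | .rapid => g (t / ε ^ 2) (ξ / κ)

/-- The slowness of the medium relative to the reference medium. -/
def Regime.slowness (R : Regime) (ε κ : ℝ) (n : ℝ → ℝ → ℝ) (t ξ : ℝ) : ℝ :=
  1 + ε * R.eval ε κ n t ξ

/-- The right going characteristics `Θ s` in one realization `n` of the medium. -/
structure IsMediumFlow (R : Regime) (M ε κ : ℝ) (n nx ny Θ : ℝ → ℝ → ℝ) : Prop where
  smooth : IsSmoothField M n nx ny
  pos : 0 < ε
  le : ε ≤ κ
  le_one : ε ≤ 1
  small : ε * M ≤ 1 / 2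
  flow : ∀ s ξ, HasDerivAt (Θ s) (R.slowness ε κ n (Θ s ξ) ξ) ξ
  flow_zero : ∀ s, Θ s 0 = ε ^ 2 * s

namespace IsMediumFlow

variable {R : Regime} {M ε κ : ℝ} {n nx ny Θ : ℝ → ℝ → ℝ}

theorem kappa_pos (H : IsMediumFlow R M ε κ n nx ny Θ) : 0 < κ := H.pos.trans_le H.le

theorem continuous_eval (ε κ : ℝ) {g : ℝ → ℝ → ℝ} (hg : Continuous fun p : ℝ × ℝ => g p.1 p.2) :
    Continuous fun p : ℝ × ℝ => R.eval ε κ g p.1 p.2 := by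
  cases R with
  | slow => exact hg.comp (by fun_prop : Continuous fun p : ℝ × ℝ => (p.2 / ε ^ 2, p.1 / κ))
  | rapid => exact hg.comp (by fun_prop : Continuous fun p : ℝ × ℝ => (p.1 / ε ^ 2, p.2 / κ))

theorem abs_eval_le {g : ℝ → ℝ → ℝ} (hg : ∀ x y, |g x y| ≤ M) (t ξ : ℝ) :
    |R.eval ε κ g t ξ| ≤ M := by
  cases R <;> exact hg _ _

theorem drift (H : IsMediumFlow R M ε κ n nx ny Θ) (t ξ : ℝ) :
    |R.slowness ε κ n t ξ - 1| ≤ ε * M := by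
  rw [Regime.slowness, add_sub_cancel_left, abs_mul, abs_of_pos H.pos]
  exact mul_le_mul_of_nonneg_left (abs_eval_le H.smooth.bound t ξ) H.pos.le

theorem near_one (H : IsMediumFlow R M ε κ n nx ny Θ) (t ξ : ℝ) :
    |R.slowness ε κ n t ξ - 1| ≤ 1 / 2 := (H.drift t ξ).trans H.small

theorem half_le (H : IsMediumFlow R M ε κ n nx ny Θ) (t ξ : ℝ) :
    1 / 2 ≤ R.slowness ε κ n t ξ := by
  linarith [(abs_le.1 (H.near_one t ξ)).1]

theorem le_three_halves (H : IsMediumFlow R M ε κ n nx ny Θ) (t ξ : ℝ) :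
    R.slowness ε κ n t ξ ≤ 3 / 2 := by
  linarith [(abs_le.1 (H.near_one t ξ)).2]

theorem continuous_slowness (H : IsMediumFlow R M ε κ n nx ny Θ) :
    Continuous fun p : ℝ × ℝ => R.slowness ε κ n p.1 p.2 :=
  continuous_const.add (continuous_const.mul (continuous_eval ε κ H.smooth.continuous))

theorem continuous_flow (H : IsMediumFlow R M ε κ n nx ny Θ) (s : ℝ) : Continuous (Θ s) :=
  continuous_iff_continuousAt.2 fun ξ => (H.flow s ξ).continuousAt

theorem flow_mem (H : IsMediumFlow R M ε κ n nx ny Θ) {S Λ s ξ : ℝ} (hs : s ∈ Icc 0 S)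
    (hξ : ξ ∈ Icc 0 Λ) : ε ^ 2 * s ≤ Θ s ξ ∧ Θ s ξ ∈ Icc 0 (S + 2 * Λ) := by
  have h1 := abs_sub_drift_le (v := 1) (H.flow s) (fun y => H.near_one _ _) 0 ξ
  rw [H.flow_zero, sub_zero, abs_of_nonneg hξ.1] at h1
  have h2 := abs_le.1 h1
  have h3 : ε ^ 2 ≤ 1 := by nlinarith [H.pos, H.le_one]
  have h4 : 0 ≤ ε ^ 2 * s := mul_nonneg (sq_nonneg _) hs.1
  have h5 : ε ^ 2 * s ≤ 1 * S := mul_le_mul h3 hs.2 hs.1 zero_le_one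
  exact ⟨by linarith [hξ.1], by linarith [hξ.1], by linarith [hξ.1, hξ.2]⟩

end IsMediumFlow

/-- In the slowly changing medium the right going characteristics solve an equation to which the
estimates for `IsDriftField` apply directly. -/
theorem IsMediumFlow.flow_bound_slow {M ε κ η S Λ : ℝ} {n nx ny Θ : ℝ → ℝ → ℝ}
    (H : IsMediumFlow .slow M ε κ n nx ny Θ) (hS : 0 ≤ S) (hΛ : 0 ≤ Λ) (hη : 0 ≤ η)
    (hη2 : η ≤ 1 / 2)
    (h1 : ∀ r ∈ Icc 0 (S + 2 * Λ), |∫ x in (0 : ℝ)..r, n (x / ε ^ 2) (x / κ)| ≤ η)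
    (h2 : ∀ r ∈ Icc 0 (S + 2 * Λ), |∫ x in (0 : ℝ)..r, ny (x / ε ^ 2) (x / κ)| ≤ η)
    {C₁ E C₂ : ℝ} (hC₁ : C₁ = (M + 1 + 0) * Real.exp ((M + 1) * (S + 2 * Λ)))
    (hE : E = S * Real.exp ((M + 0 + 1) * (S + 2 * Λ)))
    (hC₂ : C₂ = E * (3 * (S + 2 * Λ) * (M * (E + C₁) + 0) + 4)) :
    ∀ s ∈ Icc 0 S, ∀ ξ ∈ Icc 0 Λ, |Θ s ξ - Θ 0 ξ - ε ^ 2 * s| ≤ C₂ * (η + ε) * ε ^ 2 ∧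
      |Θ s ξ - ξ| ≤ (C₁ + E) * (η + ε) * ε := by
  intro s hs ξ hξ
  have hε := H.pos
  have D : IsDriftField M 0 ε κ η (S + 2 * Λ) 1 n nx ny
      (fun ξ t => Regime.slow.slowness ε κ n t ξ) := by
    refine ⟨H.smooth, H.pos, H.le, H.le_one, abs_one, le_rfl, by positivity, hη, hη2,
      fun r q => le_of_eq ?_, fun r q q' => le_of_eq ?_, h1, h2⟩
    · simp [Regime.slowness, Regime.eval]
    · simp only [Regime.slowness, Regime.eval]
      rw [zero_mul, zero_mul, abs_eq_zero]
      ring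
  have h0 : Θ 0 0 = 0 := by simp [H.flow_zero]
  have hξR : ξ ≤ S + 2 * Λ := by linarith [hξ.1, hξ.2]
  have h3 := D.abs_sub_sub_le (H.flow s) (H.flow 0) h0 le_rfl hξ.1 hξR (E := S)
    (by rw [H.flow_zero, h0, sub_zero, abs_of_nonneg (mul_nonneg (sq_nonneg _) hs.1), mul_comm]
        exact mul_le_mul_of_nonneg_right hs.2 (sq_nonneg _)) hE hC₁
  have h4 := D.abs_sub_diagonal_le (H.flow 0) h0 ⟨hξ.1, hξR⟩
  rw [← hC₁] at h4
  have hE0 : 0 ≤ E := by rw [hE]; positivity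
  refine ⟨?_, ?_⟩
  · have := h3.2
    rw [H.flow_zero, h0, sub_zero, ← hC₂] at this
    exact this
  · have h5 : |Θ s ξ - ξ| ≤ |Θ s ξ - Θ 0 ξ| + |Θ 0 ξ - ξ| := abs_sub_le _ _ _
    have h6 : E * ε ^ 2 ≤ E * (η + ε) * ε := by
      rw [sq, mul_assoc]
      gcongr
      linarith
    have := h3.1
    linarith

/-- In the rapidly changing medium the estimates for `IsDriftField` apply to the inverse functions
of the travel times, the positions on the characteristics as functions of time. -/
theorem IsMediumFlow.flow_bound_rapid {M ε κ η S Λ : ℝ} {n nx ny Θ : ℝ → ℝ → ℝ}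
    (H : IsMediumFlow .rapid M ε κ n nx ny Θ) (hS : 0 ≤ S) (hΛ : 0 ≤ Λ) (hη : 0 ≤ η)
    (hη2 : η ≤ 1 / 2)
    (h1 : ∀ r ∈ Icc 0 (S + 2 * Λ), |∫ x in (0 : ℝ)..r, n (x / ε ^ 2) (x / κ)| ≤ η)
    (h2 : ∀ r ∈ Icc 0 (S + 2 * Λ), |∫ x in (0 : ℝ)..r, ny (x / ε ^ 2) (x / κ)| ≤ η)
    {C₁ E C₂ : ℝ} (hC₁ : C₁ = (M + 1 + 10 * M ^ 2) * Real.exp ((M + 1) * (S + 2 * Λ)))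
    (hE : E = 2 * S * Real.exp ((M + 10 * M ^ 2 + 1) * (S + 2 * Λ)))
    (hC₂ : C₂ = E * (3 * (S + 2 * Λ) * (M * (E + C₁) + 10 * M ^ 2) + 4)) :
    ∀ s ∈ Icc 0 S, ∀ ξ ∈ Icc 0 Λ,
      |Θ s ξ - Θ 0 ξ - ε ^ 2 * s| ≤ (C₂ + 4 * M * E + 2 * M * S) * (η + ε) * ε ^ 2 ∧
      |Θ s ξ - ξ| ≤ (C₁ + E) * (η + ε) * ε := by
  intro s hs ξ hξ
  have hε := H.pos
  have hκ := H.kappa_pos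
  have hM := H.smooth.nonneg
  set w : ℝ → ℝ → ℝ := Regime.rapid.slowness ε κ n with hw
  have hw2 : ∀ t x, 1 / 2 ≤ w t x := H.half_le
  have hwpos : ∀ t x, 0 < w t x := fun t x => by linarith [hw2 t x]
  have hlip : ∀ t x x', |w t x - w t x'| ≤ M * |x - x'| := fun t x x' => by
    have h3 := H.smooth.abs_sub_le_y (t / ε ^ 2) (x / κ) (x' / κ)
    rw [← sub_div, abs_div, abs_of_pos hκ] at h3
    have e : w t x - w t x' = ε * (n (t / ε ^ 2) (x / κ) - n (t / ε ^ 2) (x' / κ)) := by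
      simp only [hw, Regime.slowness, Regime.eval]; ring
    rw [e, abs_mul, abs_of_pos hε]
    calc _ ≤ ε * (M * (|x - x'| / κ)) := by gcongr
      _ = M * |x - x'| * (ε / κ) := by ring
      _ ≤ M * |x - x'| * 1 := by
        gcongr
        exact div_le_one_of_le₀ H.le hκ.le
      _ = _ := mul_one _
  have hinv : ∀ t x x', |(w t x)⁻¹ - (w t x')⁻¹| ≤ 4 * M * |x - x'| := fun t x x' => by
    rw [inv_sub_inv (hwpos _ _).ne' (hwpos _ _).ne', abs_div, abs_of_pos
      (mul_pos (hwpos t x) (hwpos t x')), div_le_iff₀ (mul_pos (hwpos t x) (hwpos t x')),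
      abs_sub_comm]
    have h4 : 1 / 4 ≤ w t x * w t x' := by nlinarith [hw2 t x, hw2 t x']
    have h5 := hlip t x x'
    have h6 : 0 ≤ M * |x - x'| := by positivity
    nlinarith
  have hinv_le : ∀ t x, |(w t x)⁻¹ - 1| ≤ 2 * M * ε := fun t x => by
    have e : (w t x)⁻¹ - 1 = -(w t x - 1) / w t x := by
      field_simp [(hwpos t x).ne']; ring
    rw [e, abs_div, abs_neg, abs_of_pos (hwpos t x), div_le_iff₀ (hwpos t x)]
    have h4 := H.drift t x
    have h5 : 0 ≤ M * ε := by positivity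
    have h6 := hw2 t x
    have h7 : |w t x - 1| ≤ ε * M := h4
    nlinarith
  have hwc : Continuous fun p : ℝ × ℝ => w p.1 p.2 := H.continuous_slowness
  set L : NNReal := Real.toNNReal (4 * M) with hL
  have hLip : ∀ t, LipschitzWith L fun x => (w t x)⁻¹ := fun t =>
    LipschitzWith.of_dist_le_mul fun x x' => by
      rw [hL, Real.coe_toNNReal _ (by positivity), Real.dist_eq, Real.dist_eq]
      exact hinv t x x'
  have hX : ∀ s : ℝ, ∃ X : ℝ → ℝ, X (ε ^ 2 * s) = 0 ∧ ∀ t, HasDerivAt X (w t (X t))⁻¹ t :=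
    fun s => exists_forall_hasDerivAt (F := fun t x => (w t x)⁻¹) (K := L) (C := 2)
      (fun x => (hwc.comp (by fun_prop : Continuous fun t : ℝ => (t, x))).inv₀
        fun t => (hwpos t x).ne') hLip (fun t x => by
        rw [abs_inv, abs_of_pos (hwpos t x)]
        exact inv_le_of_inv_le₀ two_pos (by linarith [hw2 t x])) _ _
  choose X hX0 hXd using hX
  -- `X s` is the inverse function of `Θ s`
  have hinvfun : ∀ s ξ, X s (Θ s ξ) = ξ := fun s => by
    have h3 := ODE_solution_unique_univ
      (v := fun ξ y => (w (Θ s ξ) y)⁻¹ * w (Θ s ξ) ξ) (s := fun _ => univ) (K := L * 2) (t₀ := 0)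
      (f := fun ξ => X s (Θ s ξ)) (g := id) (fun ξ => ?_)
      (fun ξ => ⟨(hXd s (Θ s ξ)).comp ξ (H.flow s ξ), trivial⟩) (fun ξ => ⟨?_, trivial⟩) ?_
    · exact fun ξ => congrFun h3 ξ
    · refine (LipschitzWith.of_dist_le_mul fun y y' => ?_).lipschitzOnWith
      have h4 := (hLip (Θ s ξ)).dist_le_mul y y'
      rw [Real.dist_eq] at h4 ⊢
      have h5 : w (Θ s ξ) ξ ≤ 2 := by
        have : w (Θ s ξ) ξ ≤ 3 / 2 := H.le_three_halves _ _
        linarith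
      rw [← sub_mul, abs_mul, abs_of_pos (hwpos (Θ s ξ) ξ)]
      calc _ ≤ L * dist y y' * 2 := mul_le_mul h4 h5 (hwpos _ _).le (by positivity)
        _ = _ := by push_cast; ring
    · refine (hasDerivAt_id ξ).congr_deriv ?_
      rw [id, inv_mul_cancel₀ (hwpos _ _).ne']
    · simp [H.flow_zero, hX0]
  have D : IsDriftField M (10 * M ^ 2) ε κ η (S + 2 * Λ) (-1) n nx ny
      (fun t x => (w t x)⁻¹) := by
    have hval : ∀ t x, w t x = 1 + ε * n (t / ε ^ 2) (x / κ) := fun t x => rfl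
    refine ⟨H.smooth, H.pos, H.le, H.le_one, by simp, by positivity, by positivity, hη, hη2,
      fun t x => ?_, fun t x x' => ?_, h1, h2⟩
    · have e : (w t x)⁻¹ - 1 - -1 * ε * n (t / ε ^ 2) (x / κ) = (w t x - 1) ^ 2 / w t x := by
        rw [eq_div_iff (hwpos t x).ne', sub_mul, sub_mul, inv_mul_cancel₀ (hwpos t x).ne', hval]
        ring
      rw [e, abs_of_nonneg (div_nonneg (sq_nonneg _) (hwpos t x).le), div_le_iff₀ (hwpos t x)]
      have h4 : (w t x - 1) ^ 2 ≤ (ε * M) ^ 2 := sq_le_sq' (abs_le.1 (H.drift t x)).1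
        (abs_le.1 (H.drift t x)).2
      have h5 : 0 ≤ M ^ 2 * ε ^ 2 := by positivity
      nlinarith [hw2 t x]
    · have e : (w t x)⁻¹ - (w t x')⁻¹ - -1 * ε * (n (t / ε ^ 2) (x / κ) - n (t / ε ^ 2) (x' / κ)) =
          (w t x - w t x') * (w t x * w t x' - 1) / (w t x * w t x') := by
        rw [eq_div_iff (mul_pos (hwpos t x) (hwpos t x')).ne']
        have h3 : ε * (n (t / ε ^ 2) (x / κ) - n (t / ε ^ 2) (x' / κ)) = w t x - w t x' := by
          rw [hval, hval]; ring
        rw [mul_assoc (-1 : ℝ), h3]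
        have h4 := (hwpos t x).ne'
        have h5 := (hwpos t x').ne'
        field_simp
        ring
      have hp := mul_pos (hwpos t x) (hwpos t x')
      rw [e, abs_div, abs_of_pos hp, div_le_iff₀ hp, abs_mul]
      have h4 : 1 / 4 ≤ w t x * w t x' := by nlinarith [hw2 t x, hw2 t x']
      have h5 : |w t x * w t x' - 1| ≤ 5 / 2 * (ε * M) := by
        have e2 : w t x * w t x' - 1 = (w t x - 1) * w t x' + (w t x' - 1) := by ring
        have h6 : w t x' ≤ 3 / 2 := H.le_three_halves _ _
        have h7 : |w t x - 1| ≤ ε * M := H.drift t x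
        have h8 : |w t x' - 1| ≤ ε * M := H.drift t x'
        rw [e2]
        refine (abs_add_le _ _).trans ?_
        rw [abs_mul, abs_of_pos (hwpos t x')]
        have := mul_le_mul h7 h6 (hwpos t x').le (by positivity)
        linarith
      have h6 := mul_le_mul (hlip t x x') h5 (abs_nonneg _) (by positivity)
      have h7 : 0 ≤ M ^ 2 * ε * |x - x'| := by positivity
      nlinarith
  obtain ⟨hmem1, hmem2⟩ := H.flow_mem hs hξ
  have h00 : X 0 0 = 0 := by simpa using hX0 0
  have hE0 : 0 ≤ E := by rw [hE]; positivity
  have hC₁0 : 0 ≤ C₁ := by rw [hC₁]; positivity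
  have hs0 : 0 ≤ ε ^ 2 * s := mul_nonneg (sq_nonneg _) hs.1
  have hs1 : ε ^ 2 * s ≤ ε ^ 2 * S := mul_le_mul_of_nonneg_left hs.2 (sq_nonneg _)
  -- the position at time `ε² s` of the characteristic through the origin
  have hstart : |X 0 (ε ^ 2 * s) - ε ^ 2 * s| ≤ 2 * M * ε * (ε ^ 2 * S) := by
    have h3 := abs_sub_drift_le (v := 1) (hXd 0) (fun t => hinv_le _ _) 0 (ε ^ 2 * s)
    rw [h00, sub_zero, sub_zero, one_mul, abs_of_nonneg hs0] at h3
    exact h3.trans (by gcongr)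
  have h3 := D.abs_sub_sub_le (hXd s) (hXd 0) h00 hs0 hmem1 hmem2.2 (E := 2 * S) (by
    rw [hX0, zero_sub, abs_neg]
    have h4 := abs_le.1 hstart
    have h5 : 2 * M * ε * (ε ^ 2 * S) ≤ 1 * (ε ^ 2 * S) := by
      gcongr
      linarith [H.small]
    rw [abs_le]
    constructor <;> nlinarith) hE hC₁
  rw [← hC₂, hX0, hinvfun] at h3
  have h4 := D.abs_sub_diagonal_le (hXd 0) h00 hmem2
  rw [← hC₁] at h4
  obtain ⟨h5, h6⟩ := h3
  refine ⟨?_, ?_⟩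
  · have h7 := abs_sub_drift_le (v := 1) (hXd 0) (fun t => hinv_le _ _) (Θ 0 ξ) (Θ s ξ)
    have h8 := abs_sub_drift_le (v := 4 / 3) (b := 2 / 3) (hXd 0) (fun t => by
      have h9 := hw2 t (X 0 t)
      have h10 : w t (X 0 t) ≤ 3 / 2 := H.le_three_halves _ _
      have h11 : (w t (X 0 t))⁻¹ ≤ 2 := inv_le_of_inv_le₀ two_pos (by linarith)
      have h12 : (2 : ℝ) / 3 ≤ (w t (X 0 t))⁻¹ :=
        (le_inv_comm₀ (by norm_num) (hwpos _ _)).2 (by linarith)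
      rw [abs_le]
      constructor <;> linarith) (Θ 0 ξ) (Θ s ξ)
    rw [hinvfun] at h7 h8
    rw [one_mul] at h7
    have h9 : |Θ s ξ - Θ 0 ξ| ≤ 2 * (E * ε ^ 2) := by
      have h10 := abs_sub_abs_le_abs_sub (4 / 3 * (Θ s ξ - Θ 0 ξ)) (X 0 (Θ s ξ) - ξ)
      rw [abs_sub_comm (4 / 3 * (Θ s ξ - Θ 0 ξ)), abs_mul,
        abs_of_pos (by norm_num : (0 : ℝ) < 4 / 3), abs_sub_comm (X 0 (Θ s ξ)) ξ] at h10
      have : 0 ≤ E * ε ^ 2 := by positivity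
      linarith
    have e : Θ s ξ - Θ 0 ξ - ε ^ 2 * s = -(X 0 (Θ s ξ) - ξ - (Θ s ξ - Θ 0 ξ)) -
        (ξ - X 0 (Θ s ξ) - (0 - X 0 (ε ^ 2 * s))) + (X 0 (ε ^ 2 * s) - ε ^ 2 * s) := by ring
    rw [e]
    refine (abs_add_le _ _).trans ((add_le_add_left (abs_sub _ _) _).trans ?_)
    rw [abs_neg]
    have i1 : 2 * M * ε * |Θ s ξ - Θ 0 ξ| ≤ 2 * M * ε * (2 * (E * ε ^ 2)) := by gcongr
    have i2 : 0 ≤ (4 * M * E + 2 * M * S) * η * ε ^ 2 := by positivity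
    linarith
  · have e : Θ s ξ - ξ = -(X 0 (Θ s ξ) - Θ s ξ) - (ξ - X 0 (Θ s ξ)) := by ring
    rw [e]
    refine (abs_sub _ _).trans ?_
    rw [abs_neg]
    have h7 : E * ε ^ 2 ≤ E * (η + ε) * ε := by
      rw [sq, mul_assoc]
      gcongr
      linarith
    linarith

/-- The labels of the right going characteristics are preserved up to `o(ε²)`, and the
characteristics stay close to the diagonal on the scale of `κ`. -/
theorem Regime.exists_flow_bound (R : Regime) {M S Λ : ℝ} (hM : 0 ≤ M) (hS : 0 ≤ S)
    (hΛ : 0 ≤ Λ) : ∃ C, 0 ≤ C ∧ ∀ {ε κ η : ℝ} {n nx ny Θ : ℝ → ℝ → ℝ},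
      IsMediumFlow R M ε κ n nx ny Θ → 0 ≤ η → η ≤ 1 / 2 →
      (∀ r ∈ Icc 0 (S + 2 * Λ), |∫ x in (0 : ℝ)..r, n (x / ε ^ 2) (x / κ)| ≤ η) →
      (∀ r ∈ Icc 0 (S + 2 * Λ), |∫ x in (0 : ℝ)..r, ny (x / ε ^ 2) (x / κ)| ≤ η) →
      ∀ s ∈ Icc 0 S, ∀ ξ ∈ Icc 0 Λ, |Θ s ξ - Θ 0 ξ - ε ^ 2 * s| ≤ C * (η + ε) * ε ^ 2 ∧
        |Θ s ξ - ξ| ≤ C * (η + ε) * ε := by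
  have hR : 0 ≤ S + 2 * Λ := by positivity
  cases R with
  | slow =>
    obtain ⟨C₁, hC₁⟩ : ∃ C₁, C₁ = (M + 1 + 0) * Real.exp ((M + 1) * (S + 2 * Λ)) := ⟨_, rfl⟩
    obtain ⟨E, hE⟩ : ∃ E, E = S * Real.exp ((M + 0 + 1) * (S + 2 * Λ)) := ⟨_, rfl⟩
    have h0 : 0 ≤ C₁ + E := by rw [hC₁, hE]; positivity
    refine ⟨max (E * (3 * (S + 2 * Λ) * (M * (E + C₁) + 0) + 4)) (C₁ + E),
      le_max_of_le_right h0, fun {ε κ η n nx ny Θ} H hη hη2 h1 h2 s hs ξ hξ => ?_⟩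
    obtain ⟨a, b⟩ := H.flow_bound_slow hS hΛ hη hη2 h1 h2 hC₁ hE rfl s hs ξ hξ
    have hε := H.pos
    refine ⟨a.trans ?_, b.trans ?_⟩
    · gcongr
      exact le_max_left _ _
    · gcongr
      exact le_max_right _ _
  | rapid =>
    obtain ⟨C₁, hC₁⟩ :
      ∃ C₁, C₁ = (M + 1 + 10 * M ^ 2) * Real.exp ((M + 1) * (S + 2 * Λ)) := ⟨_, rfl⟩
    obtain ⟨E, hE⟩ : ∃ E, E = 2 * S * Real.exp ((M + 10 * M ^ 2 + 1) * (S + 2 * Λ)) := ⟨_, rfl⟩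
    have h0 : 0 ≤ C₁ + E := by rw [hC₁, hE]; positivity
    refine ⟨max (E * (3 * (S + 2 * Λ) * (M * (E + C₁) + 10 * M ^ 2) + 4) + 4 * M * E + 2 * M * S)
      (C₁ + E), le_max_of_le_right h0, fun {ε κ η n nx ny Θ} H hη hη2 h1 h2 s hs ξ hξ => ?_⟩
    obtain ⟨a, b⟩ := H.flow_bound_rapid hS hΛ hη hη2 h1 h2 hC₁ hE rfl s hs ξ hξ
    have hε := H.pos
    refine ⟨a.trans ?_, b.trans ?_⟩
    · gcongr
      exact le_max_left _ _
    · gcongr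
      exact le_max_right _ _

/-- Replacing the integrand of an iterated integral. -/
theorem abs_iterated_integral_le {g₁ g₂ : ℝ → ℝ → ℝ} {ξ Λ H e I : ℝ}
    (h₁ : Continuous fun p : ℝ × ℝ => g₁ p.1 p.2) (h₂ : Continuous fun p : ℝ × ℝ => g₂ p.1 p.2)
    (hξ : ξ ∈ Icc 0 Λ) (hH : 0 ≤ H)
    (he : ∀ x ∈ Icc 0 ξ, ∀ h ∈ Icc 0 H, |g₁ x h - g₂ x h| ≤ e)
    (hI : |∫ x in (0 : ℝ)..ξ, ∫ h in (0 : ℝ)..H, g₂ x h| ≤ I) :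
    |∫ x in (0 : ℝ)..ξ, ∫ h in (0 : ℝ)..H, g₁ x h| ≤ I + Λ * H * e := by
  have hi : ∀ {g : ℝ → ℝ → ℝ}, (Continuous fun p : ℝ × ℝ => g p.1 p.2) → ∀ x a c,
      IntervalIntegrable (g x) volume a c := fun hg x a c =>
    (hg.comp (by fun_prop : Continuous fun h : ℝ => (x, h))).intervalIntegrable a c
  have hc : ∀ {g : ℝ → ℝ → ℝ}, (Continuous fun p : ℝ × ℝ => g p.1 p.2) → ∀ a c,
      IntervalIntegrable (fun x => ∫ h in (0 : ℝ)..H, g x h) volume a c := fun hg a c =>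
    (intervalIntegral.continuous_parametric_intervalIntegral_of_continuous' hg 0 H).intervalIntegrable
      a c
  have he0 : 0 ≤ e := (abs_nonneg _).trans (he 0 ⟨le_rfl, hξ.1⟩ 0 ⟨le_rfl, hH⟩)
  have h3 : |∫ x in (0 : ℝ)..ξ, ((∫ h in (0 : ℝ)..H, g₁ x h) - ∫ h in (0 : ℝ)..H, g₂ x h)| ≤
      e * H * |ξ - 0| := by
    refine intervalIntegral.norm_integral_le_of_norm_le_const (E := ℝ) fun x hx => ?_
    rw [uIoc_of_le hξ.1] at hx
    rw [← intervalIntegral.integral_sub (hi h₁ _ _ _) (hi h₂ _ _ _)]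
    refine (intervalIntegral.norm_integral_le_of_norm_le_const (E := ℝ) (C := e)
      fun h hh => ?_).trans_eq (by rw [sub_zero, abs_of_nonneg hH])
    rw [uIoc_of_le hH] at hh
    exact he x (Ioc_subset_Icc_self hx) h (Ioc_subset_Icc_self hh)
  rw [intervalIntegral.integral_sub (hc h₁ _ _) (hc h₂ _ _), sub_zero, abs_of_nonneg hξ.1] at h3
  have h4 : e * H * ξ ≤ e * H * Λ := by
    have := hξ.2
    gcongr
  have h5 := abs_sub_abs_le_abs_sub (∫ x in (0 : ℝ)..ξ, ∫ h in (0 : ℝ)..H, g₁ x h)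
    (∫ x in (0 : ℝ)..ξ, ∫ h in (0 : ℝ)..H, g₂ x h)
  linarith

namespace IsMediumFlow

variable {R : Regime} {M ε κ : ℝ} {n nx ny Θ : ℝ → ℝ → ℝ}

/-- The kernel averages along the characteristics as it does along the diagonal. In the rapidly
changing medium the integral over the range is transformed to an integral over time. -/
theorem average (H : IsMediumFlow R M ε κ n nx ny Θ) {S Λ a η B d ωd : ℝ} (hS : 0 ≤ S)
    (ha : 0 ≤ a) (hη : 0 ≤ η)
    (hΘ : ∀ s ∈ Icc 0 S, ∀ ξ ∈ Icc 0 Λ, |Θ s ξ - ξ| ≤ a * ε) {k : ℝ → ℝ} {b : ℝ → ℝ → ℝ}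
    (hk : Continuous k) (hkM : ∀ h, |k h| ≤ M * M) (hb : Continuous fun p : ℝ × ℝ => b p.1 p.2)
    (hB : ∀ x ∈ Icc 0 (S + 2 * Λ), ∀ u ∈ Icc (-(2 * (S + 1))) S, |b x u| ≤ B)
    (hmod : ∀ x ∈ Icc 0 (S + 2 * Λ), ∀ x' ∈ Icc 0 (S + 2 * Λ), ∀ u ∈ Icc (-(2 * (S + 1))) S,
      |x - x'| ≤ d → |b x u - b x' u| ≤ ωd) (had : a ≤ d)
    (hZ : ∀ r ∈ Icc 0 (S + 2 * Λ), ∀ s ∈ Icc 0 S, |∫ x in (0 : ℝ)..r, ∫ h in (0 : ℝ)..(S + 1),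
      (R.sign * (nx (x / ε ^ 2) (x / κ) * nx (x / ε ^ 2 + R.sign * h) (x / κ)) - k h) *
        b x (s - 2 * h)| ≤ η) {s ξ : ℝ} (hs : s ∈ Icc 0 S) (hξ : ξ ∈ Icc 0 Λ) :
    |∫ x in (0 : ℝ)..ξ, ∫ h in (0 : ℝ)..(S + 1), (R.sign * R.eval ε κ nx (Θ s x) x *
      R.eval ε κ (fun x y => nx (x + R.sign * h) y) (Θ s x) x - k h) * b x (s - 2 * h)| ≤
      2 * η + Λ * (S + 1) * (2 * (M * M) * (a * B + ωd + M * ε * B)) := by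
  have hε := H.pos
  have hκ := H.kappa_pos
  have hM := H.smooth.nonneg
  have hΛ : 0 ≤ Λ := hξ.1.trans hξ.2
  have hB0 : 0 ≤ B := (abs_nonneg _).trans
    (hB 0 ⟨le_rfl, by positivity⟩ 0 ⟨by linarith, hS⟩)
  have hω0 : 0 ≤ ωd := (abs_nonneg _).trans
    (hmod 0 ⟨le_rfl, by positivity⟩ 0 ⟨le_rfl, by positivity⟩ 0 ⟨by linarith, hS⟩ (by
      rw [sub_self, abs_zero]; linarith))
  have hS1 : 0 ≤ S + 1 := by linarith
  have hσ : |R.sign| = 1 := by cases R <;> simp [Regime.sign]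
  have hu : ∀ h ∈ Icc 0 (S + 1), s - 2 * h ∈ Icc (-(2 * (S + 1))) S := fun h hh =>
    ⟨by linarith [hs.1, hh.2], by linarith [hs.2, hh.1]⟩
  -- dependence of the product on the slow coordinate
  have hprod : ∀ x x' y y', |R.sign * (nx x y * nx x' y) - R.sign * (nx x y' * nx x' y')| ≤
      2 * (M * M) * |y - y'| := fun x x' y y' => by
    have e : R.sign * (nx x y * nx x' y) - R.sign * (nx x y' * nx x' y') =
        R.sign * ((nx x y - nx x y') * nx x' y + nx x y' * (nx x' y - nx x' y')) := by ring
    have l : ∀ x, |nx x y - nx x y'| ≤ M * |y - y'| := fun x => by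
      simpa using H.smooth.lipschitz_x x y x y'
    rw [e, abs_mul, hσ, one_mul]
    refine (abs_add_le _ _).trans ?_
    rw [abs_mul, abs_mul]
    have h1 := mul_le_mul (l x) (H.smooth.bound_x x' y) (abs_nonneg _) (by positivity)
    have h2 := mul_le_mul (H.smooth.bound_x x y') (l x') (abs_nonneg _) (by positivity)
    linarith
  have hG : ∀ x x' y h, |R.sign * (nx x y * nx x' y) - k h| ≤ 2 * (M * M) := fun x x' y h => by
    refine (abs_sub _ _).trans ?_
    rw [abs_mul, hσ, one_mul, abs_mul]
    have h1 := mul_le_mul (H.smooth.bound_x x y) (H.smooth.bound_x x' y) (abs_nonneg _) hM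
    linarith [hkM h]
  have hscale : ∀ x ∈ Icc 0 ξ, |Θ s x / κ - x / κ| ≤ a := fun x hx => by
    rw [← sub_div, abs_div, abs_of_pos hκ, div_le_iff₀ hκ]
    exact (hΘ s hs x ⟨hx.1, hx.2.trans hξ.2⟩).trans (mul_le_mul_of_nonneg_left H.le ha)
  have hΘc := H.continuous_flow s
  have hξR : ξ ≤ S + 2 * Λ := by linarith [hξ.2]
  have hbc : Continuous fun p : ℝ × ℝ => b p.1 (s - 2 * p.2) :=
    hb.comp (by fun_prop : Continuous fun p : ℝ × ℝ => (p.1, s - 2 * p.2))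
  have hkc : Continuous fun p : ℝ × ℝ => k p.2 := hk.comp continuous_snd
  cases R with
  | slow =>
    simp only [Regime.sign, Regime.eval] at *
    have hcn : ∀ v : ℝ → ℝ, Continuous v → Continuous fun p : ℝ × ℝ =>
        (1 * (nx (p.1 / ε ^ 2) (v p.1) * nx (p.1 / ε ^ 2 + 1 * p.2) (v p.1)) - k p.2) *
          b p.1 (s - 2 * p.2) := fun v hv =>
      ((continuous_const.mul ((H.smooth.continuous_x.comp
        (by fun_prop : Continuous fun p : ℝ × ℝ => (p.1 / ε ^ 2, v p.1))).mul
        (H.smooth.continuous_x.comp (by fun_prop : Continuous fun p : ℝ × ℝ =>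
          (p.1 / ε ^ 2 + 1 * p.2, v p.1))))).sub hkc).mul hbc
    simp only [mul_assoc (1 : ℝ)]
    refine (abs_iterated_integral_le (hcn (fun x => Θ s x / κ) (by fun_prop))
      (hcn (fun x => x / κ) (by fun_prop)) hξ hS1 (e := 2 * (M * M) * a * B)
      (fun x hx h hh => ?_) (hZ ξ ⟨hξ.1, hξR⟩ s hs)).trans ?_
    · rw [← sub_mul, abs_mul, sub_sub_sub_cancel_right]
      refine mul_le_mul ((hprod _ _ _ _).trans ?_) (hB x ⟨hx.1, hx.2.trans hξR⟩ _ (hu h hh))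
        (abs_nonneg _) (by positivity)
      have := hscale x hx
      gcongr
    · have h1 : 0 ≤ Λ * (S + 1) * (2 * (M * M) * (ωd + M * ε * B)) := by positivity
      linarith
  | rapid =>
    simp only [Regime.sign, Regime.eval] at *
    set w : ℝ → ℝ → ℝ := Regime.rapid.slowness ε κ n with hw
    have hwc : Continuous fun x => w (Θ s x) x :=
      H.continuous_slowness.comp (by fun_prop : Continuous fun x : ℝ => (Θ s x, x))
    set Q : ℝ → ℝ → ℝ := fun t h =>
      (-1 * (nx (t / ε ^ 2) (t / κ) * nx (t / ε ^ 2 + -1 * h) (t / κ)) - k h) *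
        b t (s - 2 * h) with hQ
    have hQc : Continuous fun p : ℝ × ℝ => Q p.1 p.2 :=
      ((continuous_const.mul ((H.smooth.continuous_x.comp
        (by fun_prop : Continuous fun p : ℝ × ℝ => (p.1 / ε ^ 2, p.1 / κ))).mul
        (H.smooth.continuous_x.comp (by fun_prop : Continuous fun p : ℝ × ℝ =>
          (p.1 / ε ^ 2 + -1 * p.2, p.1 / κ))))).sub hkc).mul hbc
    have hI : Continuous fun t => ∫ h in (0 : ℝ)..(S + 1), Q t h :=
      intervalIntegral.continuous_parametric_intervalIntegral_of_continuous' hQc 0 (S + 1)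
    have hchange : ∫ x in (0 : ℝ)..ξ, ∫ h in (0 : ℝ)..(S + 1), Q (Θ s x) h * w (Θ s x) x =
        (∫ t in (0 : ℝ)..(Θ s ξ), ∫ h in (0 : ℝ)..(S + 1), Q t h) -
        ∫ t in (0 : ℝ)..(ε ^ 2 * s), ∫ h in (0 : ℝ)..(S + 1), Q t h := by
      rw [intervalIntegral.integral_interval_sub_left (hI.intervalIntegrable _ _)
        (hI.intervalIntegrable _ _), ← H.flow_zero s,
        ← intervalIntegral.integral_comp_mul_deriv (g := fun t => ∫ h in (0 : ℝ)..(S + 1), Q t h)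
          (fun x _ => H.flow s x) hwc.continuousOn hI]
      simp only [intervalIntegral.integral_mul_const, Function.comp]
      rfl
    obtain ⟨hm1, hm2⟩ := H.flow_mem hs hξ
    simp only [mul_assoc (-1 : ℝ)]
    refine (abs_iterated_integral_le (g₂ := fun x h => Q (Θ s x) h * w (Θ s x) x) (I := 2 * η)
      (e := 2 * (M * M) * (a * B + ωd + M * ε * B)) ?_ ?_ hξ hS1
      (fun x hx h hh => ?_) ?_).trans le_rfl
    · exact ((continuous_const.mul ((H.smooth.continuous_x.comp
        (by fun_prop : Continuous fun p : ℝ × ℝ => (Θ s p.1 / ε ^ 2, p.1 / κ))).mul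
        (H.smooth.continuous_x.comp (by fun_prop : Continuous fun p : ℝ × ℝ =>
          (Θ s p.1 / ε ^ 2 + -1 * p.2, p.1 / κ))))).sub hkc).mul hbc
    · exact (hQc.comp (by fun_prop : Continuous fun p : ℝ × ℝ => (Θ s p.1, p.2))).mul
        (hwc.comp continuous_fst)
    · have hxΛ : x ∈ Icc 0 Λ := ⟨hx.1, hx.2.trans hξ.2⟩
      have hxR : x ∈ Icc 0 (S + 2 * Λ) := ⟨hx.1, by linarith [hxΛ.2]⟩
      have hΘR := (H.flow_mem hs hxΛ).2
      have h1 := hprod (Θ s x / ε ^ 2) (Θ s x / ε ^ 2 + -1 * h) (x / κ) (Θ s x / κ)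
      rw [abs_sub_comm (x / κ)] at h1
      have h2 := hscale x hx
      have h3 := hG (Θ s x / ε ^ 2) (Θ s x / ε ^ 2 + -1 * h) (Θ s x / κ) h
      have h4 := hB x hxR _ (hu h hh)
      have h5 := hB _ hΘR _ (hu h hh)
      have h6 : |b x (s - 2 * h) - b (Θ s x) (s - 2 * h)| ≤ ωd := by
        refine hmod x hxR _ hΘR _ (hu h hh) ?_
        rw [abs_sub_comm]
        exact ((hΘ s hs x hxΛ).trans (mul_le_of_le_one_right ha H.le_one)).trans had
      have h7 : |w (Θ s x) x - 1| ≤ ε * M := H.drift _ _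
      set p₁ := -1 * (nx (Θ s x / ε ^ 2) (x / κ) * nx (Θ s x / ε ^ 2 + -1 * h) (x / κ))
      set p₂ := -1 * (nx (Θ s x / ε ^ 2) (Θ s x / κ) *
        nx (Θ s x / ε ^ 2 + -1 * h) (Θ s x / κ)) with hp₂
      have e : (p₁ - k h) * b x (s - 2 * h) - Q (Θ s x) h * w (Θ s x) x =
          (p₁ - p₂) * b x (s - 2 * h) +
          (p₂ - k h) * (b x (s - 2 * h) - b (Θ s x) (s - 2 * h)) -
          (p₂ - k h) * b (Θ s x) (s - 2 * h) * (w (Θ s x) x - 1) := by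
        simp only [hQ, ← hp₂]; ring
      rw [e]
      refine (abs_sub _ _).trans ((add_le_add_left (abs_add_le _ _) _).trans ?_)
      rw [abs_mul, abs_mul, abs_mul, abs_mul (p₂ - k h)]
      have i1 : |p₁ - p₂| * |b x (s - 2 * h)| ≤ 2 * (M * M) * a * B :=
        mul_le_mul (h1.trans (by gcongr)) h4 (abs_nonneg _) (by positivity)
      have i2 := mul_le_mul h3 h6 (abs_nonneg _) (by positivity)
      have i3 := mul_le_mul (mul_le_mul h3 h5 (abs_nonneg _) (by positivity)) h7 (abs_nonneg _)
        (by positivity)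
      linarith
    · rw [hchange, two_mul]
      have hs' : ε ^ 2 * s ∈ Icc 0 (S + 2 * Λ) :=
        ⟨mul_nonneg (sq_nonneg _) hs.1, hm1.trans hm2.2⟩
      exact (abs_sub _ _).trans (add_le_add (hZ _ hm2 s hs) (hZ _ hs' s hs))

end IsMediumFlow

/-! ### The coupling of the right and left going waves -/

/-- The time derivative of the slowness. -/
def Regime.slownessT (R : Regime) (ε κ : ℝ) (nx ny : ℝ → ℝ → ℝ) (t ξ : ℝ) : ℝ :=
  match R with
  | .slow => ε * (R.eval ε κ ny t ξ / κ)
  | .rapid => ε * (R.eval ε κ nx t ξ / ε ^ 2)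

/-- The range derivative of the slowness. -/
def Regime.slownessX (R : Regime) (ε κ : ℝ) (nx ny : ℝ → ℝ → ℝ) (t ξ : ℝ) : ℝ :=
  match R with
  | .slow => ε * (R.eval ε κ nx t ξ / ε ^ 2)
  | .rapid => ε * (R.eval ε κ ny t ξ / κ)

/-- The coefficient `(w_ξ + v w w_t) / (2w)` of the coupling of the right (`v = 1`) and left
(`v = -1`) going waves in a medium of slowness `w`. -/
def Regime.coupling (R : Regime) (ε κ : ℝ) (n nx ny : ℝ → ℝ → ℝ) (v t ξ : ℝ) : ℝ :=
  (R.slownessX ε κ nx ny t ξ + v * R.slowness ε κ n t ξ * R.slownessT ε κ nx ny t ξ) /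
    (2 * R.slowness ε κ n t ξ)

namespace IsMediumFlow

variable {R : Regime} {M ε κ : ℝ} {n nx ny Θ : ℝ → ℝ → ℝ}

theorem hasDerivAt_slowness (N : IsSmoothField M n nx ny) {T : ℝ → ℝ} {v ξ : ℝ}
    (hT : HasDerivAt T v ξ) : HasDerivAt (fun x => R.slowness ε κ n (T x) x)
      (R.slownessX ε κ nx ny (T ξ) ξ + v * R.slownessT ε κ nx ny (T ξ) ξ) ξ := by
  have hid := hasDerivAt_id ξ
  cases R with
  | slow =>
    refine (((N.hasDerivAt_comp (hid.div_const (ε ^ 2)) (hT.div_const κ)).const_mul ε).const_add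
      1).congr_deriv ?_
    simp only [Regime.slownessX, Regime.slownessT, Regime.eval, id]
    ring
  | rapid =>
    refine (((N.hasDerivAt_comp (hT.div_const (ε ^ 2)) (hid.div_const κ)).const_mul ε).const_add
      1).congr_deriv ?_
    simp only [Regime.slownessX, Regime.slownessT, Regime.eval, id]
    ring

theorem continuous_coupling (H : IsMediumFlow R M ε κ n nx ny Θ) (v : ℝ) :
    Continuous fun p : ℝ × ℝ => R.coupling ε κ n nx ny v p.1 p.2 := by
  have hw := H.continuous_slowness
  have hx : Continuous fun p : ℝ × ℝ => R.eval ε κ nx p.1 p.2 :=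
    continuous_eval ε κ H.smooth.continuous_x
  have hy : Continuous fun p : ℝ × ℝ => R.eval ε κ ny p.1 p.2 :=
    continuous_eval ε κ H.smooth.continuous_y
  have hX : Continuous fun p : ℝ × ℝ => R.slownessX ε κ nx ny p.1 p.2 := by
    cases R
    · exact continuous_const.mul (hx.div_const _)
    · exact continuous_const.mul (hy.div_const _)
  have hT : Continuous fun p : ℝ × ℝ => R.slownessT ε κ nx ny p.1 p.2 := by
    cases R
    · exact continuous_const.mul (hy.div_const _)
    · exact continuous_const.mul (hx.div_const _)
  refine (hX.add ((continuous_const.mul hw).mul hT)).div (continuous_const.mul hw) fun p => ?_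
  have := H.half_le p.1 p.2
  positivity

/-- The leading part of the coupling coefficients. -/
theorem abs_coupling_sub_le (H : IsMediumFlow R M ε κ n nx ny Θ) (t ξ : ℝ) :
    |ε * R.coupling ε κ n nx ny 1 t ξ - R.eval ε κ nx t ξ / 2| ≤ (M ^ 2 + M) * ε ∧
    |ε * R.coupling ε κ n nx ny (-1) t ξ - R.sign * R.eval ε κ nx t ξ / 2| ≤
      (M ^ 2 + M) * ε := by
  have hε := H.pos
  have hκ := H.kappa_pos
  have hM := H.smooth.nonneg
  have hw := H.half_le t ξ
  have hd := H.drift t ξ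
  have hx : |R.eval ε κ nx t ξ| ≤ M := abs_eval_le H.smooth.bound_x t ξ
  have hy : |R.eval ε κ ny t ξ| ≤ M := abs_eval_le H.smooth.bound_y t ξ
  set w := R.slowness ε κ n t ξ with hwdef
  have hwpos : 0 < w := by linarith
  have hyκ : |ε * (ε * (R.eval ε κ ny t ξ / κ))| ≤ M * ε := by
    rw [abs_mul, abs_mul, abs_div, abs_of_pos hε, abs_of_pos hκ]
    have : ε * (|R.eval ε κ ny t ξ| / κ) ≤ M := by
      rw [mul_div_left_comm]
      calc _ ≤ M * 1 := by
            gcongr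
            exact div_le_one_of_le₀ H.le hκ.le
        _ = M := mul_one M
    nlinarith
  have hxw : |R.eval ε κ nx t ξ * ((1 - w) / (2 * w))| ≤ M ^ 2 * ε := by
    rw [abs_mul, abs_div, abs_of_pos (by positivity : 0 < 2 * w), abs_sub_comm]
    have : |w - 1| / (2 * w) ≤ ε * M := (div_le_self (abs_nonneg _) (by linarith)).trans hd
    calc _ ≤ M * (ε * M) := by gcongr
      _ = _ := by ring
  have hyw : |ε * (ε * (R.eval ε κ ny t ξ / κ)) / (2 * w)| ≤ M * ε := by
    rw [abs_div, abs_of_pos (by positivity : 0 < 2 * w)]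
    exact (div_le_self (abs_nonneg _) (by linarith)).trans hyκ
  have hM2 : 0 ≤ M ^ 2 * ε := by positivity
  cases R with
  | slow =>
    simp only [Regime.coupling, Regime.slownessX, Regime.slownessT, Regime.sign, ← hwdef]
    set X := Regime.slow.eval ε κ nx t ξ
    set Y := Regime.slow.eval ε κ ny t ξ
    have hY2 : |ε * (ε * (Y / κ)) / 2| ≤ M * ε := by
      rw [abs_div, abs_of_pos (two_pos : (0 : ℝ) < 2)]
      exact (div_le_self (abs_nonneg _) one_le_two).trans hyκ
    have e1 : ε * ((ε * (X / ε ^ 2) + 1 * w * (ε * (Y / κ))) / (2 * w)) - X / 2 =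
        X * ((1 - w) / (2 * w)) + ε * (ε * (Y / κ)) / 2 := by
      field_simp
      ring
    have e2 : ε * ((ε * (X / ε ^ 2) + -1 * w * (ε * (Y / κ))) / (2 * w)) - 1 * X / 2 =
        X * ((1 - w) / (2 * w)) - ε * (ε * (Y / κ)) / 2 := by
      field_simp
      ring
    rw [e1, e2, add_mul]
    exact ⟨(abs_add_le _ _).trans (add_le_add hxw hY2), (abs_sub _ _).trans (add_le_add hxw hY2)⟩
  | rapid =>
    simp only [Regime.coupling, Regime.slownessX, Regime.slownessT, Regime.sign, ← hwdef]
    set X := Regime.rapid.eval ε κ nx t ξ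
    set Y := Regime.rapid.eval ε κ ny t ξ
    have e1 : ε * ((ε * (Y / κ) + 1 * w * (ε * (X / ε ^ 2))) / (2 * w)) - X / 2 =
        ε * (ε * (Y / κ)) / (2 * w) := by
      field_simp
      ring
    have e2 : ε * ((ε * (Y / κ) + -1 * w * (ε * (X / ε ^ 2))) / (2 * w)) - -1 * X / 2 =
        ε * (ε * (Y / κ)) / (2 * w) := by
      field_simp
      ring
    rw [e1, e2, add_mul]
    exact ⟨by linarith, by linarith⟩

theorem abs_coupling_le (H : IsMediumFlow R M ε κ n nx ny Θ) (t ξ : ℝ) :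
    |R.coupling ε κ n nx ny 1 t ξ| ≤ (M ^ 2 + 2 * M) / ε ∧
    |R.coupling ε κ n nx ny (-1) t ξ| ≤ (M ^ 2 + 2 * M) / ε := by
  obtain ⟨h1, h2⟩ := H.abs_coupling_sub_le t ξ
  have hε := H.pos
  have hM := H.smooth.nonneg
  have hx : |R.eval ε κ nx t ξ| ≤ M := abs_eval_le H.smooth.bound_x t ξ
  have hσ : |R.sign| = 1 := by cases R <;> simp [Regime.sign]
  have h3 : (M ^ 2 + M) * ε ≤ (M ^ 2 + M) * 1 := by
    have := H.le_one
    gcongr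
  have key : ∀ a b : ℝ, |ε * a - b| ≤ (M ^ 2 + M) * ε → |b| ≤ M → |a| ≤ (M ^ 2 + 2 * M) / ε := by
    intro a b hab hb
    rw [le_div_iff₀ hε]
    have := abs_sub_abs_le_abs_sub (ε * a) b
    rw [abs_mul, abs_of_pos hε] at this
    linarith
  refine ⟨key _ _ h1 ?_, key _ _ h2 ?_⟩
  · rw [abs_div, abs_two]
    linarith [abs_nonneg (R.eval ε κ nx t ξ)]
  · rw [abs_div, abs_mul, hσ, one_mul, abs_two]
    linarith [abs_nonneg (R.eval ε κ nx t ξ)]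

/-- Along the left going characteristics the leading part of the coupling coefficient varies
through the coordinate of decorrelation alone. -/
theorem abs_eval_left_le (H : IsMediumFlow R M ε κ n nx ny Θ) {T : ℝ → ℝ} {S : ℝ}
    (hT : ∀ ξ, HasDerivAt T (-R.slowness ε κ n (T ξ) ξ) ξ) (ξ : ℝ) {h : ℝ}
    (hh : h ∈ Icc 0 (S + 1)) :
    |R.eval ε κ nx (T (ξ + ε ^ 2 * h)) (ξ + ε ^ 2 * h) -
      R.eval ε κ (fun x y => nx (x + R.sign * h) y) (T ξ) ξ| ≤
      M * (M + 3 / 2) * (S + 1) * ε := by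
  have hε := H.pos
  have hκ := H.kappa_pos
  have hM := H.smooth.nonneg
  have hε2 : 0 < ε ^ 2 := by positivity
  have hS : 0 ≤ S + 1 := hh.1.trans hh.2
  have hdr := abs_sub_drift_le (v := -1) (b := ε * M) hT (fun y => by
    rw [show -R.slowness ε κ n (T y) y - -1 = -(R.slowness ε κ n (T y) y - 1) by ring, abs_neg]
    exact H.drift _ _) ξ (ξ + ε ^ 2 * h)
  rw [add_sub_cancel_left, abs_of_nonneg (mul_nonneg hε2.le hh.1)] at hdr
  have hεκ : ε ^ 2 * h / κ ≤ ε * h := by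
    rw [div_le_iff₀ hκ]
    have h1 := mul_le_mul_of_nonneg_left H.le (mul_nonneg hε.le hh.1)
    linarith
  cases R with
  | slow =>
    simp only [Regime.eval, Regime.sign]
    have e : (ξ + ε ^ 2 * h) / ε ^ 2 = ξ / ε ^ 2 + 1 * h := by field_simp
    rw [e]
    refine (H.smooth.lipschitz_x _ _ _ _).trans ?_
    rw [sub_self, abs_zero, zero_add, ← sub_div, abs_div, abs_of_pos hκ, mul_assoc, mul_assoc]
    refine mul_le_mul_of_nonneg_left ?_ hM
    have h1 : |T (ξ + ε ^ 2 * h) - T ξ| ≤ 3 / 2 * (ε ^ 2 * h) := by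
      have h2 := abs_add_le (T (ξ + ε ^ 2 * h) - T ξ - -1 * (ε ^ 2 * h)) (-1 * (ε ^ 2 * h))
      rw [sub_add_cancel, abs_mul, abs_neg, abs_one, one_mul,
        abs_of_nonneg (mul_nonneg hε2.le hh.1)] at h2
      have h3 := mul_le_mul_of_nonneg_right H.small (mul_nonneg hε2.le hh.1)
      linarith
    have h4 : |T (ξ + ε ^ 2 * h) - T ξ| / κ ≤ 3 / 2 * (ε * h) := by
      rw [div_le_iff₀ hκ]
      rw [div_le_iff₀ hκ] at hεκ
      linarith
    have h5 : ε * h ≤ ε * (S + 1) := mul_le_mul_of_nonneg_left hh.2 hε.le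
    have h6 : 0 ≤ M * (ε * (S + 1)) := by positivity
    linarith
  | rapid =>
    simp only [Regime.eval, Regime.sign]
    refine (H.smooth.lipschitz_x _ _ _ _).trans ?_
    rw [mul_assoc, mul_assoc]
    refine mul_le_mul_of_nonneg_left ?_ hM
    have e : T (ξ + ε ^ 2 * h) / ε ^ 2 - (T ξ / ε ^ 2 + -1 * h) =
        (T (ξ + ε ^ 2 * h) - T ξ - -1 * (ε ^ 2 * h)) / ε ^ 2 := by field_simp; ring
    have h1 : |T (ξ + ε ^ 2 * h) / ε ^ 2 - (T ξ / ε ^ 2 + -1 * h)| ≤ ε * M * h := by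
      rw [e, abs_div, abs_of_pos hε2, div_le_iff₀ hε2]
      linarith
    have h2 : |(ξ + ε ^ 2 * h) / κ - ξ / κ| ≤ ε * h := by
      rw [← sub_div, add_sub_cancel_left, abs_div, abs_of_pos hκ,
        abs_of_nonneg (mul_nonneg hε2.le hh.1)]
      exact hεκ
    have h5 : ε * h ≤ ε * (S + 1) := mul_le_mul_of_nonneg_left hh.2 hε.le
    have h6 : ε * h * M ≤ ε * (S + 1) * M := mul_le_mul_of_nonneg_right h5 hM
    have h7 : 0 ≤ ε * (S + 1) := by positivity
    linarith

/-- The hypotheses of the deterministic error estimate, from the averages of the medium. -/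
theorem isFrontApprox (H : IsMediumFlow R M ε κ n nx ny Θ) {S Λ C η B d ωd M' : ℝ}
    (hM' : M' = 2 * (M + 1) ^ 2 * (S + 1)) (hS : 0 < S) (hΛ : 0 ≤ Λ) (hC : 0 ≤ C) (hη : 0 ≤ η)
    (hΘ : ∀ s ∈ Icc 0 S, ∀ ξ ∈ Icc 0 Λ, |Θ s ξ - Θ 0 ξ - ε ^ 2 * s| ≤ C * (η + ε) * ε ^ 2 ∧
      |Θ s ξ - ξ| ≤ C * (η + ε) * ε) {k : ℝ → ℝ} {b : ℝ → ℝ → ℝ}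
    (hk : Continuous k) (hkM : ∀ h, |k h| ≤ M * M) (hb : Continuous fun p : ℝ × ℝ => b p.1 p.2)
    (hB : ∀ x ∈ Icc 0 (S + 2 * Λ), ∀ u ∈ Icc (-(2 * (S + 1))) S, |b x u| ≤ B)
    (hmod : ∀ x ∈ Icc 0 (S + 2 * Λ), ∀ x' ∈ Icc 0 (S + 2 * Λ), ∀ u ∈ Icc (-(2 * (S + 1))) S,
      ∀ u' ∈ Icc (-(2 * (S + 1))) S, |x - x'| ≤ d → |u - u'| ≤ d → |b x u - b x' u'| ≤ ωd)
    (h1 : C * (η + ε) ≤ 1)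
    (hd : 2 * (C * (η + ε)) + 2 * M' * ε * (S + 1) + ε ^ 2 * (S + 1) ≤ d)
    (hZ : ∀ r ∈ Icc 0 (S + 2 * Λ), ∀ s ∈ Icc 0 S, |∫ x in (0 : ℝ)..r, ∫ h in (0 : ℝ)..(S + 1),
      (R.sign * (nx (x / ε ^ 2) (x / κ) * nx (x / ε ^ 2 + R.sign * h) (x / κ)) - k h) *
        b x (s - 2 * h)| ≤ η) :
    IsFrontApprox Λ ε S M' R.sign (C * (η + ε))
      (2 * η + Λ * (S + 1) * (2 * (M * M) * (C * (η + ε) * B + ωd + M * ε * B))) d ωd B k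
      (R.slowness ε κ n) (R.coupling ε κ n nx ny 1) (R.coupling ε κ n nx ny (-1)) Θ
      (R.eval ε κ nx) (fun h => R.eval ε κ fun x y => nx (x + R.sign * h) y) b := by
  have hε := H.pos
  have hM := H.smooth.nonneg
  have hS1 : 1 ≤ S + 1 := by linarith
  have ha : 0 ≤ C * (η + ε) := by positivity
  have hM'le : ∀ a, a ≤ 2 * (M + 1) ^ 2 → a ≤ M' := fun a ha => by
    rw [hM']
    exact ha.trans (le_mul_of_one_le_right (by positivity) hS1)
  have hMM' : M ≤ M' := hM'le _ (by nlinarith)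
  have hMM2 : (M ^ 2 + M) * ε ≤ M' * ε := by
    gcongr
    exact hM'le _ (by nlinarith)
  have hM'0 : 0 < M' := by rw [hM']; positivity
  have hsub : Icc 0 Λ ⊆ Icc 0 (S + 2 * Λ) := Icc_subset_Icc_right (by linarith)
  have had : C * (η + ε) ≤ d := by
    have h2 : 0 ≤ 2 * M' * ε * (S + 1) + ε ^ 2 * (S + 1) := by positivity
    linarith
  refine ⟨H.le_one, hS, hM'0, by cases R <;> simp [Regime.sign], ha, h1, fun t ξ => ?_,
    continuous_eval ε κ H.smooth.continuous_x, ?_, fun h t ξ => ?_,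
    fun t ξ => ?_, fun t ξ => ?_, fun T hT ξ h hh => ?_,
    fun s hs ξ hξ => (hΘ s hs ξ hξ).1, fun s hs ξ hξ => ?_, fun x hx u hu => hB x (hsub hx) u hu,
    fun x hx x' hx' u hu u' hu' => hmod x (hsub hx) x' (hsub hx') u hu u' hu', hd⟩
  · refine (H.drift t ξ).trans ?_
    rw [mul_comm]
    gcongr
  · cases R
    · exact H.smooth.continuous_x.comp (by fun_prop : Continuous fun p : ℝ × ℝ × ℝ =>
        (p.2.2 / ε ^ 2 + Regime.slow.sign * p.1, p.2.1 / κ))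
    · exact H.smooth.continuous_x.comp (by fun_prop : Continuous fun p : ℝ × ℝ × ℝ =>
        (p.2.1 / ε ^ 2 + Regime.rapid.sign * p.1, p.2.2 / κ))
  · exact (abs_eval_le (fun x y => H.smooth.bound_x _ _) t ξ).trans hMM'
  · exact ((H.abs_coupling_sub_le t ξ).1).trans hMM2
  · exact ((H.abs_coupling_sub_le t ξ).2).trans hMM2
  · refine (H.abs_eval_left_le hT ξ hh).trans ?_
    rw [hM']
    exact mul_le_mul_of_nonneg_right (mul_le_mul_of_nonneg_right (by nlinarith) (by positivity))
      hε.le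
  · exact H.average hS.le ha hη (fun s hs ξ hξ => (hΘ s hs ξ hξ).2) hk hkM hb hB
      (fun x hx x' hx' u hu hxx => hmod x hx x' hx' u hu u hu hxx (by
        rw [sub_self, abs_zero]; exact ha.trans had)) had hZ hs hξ

end IsMediumFlow

/-! ### From the acoustic equations to the transport system -/

section Acoustics

/-- Derivative of a function of time and range along a curve `t = T(ξ)`, `z = c₀ ξ`. -/
theorem hasDerivAt_along {g : ℝ → ℝ → ℝ} {T : ℝ → ℝ} {c₀ v ξ : ℝ}
    (hg : DifferentiableAt ℝ (fun x : ℝ × ℝ => g x.1 x.2) (T ξ, c₀ * ξ))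
    (hT : HasDerivAt T v ξ) : HasDerivAt (fun x => g (T x) (c₀ * x))
      (timeDeriv g (T ξ) (c₀ * ξ) * v + rangeDeriv g (T ξ) (c₀ * ξ) * c₀) ξ := by
  have hz : HasDerivAt (fun x => c₀ * x) c₀ ξ := by
    simpa using (hasDerivAt_id ξ).const_mul c₀
  have := (hasFDerivAt_of_differentiableAt hg).1.comp_hasDerivAt (f := fun x => (T x, c₀ * x)) ξ
    (hT.prodMk hz)
  exact this.congr_deriv (by simp)

theorem hasDerivAt_sqrt_div {W : ℝ → ℝ} {W' Z ξ : ℝ} (hZ : 0 < Z) (hW0 : 0 < W ξ)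
    (hW : HasDerivAt W W' ξ) :
    HasDerivAt (fun x => √(Z / W x)) (-(√(Z / W ξ) * (W' / (2 * W ξ)))) ξ := by
  have h0 : 0 < Z / W ξ := div_pos hZ hW0
  have h1 : HasDerivAt (fun x => Z / W x) (-(Z * W') / W ξ ^ 2) ξ := by
    exact ((hasDerivAt_const ξ Z).div hW hW0.ne').congr_deriv (by simp)
  refine (h1.sqrt h0.ne').congr_deriv ?_
  have hq := Real.sqrt_pos.2 h0
  have hs := Real.sq_sqrt h0.le
  rw [div_eq_iff (by positivity)]
  have : -(√(Z / W ξ) * (W' / (2 * W ξ))) * (2 * √(Z / W ξ)) =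
      -(√(Z / W ξ) ^ 2 * (W' / W ξ)) := by field_simp
  rw [this, hs]
  field_simp

/-- The right and left going waves satisfy the transport equations along the characteristics. -/
theorem IsAcousticWave.transport {ρ L c₀ : ℝ} {c p u : ℝ → ℝ → ℝ} {g : ℝ → ℝ}
    (hw : IsAcousticWave ρ L c g p u) (hρ : 0 < ρ) (hc₀ : 0 < c₀) {w : ℝ → ℝ → ℝ}
    (hwpos : ∀ t ξ, 0 < w t ξ) (hcw : ∀ t ξ, c t (c₀ * ξ) = c₀ / w t ξ) {T : ℝ → ℝ}
    {ξ W' : ℝ} (hξ : ξ ∈ Ioo 0 (L / c₀)) (hW : HasDerivAt (fun x => w (T x) x) W' ξ) :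
    (HasDerivAt T (w (T ξ) ξ) ξ → HasDerivAt (fun x => rightGoing ρ c p u (T x) (c₀ * x))
      (-(W' / (2 * w (T ξ) ξ) * leftGoing ρ c p u (T ξ) (c₀ * ξ))) ξ) ∧
    (HasDerivAt T (-w (T ξ) ξ) ξ → HasDerivAt (fun x => leftGoing ρ c p u (T x) (c₀ * x))
      (-(W' / (2 * w (T ξ) ξ) * rightGoing ρ c p u (T ξ) (c₀ * ξ))) ξ) := by
  have hz : c₀ * ξ ∈ Ioo 0 L := ⟨mul_pos hc₀ hξ.1, by
    have := (lt_div_iff₀ hc₀).1 hξ.2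
    linarith⟩
  have hopen : (univ : Set ℝ) ×ˢ Ioo 0 L ∈ 𝓝 (T ξ, c₀ * ξ) :=
    (isOpen_univ.prod isOpen_Ioo).mem_nhds ⟨trivial, hz⟩
  have hp := hw.differentiable_p.differentiableAt hopen
  have hu := hw.differentiable_u.differentiableAt hopen
  have hw0 := hwpos (T ξ) ξ
  have hZ : 0 < ρ * c₀ := mul_pos hρ hc₀
  have hq : ∀ t x, √(ρ * c t (c₀ * x)) = √(ρ * c₀ / w t x) := fun t x => by
    rw [hcw, mul_div_assoc]
  have hqd := hasDerivAt_sqrt_div (W := fun x => w (T x) x) hZ hw0 hW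
  have hq0 : 0 < √(ρ * c₀ / w (T ξ) ξ) := Real.sqrt_pos.2 (div_pos hZ hw0)
  have hqs : √(ρ * c₀ / w (T ξ) ξ) ^ 2 = ρ * c₀ / w (T ξ) ξ := Real.sq_sqrt (div_pos hZ hw0).le
  have hmom := hw.momentum (T ξ) _ hz
  have hmass := hw.mass (T ξ) _ hz
  rw [hcw] at hmass
  simp only [rightGoing, leftGoing, hq]
  set q := √(ρ * c₀ / w (T ξ) ξ) with hqdef
  set W := w (T ξ) ξ with hWdef
  set pt := timeDeriv p (T ξ) (c₀ * ξ)
  set ut := timeDeriv u (T ξ) (c₀ * ξ)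
  have hpz : rangeDeriv p (T ξ) (c₀ * ξ) = -(ρ * ut) := by linarith
  have huz : rangeDeriv u (T ξ) (c₀ * ξ) = -((ρ * (c₀ / W) ^ 2)⁻¹ * pt) := by linarith
  have hZq : ρ * c₀ = q ^ 2 * W := by rw [hqs]; field_simp
  have hρq : ρ = q ^ 2 * W / c₀ := by rw [← hZq]; field_simp
  have huz' : rangeDeriv u (T ξ) (c₀ * ξ) * c₀ = -(W / q ^ 2 * pt) := by
    rw [huz, hρq]
    field_simp
  have hpz' : rangeDeriv p (T ξ) (c₀ * ξ) * c₀ = -(q ^ 2 * W * ut) := by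
    rw [hpz, ← hZq]
    ring
  refine ⟨fun hT => ?_, fun hT => ?_⟩
  · have h1 := hasDerivAt_along hp hT
    have h2 := hasDerivAt_along hu hT
    rw [hpz'] at h1
    rw [huz'] at h2
    refine (((hqd.inv hq0.ne').mul h1).add (hqd.mul h2)).congr_deriv ?_
    simp only [Pi.inv_apply]
    simp only [← hqdef, ← hWdef]
    field_simp
    ring
  · have h1 := hasDerivAt_along hp hT
    have h2 := hasDerivAt_along hu hT
    rw [hpz'] at h1
    rw [huz'] at h2
    refine (((hqd.inv hq0.ne').neg.mul h1).add (hqd.mul h2)).congr_deriv ?_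
    simp only [Pi.inv_apply, Pi.neg_apply]
    simp only [← hqdef, ← hWdef]
    field_simp
    ring

/-- The right going characteristics as solutions of a differential equation. -/
theorem IsTravelTime.eq_flow {L c₀ t₀ k : ℝ} {c : ℝ → ℝ → ℝ} {θ : ℝ → ℝ}
    (hθ : IsTravelTime L c t₀ θ) (hL : 0 ≤ L) (hc₀ : 0 < c₀) {w : ℝ → ℝ → ℝ}
    (hwc : Continuous fun x : ℝ × ℝ => w x.1 x.2)
    (hcw : ∀ t z, (c t z)⁻¹ = w t (z / c₀) / c₀) (hk : 1 ≤ k)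
    (hlip : ∀ t t' ξ, |w t ξ - w t' ξ| ≤ k * |t - t'|) {Θ : ℝ → ℝ}
    (hΘ : ∀ ξ, HasDerivAt Θ (w (Θ ξ) ξ) ξ) (h0 : Θ 0 = t₀) {ξ : ℝ} (hξ : ξ ∈ Icc 0 (L / c₀)) :
    θ (c₀ * ξ) = Θ ξ := by
  obtain ⟨hcont, heq⟩ := hθ
  have hmem : ∀ x ∈ Icc 0 (L / c₀), c₀ * x ∈ Icc 0 L := fun x hx =>
    ⟨mul_nonneg hc₀.le hx.1, by have := (le_div_iff₀ hc₀).1 hx.2; linarith⟩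
  -- a continuous extension of the travel time beyond `[0, L]`
  set θe : ℝ → ℝ := fun z => θ (projIcc 0 L hL z) with hθe
  have hθec : Continuous θe :=
    (continuousOn_iff_continuous_domRestrict.1 hcont).comp continuous_projIcc
  have hθeq : ∀ z ∈ Icc 0 L, θe z = θ z := fun z hz => by
    simp only [hθe, projIcc_of_mem hL hz]
  have hgc : Continuous fun z => (c (θe z) z)⁻¹ := by
    simp only [hcw]
    exact (hwc.comp (by fun_prop : Continuous fun z => (θe z, z / c₀))).div_const c₀
  set Y : ℝ → ℝ := fun x => t₀ + ∫ z in (0 : ℝ)..(c₀ * x), (c (θe z) z)⁻¹ with hY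
  have hYeq : ∀ x ∈ Icc 0 (L / c₀), Y x = θ (c₀ * x) := fun x hx => by
    rw [heq _ (hmem x hx)]
    simp only [hY]
    congr 1
    refine intervalIntegral.integral_congr fun z hz => ?_
    rw [uIcc_of_le (hmem x hx).1] at hz
    simp only [hθeq z ⟨hz.1, hz.2.trans (hmem x hx).2⟩]
  have hYd : ∀ x ∈ Icc 0 (L / c₀), HasDerivAt Y (w (Y x) x) x := fun x hx => by
    have h1 := (hgc.integral_hasStrictDerivAt 0 (c₀ * x)).hasDerivAt
    have h2 : HasDerivAt (fun x => c₀ * x) c₀ x := by simpa using (hasDerivAt_id x).const_mul c₀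
    refine ((h1.comp x h2).const_add t₀).congr_deriv ?_
    rw [hYeq x hx, hθeq _ (hmem x hx), hcw, mul_div_cancel_left₀ _ hc₀.ne',
      div_mul_cancel₀ _ hc₀.ne']
  have := abs_le_of_abs_deriv_le (v := fun x => Y x - Θ x)
    (v' := fun x => w (Y x) x - w (Θ x) x) (K := k) (e := 0) hk le_rfl
    (fun x hx => (hYd x hx).sub (hΘ x)) (fun x _ => by
      rw [add_zero]; exact hlip _ _ _) hξ
  have hY0 : Y 0 = t₀ := by simp [hY]
  rw [hY0, h0, sub_self, abs_zero, add_zero, zero_mul] at this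
  have h3 := abs_nonpos_iff.1 this
  rw [← hYeq ξ hξ]
  linarith

/-- The correlation scale of the medium in the coordinate other than that of decorrelation. -/
def Regime.scale (R : Regime) (α β ε : ℝ) : ℝ :=
  match R with
  | .slow => ε ^ α
  | .rapid => ε ^ β

theorem Regime.Exponents.le_scale {R : Regime} {α β ε : ℝ} (h : R.Exponents α β) (hε : 0 < ε)
    (h1 : ε ≤ 1) : ε ≤ R.scale α β ε := by
  cases R with
  | slow =>
    have := Real.rpow_le_rpow_of_exponent_ge hε h1 h.2.1
    rwa [Real.rpow_one] at this
  | rapid =>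
    have := Real.rpow_le_rpow_of_exponent_ge hε h1 h.2.2
    rwa [Real.rpow_one] at this

theorem Regime.Exponents.localSpeed_eq {R : Regime} {α β c₀ ε : ℝ} (h : R.Exponents α β)
    (m : ℝ → ℝ → ℝ) (t ξ : ℝ) :
    localSpeed c₀ α β ε m t (c₀ * ξ) =
      c₀ / R.slowness ε (R.scale α β ε) (R.unitField c₀ m) t ξ := by
  cases R with
  | slow =>
    obtain ⟨_, _, rfl⟩ := h
    simp only [localSpeed, Regime.slowness, Regime.eval, Regime.unitField, Regime.scale,
      div_eq_mul_inv, Real.rpow_two, mul_assoc]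
  | rapid =>
    obtain ⟨rfl, _, _⟩ := h
    simp only [localSpeed, Regime.slowness, Regime.eval, Regime.unitField, Regime.scale,
      div_eq_mul_inv, Real.rpow_two, mul_assoc]

/-- The right going characteristics in one realization of the medium exist globally. -/
theorem exists_isMediumFlow (R : Regime) {M ε κ : ℝ} {n nx ny : ℝ → ℝ → ℝ}
    (N : IsSmoothField M n nx ny) (hε : 0 < ε) (hεκ : ε ≤ κ) (h1 : ε ≤ 1) (hM : ε * M ≤ 1 / 2) :
    ∃ Θ, IsMediumFlow R M ε κ n nx ny Θ ∧
      ∀ t t' ξ, |R.slowness ε κ n t ξ - R.slowness ε κ n t' ξ| ≤ (M / ε + 1) * |t - t'| := by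
  have hκ : 0 < κ := hε.trans_le hεκ
  have hM0 := N.nonneg
  have hlip : ∀ t t' ξ, |R.slowness ε κ n t ξ - R.slowness ε κ n t' ξ| ≤
      (M / ε + 1) * |t - t'| := fun t t' ξ => by
    have h0 : 0 ≤ |t - t'| := abs_nonneg _
    suffices h : |R.slowness ε κ n t ξ - R.slowness ε κ n t' ξ| ≤ M / ε * |t - t'| by linarith
    rw [Regime.slowness, Regime.slowness, add_sub_add_left_eq_sub, ← mul_sub, abs_mul,
      abs_of_pos hε]
    cases R with
    | slow =>
      have := N.abs_sub_le_y (ξ / ε ^ 2) (t / κ) (t' / κ)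
      rw [← sub_div, abs_div, abs_of_pos hκ] at this
      have h2 : |t - t'| / κ ≤ |t - t'| / ε := by gcongr
      calc _ ≤ 1 * (M * (|t - t'| / ε)) := by
            refine mul_le_mul h1 (this.trans ?_) (abs_nonneg _) zero_le_one
            gcongr
        _ = _ := by ring
    | rapid =>
      have := N.abs_sub_le_x (t / ε ^ 2) (t' / ε ^ 2) (ξ / κ)
      rw [← sub_div, abs_div, abs_of_pos (by positivity : 0 < ε ^ 2)] at this
      calc _ ≤ ε * (M * (|t - t'| / ε ^ 2)) := mul_le_mul_of_nonneg_left this hε.le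
        _ = _ := by field_simp
  have hc : Continuous fun p : ℝ × ℝ => R.slowness ε κ n p.1 p.2 :=
    continuous_const.add (continuous_const.mul (IsMediumFlow.continuous_eval ε κ N.continuous))
  have hex : ∀ s : ℝ, ∃ T : ℝ → ℝ, T 0 = ε ^ 2 * s ∧
      ∀ ξ, HasDerivAt T (R.slowness ε κ n (T ξ) ξ) ξ := fun s =>
    exists_forall_hasDerivAt (F := fun ξ t => R.slowness ε κ n t ξ)
      (K := Real.toNNReal (M / ε + 1)) (C := 3 / 2)
      (fun t => hc.comp (by fun_prop : Continuous fun ξ : ℝ => (t, ξ)))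
      (fun ξ => LipschitzWith.of_dist_le_mul fun t t' => by
        rw [Real.coe_toNNReal _ (by positivity), Real.dist_eq, Real.dist_eq]
        exact hlip t t' ξ)
      (fun ξ t => by
        have h2 : |ε * R.eval ε κ n t ξ| ≤ 1 / 2 := by
          rw [abs_mul, abs_of_pos hε]
          exact (mul_le_mul_of_nonneg_left (IsMediumFlow.abs_eval_le N.bound t ξ) hε.le).trans hM
        refine (abs_add_le _ _).trans ?_
        rw [abs_one]
        linarith) 0 _
  choose Θ h0 hd using hex
  exact ⟨Θ, ⟨N, hε, hεκ, h1, hM, hd, h0⟩, hlip⟩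

theorem IsMediumFlow.isFrontSystem {R : Regime} {M ε κ : ℝ} {n nx ny Θ : ℝ → ℝ → ℝ}
    (H : IsMediumFlow R M ε κ n nx ny Θ) {k : ℝ}
    (hlip : ∀ t t' ξ, |R.slowness ε κ n t ξ - R.slowness ε κ n t' ξ| ≤ k * |t - t'|)
    {ρ L c₀ M' : ℝ} (hρ : 0 < ρ) (hc₀ : 0 < c₀) (hL : 0 < L) (hM' : M ^ 2 + 2 * M ≤ M')
    {c p u : ℝ → ℝ → ℝ} {f : ℝ → ℝ} (hf : ∀ s ≤ 0, f s = 0)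
    (hw : IsAcousticWave ρ L c (fun t => f (t / ε ^ 2)) p u)
    (hcw : ∀ t ξ, c t (c₀ * ξ) = c₀ / R.slowness ε κ n t ξ) :
    IsFrontSystem (L / c₀) ε (M' / ε) f (R.slowness ε κ n) (R.coupling ε κ n nx ny 1)
      (R.coupling ε κ n nx ny (-1)) (fun t ξ => rightGoing ρ c p u t (c₀ * ξ))
      (fun t ξ => leftGoing ρ c p u t (c₀ * ξ)) Θ := by
  have hε := H.pos
  have hwpos : ∀ t ξ, 0 < R.slowness ε κ n t ξ := fun t ξ => by linarith [H.half_le t ξ]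
  have hk0 : 0 ≤ k := by
    have := (abs_nonneg _).trans (hlip 1 0 0)
    simpa using this
  have hle : (M ^ 2 + 2 * M) / ε ≤ M' / ε := by gcongr
  have hmem : ∀ ξ ∈ Icc 0 (L / c₀), c₀ * ξ ∈ Icc 0 L := fun ξ hξ =>
    ⟨mul_nonneg hc₀.le hξ.1, by have := (le_div_iff₀ hc₀).1 hξ.2; linarith⟩
  have hmaps : MapsTo (fun x : ℝ × ℝ => (x.1, c₀ * x.2)) (univ ×ˢ Icc 0 (L / c₀))
      (univ ×ˢ Icc 0 L) := fun x hx => ⟨trivial, hmem _ hx.2⟩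
  have hp : ContinuousOn (fun x : ℝ × ℝ => p x.1 (c₀ * x.2)) (univ ×ˢ Icc 0 (L / c₀)) :=
    hw.continuous_p.comp (f := fun x : ℝ × ℝ => (x.1, c₀ * x.2)) (by fun_prop) hmaps
  have hu : ContinuousOn (fun x : ℝ × ℝ => u x.1 (c₀ * x.2)) (univ ×ˢ Icc 0 (L / c₀)) :=
    hw.continuous_u.comp (f := fun x : ℝ × ℝ => (x.1, c₀ * x.2)) (by fun_prop) hmaps
  have hqpos : ∀ t ξ, 0 < √(ρ * c t (c₀ * ξ)) := fun t ξ => by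
    rw [hcw]
    exact Real.sqrt_pos.2 (mul_pos hρ (div_pos hc₀ (hwpos t ξ)))
  have hq : Continuous fun x : ℝ × ℝ => √(ρ * c x.1 (c₀ * x.2)) := by
    simp only [hcw]
    exact (continuous_const.mul (continuous_const.div H.continuous_slowness
      fun x => (hwpos _ _).ne')).sqrt
  have hqi : Continuous fun x : ℝ × ℝ => (√(ρ * c x.1 (c₀ * x.2)))⁻¹ :=
    hq.inv₀ fun x => (hqpos _ _).ne'
  refine ⟨hε, div_pos hL hc₀, H.continuous_slowness, ⟨Real.toNNReal k, fun ξ =>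
    LipschitzWith.of_dist_le_mul fun t t' => ?_⟩, H.near_one, H.continuous_coupling 1,
    H.continuous_coupling (-1), fun t ξ => ((H.abs_coupling_le t ξ).1).trans hle,
    fun t ξ => ((H.abs_coupling_le t ξ).2).trans hle, ?_, ?_, fun T ξ hξ hT => ?_,
    fun T ξ hξ hT => ?_, fun t ht ξ hξ => ?_, fun t => ?_, fun t => ?_, hf, H.flow, H.flow_zero⟩
  · rw [Real.coe_toNNReal _ hk0, Real.dist_eq, Real.dist_eq]
    exact hlip t t' ξ
  · exact (hqi.continuousOn.mul hp).add (hq.continuousOn.mul hu)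
  · exact (hqi.continuousOn.neg.mul hp).add (hq.continuousOn.mul hu)
  · have hW := hasDerivAt_slowness (R := R) (ε := ε) (κ := κ) H.smooth hT
    refine ((hw.transport hρ hc₀ hwpos hcw hξ hW).1 hT).congr_deriv ?_
    rw [Regime.coupling, one_mul]
  · have hW := hasDerivAt_slowness (R := R) (ε := ε) (κ := κ) H.smooth hT
    refine ((hw.transport hρ hc₀ hwpos hcw hξ hW).2 hT).congr_deriv ?_
    rw [Regime.coupling, neg_one_mul]
  · obtain ⟨h1, h2⟩ := hw.quiescent t ht _ (hmem ξ hξ)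
    simp [rightGoing, leftGoing, h1, h2]
  · simpa using hw.incoming t
  · have := hw.outgoing t
    rwa [mul_div_cancel₀ _ hc₀.ne']

end Acoustics

/-! ### Convergence of the wave front -/

/-- In each realization, the wave front of the acoustic equations is the right going wave of a
transport system along its characteristics. -/
theorem exists_isFrontSystem {R : Regime} {α β c₀ ρ L S M M' ε : ℝ} (hαβ : R.Exponents α β)
    {m : ℝ → ℝ → ℝ} (N : IsSmoothField M (R.unitField c₀ m) (R.unitFieldX c₀ m)
      (R.unitFieldY c₀ m)) (hε : 0 < ε) (h1 : ε ≤ 1) (hM : ε * M ≤ 1 / 2) (hρ : 0 < ρ)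
    (hc₀ : 0 < c₀) (hL : 0 < L) (hM' : M ^ 2 + 2 * M ≤ M') {f : ℝ → ℝ} (hf : ∀ s ≤ 0, f s = 0)
    {p u θ : ℝ → ℝ → ℝ}
    (hw : IsAcousticWave ρ L (localSpeed c₀ α β ε m) (fun t => f (t / ε ^ 2)) p u)
    (hθ : ∀ s ∈ Icc 0 S, IsTravelTime L (localSpeed c₀ α β ε m) (ε ^ 2 * s) (θ s)) :
    ∃ Θ, IsMediumFlow R M ε (R.scale α β ε) (R.unitField c₀ m) (R.unitFieldX c₀ m)
        (R.unitFieldY c₀ m) Θ ∧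
      IsFrontSystem (L / c₀) ε (M' / ε) f (R.slowness ε (R.scale α β ε) (R.unitField c₀ m))
        (R.coupling ε (R.scale α β ε) (R.unitField c₀ m) (R.unitFieldX c₀ m)
          (R.unitFieldY c₀ m) 1)
        (R.coupling ε (R.scale α β ε) (R.unitField c₀ m) (R.unitFieldX c₀ m)
          (R.unitFieldY c₀ m) (-1))
        (fun t ξ => rightGoing ρ (localSpeed c₀ α β ε m) p u t (c₀ * ξ))
        (fun t ξ => leftGoing ρ (localSpeed c₀ α β ε m) p u t (c₀ * ξ)) Θ ∧
      ∀ τ ∈ Icc 0 (L / c₀), ∀ s ∈ Icc 0 S,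
        waveFront c₀ ρ (localSpeed c₀ α β ε m) p u θ τ s =
          rightGoing ρ (localSpeed c₀ α β ε m) p u (Θ s τ) (c₀ * τ) := by
  obtain ⟨Θ, H, hlip⟩ := exists_isMediumFlow R N hε (hαβ.le_scale hε h1) h1 hM
  have hcw := hαβ.localSpeed_eq (c₀ := c₀) (ε := ε) m
  refine ⟨Θ, H, H.isFrontSystem hlip hρ hc₀ hL hM' hf hw hcw, fun τ hτ s hs => ?_⟩
  have hM0 := N.nonneg
  rw [waveFront, (hθ s hs).eq_flow hL.le hc₀ H.continuous_slowness (k := M / ε + 1)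
    (fun t z => ?_) (le_add_of_nonneg_left (by positivity)) hlip (H.flow s) (H.flow_zero s) hτ]
  have := hcw t (z / c₀)
  rw [mul_div_cancel₀ _ hc₀.ne'] at this
  rw [this, inv_div]

theorem exists_pos_forall_lt {E : ℝ × ℝ → ℝ} (hE : Continuous E) {δ : ℝ} (h0 : E (0, 0) < δ) :
    ∃ r > 0, ∀ x y, |x| ≤ r → |y| ≤ r → E (x, y) < δ := by
  obtain ⟨r, hr, h⟩ := Metric.eventually_nhds_iff.1
    (hE.continuousAt.eventually_lt (continuousAt_const (y := δ)) h0)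
  refine ⟨r / 2, by positivity, fun x y hx hy => h ?_⟩
  rw [Prod.dist_eq, Real.dist_eq, Real.dist_eq, sub_zero, sub_zero]
  exact max_lt (by linarith) (by linarith)

/-- The deterministic statement behind the convergence: if the three averages of the medium are
small, then the wave front is uniformly close to its limit. -/
theorem exists_threshold (R : Regime) {c₀ ρ L S M δ α β : ℝ} {k f : ℝ → ℝ} {b : ℝ → ℝ → ℝ}
    (hαβ : R.Exponents α β) (hρ : 0 < ρ) (hc₀ : 0 < c₀) (hL : 0 < L) (hS : 0 < S) (hM : 0 ≤ M)
    (hδ : 0 < δ) (hf : ∀ s ≤ 0, f s = 0) (P : IsProfile S k f b) (hkM : ∀ h, |k h| ≤ M * M) :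
    ∃ η > 0, ∃ r > 0, ∀ ε, 0 < ε → ε ≤ r → ∀ {m p u θ : ℝ → ℝ → ℝ},
      IsSmoothField M (R.unitField c₀ m) (R.unitFieldX c₀ m) (R.unitFieldY c₀ m) →
      IsAcousticWave ρ L (localSpeed c₀ α β ε m) (fun t => f (t / ε ^ 2)) p u →
      (∀ s ∈ Icc 0 S, IsTravelTime L (localSpeed c₀ α β ε m) (ε ^ 2 * s) (θ s)) →
      (∀ r ∈ Icc 0 (S + 2 * (L / c₀)), |∫ x in (0 : ℝ)..r,
        R.unitField c₀ m (x / ε ^ 2) (x / R.scale α β ε)| ≤ η) →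
      (∀ r ∈ Icc 0 (S + 2 * (L / c₀)), |∫ x in (0 : ℝ)..r,
        R.unitFieldY c₀ m (x / ε ^ 2) (x / R.scale α β ε)| ≤ η) →
      (∀ r ∈ Icc 0 (S + 2 * (L / c₀)), ∀ s ∈ Icc 0 S,
        |∫ x in (0 : ℝ)..r, ∫ h in (0 : ℝ)..(S + 1),
          (R.sign * (R.unitFieldX c₀ m (x / ε ^ 2) (x / R.scale α β ε) *
            R.unitFieldX c₀ m (x / ε ^ 2 + R.sign * h) (x / R.scale α β ε)) - k h) *
            b x (s - 2 * h)| ≤ η) →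
      ∀ τ ∈ Icc 0 (L / c₀), ∀ s ∈ Icc 0 S,
        |waveFront c₀ ρ (localSpeed c₀ α β ε m) p u θ τ s - b τ s| < δ := by
  set Λ := L / c₀ with hΛ
  have hΛ0 : 0 < Λ := div_pos hL hc₀
  obtain ⟨C, hC, hflow⟩ := R.exists_flow_bound hM hS.le hΛ0.le
  set D : Set (ℝ × ℝ) := Icc 0 (S + 2 * Λ) ×ˢ Icc (-(2 * (S + 1))) S with hD
  have hDc : IsCompact D := isCompact_Icc.prod isCompact_Icc
  obtain ⟨B, hB⟩ := hDc.exists_bound_of_continuousOn P.continuous.continuousOn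
  set M' := 2 * (M + 1) ^ 2 * (S + 1) with hM'
  have hMM' : M ^ 2 + 2 * M ≤ M' := by
    have h1 : M ^ 2 + 2 * M ≤ 2 * (M + 1) ^ 2 := by nlinarith
    exact h1.trans (le_mul_of_one_le_right (by positivity) (by linarith))
  -- the error as a function of `η`, `ε` and the oscillation `o` of the profile
  set E : ℝ → ℝ → ℝ → ℝ := fun η ε o =>
    2 * (2 * η + Λ * (S + 1) * (2 * (M * M) * (C * (η + ε) * B + o + M * ε * B)) +
      4 * M' ^ 2 * (S + 1) * (Λ * (2 * (ε * B) + o)) +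
      ε ^ 2 * (S + 1) * (M' ^ 2 * B * (S + 1))) *
      Real.exp (4 * (4 * M' ^ 2 * (S + 1)) * (S + 2 * Λ)) with hE
  obtain ⟨o, ho, hEo⟩ := exists_pos_forall_lt (E := fun x => E 0 0 x.1) (by fun_prop)
    (δ := δ) (by simpa [hE] using hδ)
  obtain ⟨d, hd, hmod⟩ := Metric.uniformContinuousOn_iff.1
    (hDc.uniformContinuousOn_of_continuous P.continuous.continuousOn) o ho
  obtain ⟨r₁, hr₁, h₁⟩ := exists_pos_forall_lt (E := fun x => E x.1 x.2 o) (by fun_prop)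
    (δ := δ) (hEo o 0 (abs_of_pos ho).le (by simpa using ho.le))
  obtain ⟨r₂, hr₂, h₂⟩ := exists_pos_forall_lt (E := fun x => C * (x.1 + x.2)) (by fun_prop)
    (δ := 1) (by simp)
  obtain ⟨r₃, hr₃, h₃⟩ := exists_pos_forall_lt
    (E := fun x => 2 * (C * (x.1 + x.2)) + 2 * M' * x.2 * (S + 1) + x.2 ^ 2 * (S + 1))
    (by fun_prop) (δ := d / 2) (by simpa using hd)
  obtain ⟨r₄, hr₄, h₄⟩ := exists_pos_forall_lt (E := fun x => x.1 * M) (by fun_prop)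
    (δ := 1 / 2) (by simp)
  set r := min (min r₁ r₂) (min (min r₃ r₄) (1 / 2)) with hr
  have hr0 : 0 < r := by positivity
  have l₁ : r ≤ r₁ := (min_le_left _ _).trans (min_le_left _ _)
  have l₂ : r ≤ r₂ := (min_le_left _ _).trans (min_le_right _ _)
  have l₃ : r ≤ r₃ := (min_le_right _ _).trans ((min_le_left _ _).trans (min_le_left _ _))
  have l₄ : r ≤ r₄ := (min_le_right _ _).trans ((min_le_left _ _).trans (min_le_right _ _))
  have l₅ : r ≤ 1 / 2 := (min_le_right _ _).trans (min_le_right _ _)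
  refine ⟨r, hr0, r, hr0, fun ε hε hεr m p u θ N hw hθ a₁ a₂ a₃ τ hτ s hs => ?_⟩
  have hr' : |r| ≤ r := (abs_of_pos hr0).le
  have hε' : |ε| ≤ r := by rwa [abs_of_pos hε]
  obtain ⟨Θ, F, H, hfront⟩ := exists_isFrontSystem hαβ N hε (by linarith)
    (h₄ ε ε (hε'.trans l₄) (hε'.trans l₄)).le hρ hc₀ hL hMM' hf hw hθ
  have Q := F.isFrontApprox hM' hS hΛ0.le hC hr0.le (hflow F hr0.le l₅ a₁ a₂)
    P.continuous_kernel hkM P.continuous (B := B) (d := d / 2) (ωd := o)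
    (fun x hx v hv => hB (x, v) ⟨hx, hv⟩)
    (fun x hx x' hx' v hv v' hv' hxx hvv => (hmod (x, v) ⟨hx, hv⟩ (x', v') ⟨hx', hv'⟩ (by
      rw [Prod.dist_eq, Real.dist_eq, Real.dist_eq]
      exact max_lt (by linarith) (by linarith))).le)
    (h₂ r ε (hr'.trans l₂) (hε'.trans l₂)).le (h₃ r ε (hr'.trans l₃) (hε'.trans l₃)).le a₃
  rw [hfront τ hτ s hs]
  exact (Q.front_error H P hs hτ).trans_lt (h₁ r ε (hr'.trans l₁) (hε'.trans l₁))

end PulseFront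

end

open PulseFront in
theorem theorem1
    {Ω : Type*} [MeasurableSpace Ω] (P : Measure Ω) [IsProbabilityMeasure P]
    -- the scaling regime and its exponents
    (R : Regime) (α β : ℝ) (hαβ : R.Exponents α β)
    -- reference speed, density, final range, final travel time, pulse duration
    (c₀ ρ L T S : ℝ) (hc₀ : 0 < c₀) (hρ : 0 < ρ) (hT : 0 < T) (hS : 0 < S) (hL : c₀ * T ≤ L)
    -- the pulse
    (f : ℝ → ℝ) (hf : ContDiff ℝ 1 f) (hfS : Function.support f ⊆ Icc 0 S)
    -- the random medium
    (μ : ℝ → ℝ → Ω → ℝ) (hμ : IsRandomMedium R P μ)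
    -- for every small `ε` and every realization: the wave speed, pressure and displacement
    -- fields, and the travel time `θ ε ω s z`
    (c : ℝ → Ω → ℝ → ℝ → ℝ)
    (hc : ∀ ε ω, c ε ω = localSpeed c₀ α β ε (fun t z => μ t z ω))
    (p u : ℝ → Ω → ℝ → ℝ → ℝ)
    (hpu : ∀ᶠ ε in 𝓝[>] (0 : ℝ), ∀ ω,
      IsAcousticWave ρ L (c ε ω) (fun t => f (t / ε ^ 2)) (p ε ω) (u ε ω))
    (θ : ℝ → Ω → ℝ → ℝ → ℝ)
    (hθ : ∀ᶠ ε in 𝓝[>] (0 : ℝ), ∀ ω, ∀ s ∈ Icc 0 S,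
      IsTravelTime L (c ε ω) (ε ^ 2 * s) (θ ε ω s))
    -- the wave front
    (a : ℝ → Ω → ℝ → ℝ → ℝ)
    (ha : ∀ ε ω, a ε ω = waveFront c₀ ρ (c ε ω) (p ε ω) (u ε ω) (θ ε ω))
    -- the kernel
    (Ψ : ℝ → ℝ) (hΨ : Ψ = R.kernel c₀ (autocorr P μ)) :
    ∃ abar : ℝ → ℝ → ℝ,
      -- `abar` is the unique continuous solution of the limit problem
      SolvesLimitProblem c₀ S Ψ f abar ∧
      (∀ b : ℝ → ℝ → ℝ, SolvesLimitProblem c₀ S Ψ f b →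
        ∀ τ ≥ 0, ∀ s ∈ Icc 0 S, b τ s = abar τ s) ∧
      -- the explicit Fourier representation, with absolutely convergent integrals
      IntegrableOn Ψ (Ioi 0) ∧
      (∀ τ ≥ 0, ∀ s ∈ Icc 0 S,
        Integrable (fourierIntegrand c₀ Ψ f τ s) ∧
          (abar τ s : ℂ) = ∫ w : ℝ, fourierIntegrand c₀ Ψ f τ s w) ∧
      -- the wave front is continuous and converges to `abar` in probability, uniformly
      (∀ᶠ ε in 𝓝[>] (0 : ℝ), ∀ ω,
        ContinuousOn (fun x : ℝ × ℝ => a ε ω x.1 x.2) (Icc 0 T ×ˢ Icc 0 S)) ∧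
      (∀ δ > 0, Tendsto
        (fun ε => P {ω | ∃ τ ∈ Icc 0 T, ∃ s ∈ Icc 0 S, δ ≤ |a ε ω τ s - abar τ s|})
        (𝓝[>] (0 : ℝ)) (𝓝 0)) := by
  obtain ⟨M, d, H⟩ := isMixingMedium_unitField hc₀ hμ
  rw [← hΨ] at H
  have hk : Ψ = fun h => (c₀ ^ 2)⁻¹ * (c₀ ^ 2 * Ψ h) := by
    funext h
    rw [inv_mul_cancel_left₀ (by positivity)]
  have D : IsLimitData S Ψ f := by
    refine ⟨hS, ?_, ?_, hf, hfS⟩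
    · rw [hk]
      exact continuous_const.mul H.continuous_correlation
    · rw [hk]
      exact H.integrableOn_correlation.const_mul _
  have hL0 : 0 < L := (mul_pos hc₀ hT).trans_le hL
  have hTΛ : T ≤ L / c₀ := (le_div_iff₀ hc₀).2 (by linarith)
  have hf0 : ∀ s ≤ 0, f s = 0 := fun s hs => D.pulse_eq_zero hs
  obtain ⟨ω₀⟩ : Nonempty Ω := nonempty_of_isProbabilityMeasure P
  have hM0 : 0 ≤ M := (H.smooth ω₀).nonneg
  refine ⟨limitProfile c₀ Ψ f, D.solvesLimitProblem, fun b hb τ hτ s hs => D.unique hb hτ hs,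
    D.integrableOn, fun τ _ s _ => 
      ⟨D.integrable_fourierIntegrand τ s, IsLimitData.ofReal_limitProfile τ s⟩,
    ?_, fun δ hδ => ?_⟩
  · have hsmall : ∀ᶠ ε in 𝓝[>] (0 : ℝ), ε * M ≤ 1 / 2 := by
      have h1 : Tendsto (fun ε : ℝ => ε * M) (𝓝 0) (𝓝 (0 * M)) :=
        (continuous_id.mul continuous_const).tendsto 0
      rw [zero_mul] at h1
      exact (h1.mono_left nhdsWithin_le_nhds).eventually_le_const (by norm_num)
    filter_upwards [hpu, hθ, self_mem_nhdsWithin, hsmall,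
      Ioc_mem_nhdsGT (zero_lt_one (α := ℝ))] with ε h1 h2 h3 h4 h5 ω
    have h1' := h1 ω
    have h2' := h2 ω
    rw [hc] at h1' h2'
    obtain ⟨Θ, _, F, hfront⟩ := exists_isFrontSystem hαβ (H.smooth ω) h3 h5.2 h4 hρ hc₀ hL0 le_rfl
      hf0 h1' h2'
    refine ((F.continuousOn_front (Icc 0 S)).mono
      (prod_mono (Icc_subset_Icc_right hTΛ) subset_rfl)).congr fun x hx => ?_
    rw [ha, hc]
    exact hfront x.1 ⟨hx.1.1, hx.1.2.trans hTΛ⟩ x.2 hx.2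
  · obtain ⟨η, hη, r, hr, key⟩ := exists_threshold R hαβ hρ hc₀ hL0 hS hM0 hδ hf0
      (D.isProfile (c₀ := c₀)) H.abs_correlation_le_sq
    obtain ⟨C₁, hC₁⟩ := H.mixing
    obtain ⟨C₂, hC₂⟩ := H.mixing_y
    have hd : 0 < d := by linarith [H.decay_gt]
    have t₁ := tendsto_measure_average (fun ω => (H.smooth ω).continuous)
      (fun ω => (H.smooth ω).bound) H.history_le H.adapted hd hC₁ (R.scale α β)
      (S + 2 * (L / c₀)) hη
    have t₂ := tendsto_measure_average (fun ω => (H.smooth ω).continuous_y)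
      (fun ω => (H.smooth ω).bound_y) H.history_le H.adapted_y hd hC₂ (R.scale α β)
      (S + 2 * (L / c₀)) hη
    have t₃ := H.tendsto_measure_average_mul (R.scale α β)
      (D.continuous_limitProfile (c₀ := c₀)) (S + 2 * (L / c₀)) S (h₀ := S + 1) (by linarith) hη
    have t := (t₁.add t₂).add t₃
    simp only [add_zero] at t
    refine tendsto_of_tendsto_of_tendsto_of_le_of_le' tendsto_const_nhds t
      (.of_forall fun _ => zero_le) ?_
    filter_upwards [hpu, hθ, Ioc_mem_nhdsGT hr] with ε h1 h2 h3
    refine (measure_mono ?_).trans ((measure_union_le _ _).trans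
      (add_le_add_left (measure_union_le _ _) _))
    -- outside the three exceptional events the wave front is close to the limit
    intro ω hω
    by_contra hgood
    simp only [mem_union, mem_ofPred_eq, not_or, not_exists, not_and, not_le] at hgood
    obtain ⟨⟨g₁, g₂⟩, g₃⟩ := hgood
    obtain ⟨τ, hτ, s, hs, hδω⟩ := hω
    have h1' := h1 ω
    have h2' := h2 ω
    rw [hc] at h1' h2'
    have := key ε h3.1 h3.2 (H.smooth ω) h1' h2' (fun r hr => (g₁ r hr).le)
      (fun r hr => (g₂ r hr).le) (fun r hr s hs => (g₃ (r, s) ⟨hr, hs⟩).le) τ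
      ⟨hτ.1, hτ.2.trans hTΛ⟩ s hs
    rw [ha, hc] at hδω
    exact absurd hδω (not_le.2 this)
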